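/- Consider the class of differential equations for one unknown function $\psi=\psi(t,x,y)$ $$\zeta_t+\psi_x\zeta_y-\psi_y\zeta_x=H(t,x,y,\zeta,\zeta_x,\zeta_y,\zeta_{xx},\zeta_{xy},\zeta_{yy}),\qquad \zeta:=\psi_{xx}+\psi_{yy},\tag{1}$$ where the arbitrary element $H$ runs through the smooth ($C^\infty$) real functions of its nine arguments, defined on open sets. An equation of the class is identified with the subset of the jet space $J^4$ (coordinates: $t,x,y$, $\psi$ and the derivatives of $\psi$ of order at most $4$) that it determines. All considerations are local: point transformations $\varphi\colon(t,x,y,\psi)\mapsto(\tilde t,\tilde x,\tilde y,\tilde\psi)$ are smooth maps with nonvanishing Jacobian on a connected open set $\Omega\subseteq\mathbb R^4$ whose sections $t=\mathrm{const}$ and $(t,x,y)=\mathrm{const}$ are connected (for example, a convex open set), and arbitrary elements are taken over the projection $B$ of $\Omega$ to the $(t,x,y)$-space, i.e. their domains project onto $B$. Let $I$ be the projection of $\Omega$ to the $t$-axis. An admissible transformation is a triple $(H,\tilde H,\varphi)$ such that the prolongation of $\varphi$ to $J^4$ maps the equation with arbitrary element $H$ to the one with arbitrary element $\tilde H$ (the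 domain of $\tilde H$ projecting onto the projection of $\varphi(\Omega)$): wherever the prolongation is defined over $\Omega$, a jet lies on the first equation if and only if its image lies on the second one. The (usual) equivalence group $G^\sim_2$ consists of the nondegenerate point transformations $\Phi$ of the space $J^4\times\mathbb R_H$ whose projection to $J^4$ is the prolongation of a point transformation $\varphi$ of $(t,x,y,\psi)$ and such that, for every arbitrary element $H$, the image $\Phi H$ is again an arbitrary element and $(H,\Phi H,\varphi)$ is an admissible transformation. The class is normalized if every admissible transformation $(H,\tilde H,\varphi)$ is of the form $(H,\Phi H,\varphi)$ with some $\Phi\in G^\sim_2$ that projects to $\varphi$. **Theorem.** The class (1) is normalized. Its equivalence group $G^\sim_2$ is formed by the transformations $$\tilde t=\tau,\qquad \tilde x=\lambda(x\mathfrak c-y\mathfrak s)+\gamma^1,\qquad \varepsilon\tilde y=\lambda(x\mathfrak s+y\mathfrak c)+\gamma^2,$$ $$\tilde\psi=\varepsilon\frac{\lambda}{\tau_t}\Bigl(\lambda\psi+\frac\lambda2\beta_t(x^2+y^2)-\gamma^1_t(x\mathfrak s+y\mathfrak c)+\gamma^2_t(x\mathfrak c-y\mathfrak s)\Bigr)+\delta+\frac\sigma2(x^2+y^2),$$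 $$\tilde H=\frac{\varepsilon}{\tau_t^2}\Bigl(H-\frac{\tau_{tt}}{\tau_t}\zeta-\frac{\lambda_t}{\lambda}(x\zeta_x+y\zeta_y)+2\beta_{tt}-2\frac{\tau_{tt}}{\tau_t}\beta_t\Bigr)-\frac{\delta_y+\sigma y}{\tau_t\lambda^2}\zeta_x+\frac{\delta_x+\sigma x}{\tau_t\lambda^2}\zeta_y+\frac{2}{\tau_t}\Bigl(\frac{\sigma}{\lambda^2}\Bigr)_t,$$ where $\varepsilon=\pm1$, $\mathfrak c=\cos\beta$, $\mathfrak s=\sin\beta$; $\tau,\lambda,\beta,\gamma^1,\gamma^2$ and $\sigma$ are arbitrary smooth functions of $t\in I$ satisfying $\lambda>0$ and $\tau_t\neq0$; and $\delta=\delta(t,x,y)$ is an arbitrary smooth function on $B$ that satisfies the Laplace equation $\delta_{xx}+\delta_{yy}=0$. -/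

import Mathlib

open Set Filter Topology
open scoped ContDiff

noncomputable section

namespace GenVorticity

/-- The space of the independent variables `z = (t, x, y)`: `z 0 = t`, `z 1 = x`, `z 2 = y`. -/
abbrev Base : Type := Fin 3 → ℝ

/-- The space of the independent and dependent variables `(z, ψ) = (t, x, y, ψ)`. -/
abbrev Total : Type := Base × ℝ

/-- Partial derivative with respect to the `i`-th of the variables `t, x, y`. -/
def pd (i : Fin 3) (f : Base → ℝ) (z : Base) : ℝ :=
  fderiv ℝ f z (Pi.single i 1)

/-- Multi-indices `(a, b, c)` of order `a + b + c ≤ 4`, labelling `∂ₜᵃ ∂ₓᵇ ∂ᵧᶜ`. -/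
abbrev MultiIdx : Type :=
  {α : Fin 5 × Fin 5 × Fin 5 // (α.1 : ℕ) + (α.2.1 : ℕ) + (α.2.2 : ℕ) ≤ 4}

/-- The fourth order jet space `J⁴` of real functions of `(t, x, y)`: the base point, and one
coordinate for each derivative of `ψ` of order at most four (order zero is `ψ` itself). -/
abbrev Jet : Type := Base × (MultiIdx → ℝ)

/-- The fourth order jet at `z` of a function `ψ`. -/
def jetOf (ψ : Base → ℝ) (z : Base) : Jet :=
  (z, fun α => ((pd 0)^[(α.1.1 : ℕ)] ((pd 1)^[(α.1.2.1 : ℕ)] ((pd 2)^[(α.1.2.2 : ℕ)] ψ))) z)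

/-- The jet coordinate `∂ₜᵃ ∂ₓᵇ ∂ᵧᶜ ψ`. -/
def D (j : Jet) (a b c : Fin 5) (h : (a : ℕ) + (b : ℕ) + (c : ℕ) ≤ 4 := by decide) : ℝ :=
  j.2 ⟨(a, b, c), h⟩

/-- The point `(t, x, y, ψ)` below a jet. -/
def pt (j : Jet) : Total := (j.1, D j 0 0 0)

/-- The vorticity `ζ = ψ_xx + ψ_yy`, and its derivatives, as functions on the jet space. -/
def ζ (j : Jet) : ℝ := D j 0 2 0 + D j 0 0 2
def ζ_t (j : Jet) : ℝ := D j 1 2 0 + D j 1 0 2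
def ζ_x (j : Jet) : ℝ := D j 0 3 0 + D j 0 1 2
def ζ_y (j : Jet) : ℝ := D j 0 2 1 + D j 0 0 3
def ζ_xx (j : Jet) : ℝ := D j 0 4 0 + D j 0 2 2
def ζ_xy (j : Jet) : ℝ := D j 0 3 1 + D j 0 1 3
def ζ_yy (j : Jet) : ℝ := D j 0 2 2 + D j 0 0 4

/-- The space of the arguments `(t, x, y, ζ, ζ_x, ζ_y, ζ_xx, ζ_xy, ζ_yy)` of `H`. -/
abbrev Arg : Type := Base × (Fin 6 → ℝ)

/-- The values of the arguments of `H` at a jet. -/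
def arg (j : Jet) : Arg := (j.1, ![ζ j, ζ_x j, ζ_y j, ζ_xx j, ζ_xy j, ζ_yy j])

/-- A value of the arbitrary element: a smooth function `H` of the nine arguments, on an open
set (all considerations are local). -/
structure ArbElem where
  dom : Set Arg
  isOpen_dom : IsOpen dom
  H : Arg → ℝ
  smooth : ContDiffOn ℝ ∞ H dom

/-- The region of the `(t, x, y)`-space over which `H` is defined. -/
def ArbElem.base (f : ArbElem) : Set Base := Prod.fst '' f.dom

/-- The equation `ζ_t + ψ_x ζ_y - ψ_y ζ_x = H(t, x, y, ζ, ζ_x, ζ_y, ζ_xx, ζ_xy, ζ_yy)` as a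
submanifold of the jet space. -/
def ArbElem.eqn (f : ArbElem) : Set Jet :=
  {j | arg j ∈ f.dom ∧ ζ_t j + D j 0 1 0 * ζ_y j - D j 0 0 1 * ζ_x j = f.H (arg j)}

/-- The domains `Ω` of the `(t, x, y, ψ)`-space on which point transformations are considered:
open connected sets whose sections `t = const` and `(t, x, y) = const` are connected. All
convex open sets are of this kind, so every point has arbitrarily small such neighbourhoods,
and the whole space is of this kind, too. -/
structure LocalDomain (Ω : Set Total) : Prop where
  isOpen : IsOpen Ω
  preconnected : IsPreconnected Ω
  preconnected_time : ∀ t : ℝ, IsPreconnected {p | p ∈ Ω ∧ p.1 0 = t}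
  preconnected_fiber : ∀ z : Base, IsPreconnected {p | p ∈ Ω ∧ p.1 = z}

/-- The projection of `Ω` to the `(t, x, y)`-space. -/
def base (Ω : Set Total) : Set Base := Prod.fst '' Ω

/-- The projection of `Ω` to the `t`-axis. -/
def times (Ω : Set Total) : Set ℝ := (fun p : Total => p.1 0) '' Ω

/-- Point transformations `(z, ψ) ↦ (Z(z, ψ), Ψ(z, ψ))` on `Ω`: smooth, with nonvanishing
Jacobian. -/
def IsPointTransf (Ω : Set Total) (φ : Total → Total) : Prop :=
  ContDiffOn ℝ ∞ φ Ω ∧ ∀ p ∈ Ω, (fderiv ℝ φ p).det ≠ 0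

/-- The fourth prolongation of `φ`, as a relation: `φ` carries the jet `j` over `Ω` to `j'` if
`j` is the jet of a smooth function `ψ` whose graph is mapped by `φ`, near the point considered,
to the graph of a smooth function `ψ'` with the jet `j'`. -/
def Prolong (Ω : Set Total) (φ : Total → Total) (j j' : Jet) : Prop :=
  pt j ∈ Ω ∧ ∃ ψ ψ' : Base → ℝ,
    ContDiffAt ℝ ∞ ψ j.1 ∧ jetOf ψ j.1 = j ∧
    ContDiffAt ℝ ∞ ψ' j'.1 ∧ jetOf ψ' j'.1 = j' ∧
    j'.1 = (φ (pt j)).1 ∧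
    ∀ᶠ w in 𝓝 j.1, ψ' (φ (w, ψ w)).1 = (φ (w, ψ w)).2

/-- The jets on which the prolongation of `φ` is defined. -/
def jetDom (Ω : Set Total) (φ : Total → Total) : Set Jet := {j | ∃ j', Prolong Ω φ j j'}

/-- `(f, f', φ)` is an admissible transformation of the class: `φ` is a point transformation on
`Ω`, the elements `f` and `f'` live over `Ω` and over its image, and the prolongation of `φ` maps
the equation with the arbitrary element `f` to the one with `f'`. -/
structure IsAdmissible (Ω : Set Total) (f f' : ArbElem) (φ : Total → Total) : Prop where
  pointTransf : IsPointTransf Ω φ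
  source : f.base = base Ω
  target : f'.base = base (φ '' Ω)
  maps_eqn : ∀ j j', Prolong Ω φ j j' → (j ∈ f.eqn ↔ j' ∈ f'.eqn)

/-- `f' = Φ f` for the transformation `Φ` of the space of `(t, x, y, ψ₍₄₎, H)` whose part on the
jet space is the prolongation of `φ` and whose `H`-component is `K`: at corresponding jets, `f'`
is defined if and only if `f` is, and `Φ` carries the value of `f` to the value of `f'`. -/
def Transforms (Ω : Set Total) (φ : Total → Total) (K : Jet → ℝ → ℝ) (f f' : ArbElem) : Prop :=
  ∀ j j', Prolong Ω φ j j' →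
    (arg j ∈ f.dom ↔ arg j' ∈ f'.dom) ∧
    (arg j ∈ f.dom → f'.H (arg j') = K j (f.H (arg j)))

/-- The usual equivalence group: transformations `Φ` of the space of `(t, x, y, ψ₍₄₎, H)` that
project to the prolongation of a point transformation `φ`, have a smooth `H`-component
`K(j, H)` with `∂K/∂H ≠ 0`, and induce, for every arbitrary element `f` over `Ω`, an admissible
transformation `(f, Φ f, φ)`. -/
structure IsEquivTransf (Ω : Set Total) (φ : Total → Total) (K : Jet → ℝ → ℝ) : Prop where
  pointTransf : IsPointTransf Ω φ
  smooth : ContDiffOn ℝ ∞ (fun q : Jet × ℝ => K q.1 q.2) {q | q.1 ∈ jetDom Ω φ}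
  nondegenerate : ∀ j ∈ jetDom Ω φ, ∀ h : ℝ, deriv (K j) h ≠ 0
  admissible : ∀ f : ArbElem, f.base = base Ω →
    ∃ f' : ArbElem, Transforms Ω φ K f f' ∧ IsAdmissible Ω f f' φ

/-- The class is normalized: every admissible transformation is induced by an element of the
equivalence group. -/
def IsNormalized : Prop :=
  ∀ Ω : Set Total, LocalDomain Ω → ∀ (f f' : ArbElem) (φ : Total → Total),
    IsAdmissible Ω f f' φ →
      ∃ K : Jet → ℝ → ℝ, IsEquivTransf Ω φ K ∧ Transforms Ω φ K f f'

end GenVorticity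

end

/-! The engine is a perturbation argument at a single jet. `H` does not involve `ψ_x`, `ψ_y` or
`ζ_t`, so a jet stays on its equation when `ψ` is changed in such a way that the arguments of `H`
and the left hand side keep their values. Admissibility then forces the image jet to stay on the
other equation, and this is a condition on `φ`. The computations take place in the ring of germs of
smooth functions; the image of a graph transversal to `φ` is described there by a bijective pullback
(`Transversal.bijective_pull`, `IsAdmissible.exists_perturbation`).

Adding `(t - t₀) k` to `ψ` changes, among the quantities in the equation at `t₀`, only `ζ_t`, namely
by `Δk`, provided that the spatial gradient of the summand vanishes there, which its factor `t - t₀`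
ensures (`Solves.add_time_mul_iff`). Three choices of `k` are used. If `k` is `t - t₀` times the
increment of the new time along the graph, the old time turns out to have no spatial gradient in the
new coordinates, so the new time depends on `t` alone (`IsAdmissible.fderiv_time`). The harmonic
polynomials `x² - y²` and `xy` show that the plane is mapped conformally along each transversal
graph; comparing graphs of different slopes, the new `x, y` do not involve `ψ`
(`IsAdmissible.fderiv_vertical`). Finally `k = x` and `k = y` show that `∂ψ'/∂ψ` depends on `t`
alone. Hence `φ` is conformal in the plane and of the form `κ(t) ψ + χ(t, x, y)` in the last
component (`IsAdmissible.exists_conformalForm`).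

Perturbing `ψ` by `αx + βy + s t x²/2`, centred at the point, with `s + α ζ_y - β ζ_x = 0` gives
that the pulled back new vorticity has gradient `ε/τ_t` times that of the old one
(`ConformalForm.grad_vorticity`). On the other hand `m ζ' = κ ζ + Δχ` with the conformal factor `m`.
Since `ζ, ζ_x, ζ_y` vary over an open set, `m` and `Δχ` depend on `t` alone and `τ_t κ = ε m`
(`ConformalForm.conditions`). A conformal map whose factor is constant in space is a similarity;
lifting its rotation to an angle and splitting `χ` yields the stated formulas
(`ConformalForm.exists_normalForm`).

Conversely, for a transformation of the stated form the arguments of `H` at the image jet are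
functions of the arguments at the source, and the left hand side changes by the affine bijection
`elemForm` (`NormalForm.args_eq`, `NormalForm.lhs_eq`). So every arbitrary element is carried to
one. As `ζ_t` is free, the target element of an admissible transformation is determined by the
source and `φ` (`NormalForm.transforms`), which gives normalization; constant elements determine the
`H`-component of a group element. -/

noncomputable section

namespace GenVorticity

/-! ### Germs of smooth functions, their derivations and pullbacks. -/

/-- The ring of germs at `z` of functions that are smooth at `z`. -/
def smoothGermSubring (z : Base) : Subring (Germ (𝓝 z) ℝ) where
  carrier := {a | ∃ f : Base → ℝ, ContDiffAt ℝ ∞ f z ∧ (f : Germ (𝓝 z) ℝ) = a}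
  mul_mem' := by
    rintro _ _ ⟨f, hf, rfl⟩ ⟨g, hg, rfl⟩
    exact ⟨f * g, hf.mul hg, rfl⟩
  one_mem' := ⟨1, contDiffAt_const, rfl⟩
  add_mem' := by
    rintro _ _ ⟨f, hf, rfl⟩ ⟨g, hg, rfl⟩
    exact ⟨f + g, hf.add hg, rfl⟩
  zero_mem' := ⟨0, contDiffAt_const, rfl⟩
  neg_mem' := by
    rintro _ ⟨f, hf, rfl⟩
    exact ⟨-f, hf.neg, rfl⟩

/-- The type of germs of smooth functions at `z`. -/
def SGerm (z : Base) : Type := smoothGermSubring z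

namespace SGerm

instance (z : Base) : CommRing (SGerm z) := inferInstanceAs (CommRing (smoothGermSubring z))

variable {z z' : Base}

/-- The germ of a function that is smooth at `z`. -/
def of (f : Base → ℝ) (hf : ContDiffAt ℝ ∞ f z) : SGerm z := ⟨(f : Germ (𝓝 z) ℝ), f, hf, rfl⟩

theorem exists_rep (a : SGerm z) : ∃ (f : Base → ℝ) (hf : ContDiffAt ℝ ∞ f z), of f hf = a := by
  obtain ⟨_, f, hf, rfl⟩ := a
  exact ⟨f, hf, rfl⟩

theorem of_eq_of {f g : Base → ℝ} {hf : ContDiffAt ℝ ∞ f z} {hg : ContDiffAt ℝ ∞ g z} :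
    of f hf = of g hg ↔ f =ᶠ[𝓝 z] g := by
  rw [← Germ.coe_eq]
  exact Subtype.ext_iff

theorem of_add {f g : Base → ℝ} (hf : ContDiffAt ℝ ∞ f z) (hg : ContDiffAt ℝ ∞ g z) :
    of f hf + of g hg = of (fun w => f w + g w) (hf.add hg) := rfl

theorem of_mul {f g : Base → ℝ} (hf : ContDiffAt ℝ ∞ f z) (hg : ContDiffAt ℝ ∞ g z) :
    of f hf * of g hg = of (fun w => f w * g w) (hf.mul hg) := rfl

theorem of_sub {f g : Base → ℝ} (hf : ContDiffAt ℝ ∞ f z) (hg : ContDiffAt ℝ ∞ g z) :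
    of f hf - of g hg = of (fun w => f w - g w) (hf.sub hg) := rfl

/-- The value of a germ. -/
def ev (z : Base) : SGerm z →+* ℝ := Germ.valueRingHom.comp (smoothGermSubring z).subtype

@[simp] theorem ev_of (f : Base → ℝ) (hf : ContDiffAt ℝ ∞ f z) : ev z (of f hf) = f z := rfl

/-- Constant germs. -/
def C (z : Base) : ℝ →+* SGerm z where
  toFun c := of (fun _ => c) contDiffAt_const
  map_one' := rfl
  map_mul' _ _ := rfl
  map_zero' := rfl
  map_add' _ _ := rfl

theorem C_apply (c : ℝ) : C z c = of (fun _ => c) contDiffAt_const := rfl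

@[simp] theorem ev_C (c : ℝ) : ev z (C z c) = c := rfl

/-- The coordinate `w ↦ w i - z i` vanishing at `z`. -/
def X (z : Base) (i : Fin 3) : SGerm z := of (fun w => w i - z i) (by fun_prop)

@[simp] theorem ev_X (i : Fin 3) : ev z (X z i) = 0 := by simp [X]

/-- A smooth function with nonzero value has a smooth reciprocal nearby. Nonvanishing factors can
thus be inverted or cancelled as germs, before any derivative is taken. -/
theorem isUnit_iff {a : SGerm z} : IsUnit a ↔ ev z a ≠ 0 := by
  refine ⟨fun h => (h.map (ev z)).ne_zero, fun h => ?_⟩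
  obtain ⟨f, hf, rfl⟩ := a.exists_rep
  rw [ev_of] at h
  refine IsUnit.of_mul_eq_one (of (fun w => (f w)⁻¹) (hf.inv h)) ?_
  rw [of_mul, ← map_one (C z), C_apply, of_eq_of]
  filter_upwards [hf.continuousAt.eventually_ne h] with w hw
  exact mul_inv_cancel₀ hw

theorem contDiffAt_pd {f : Base → ℝ} (hf : ContDiffAt ℝ ∞ f z) (i : Fin 3) :
    ContDiffAt ℝ ∞ (pd i f) z :=
  (hf.fderiv_right (m := ∞) (by simp)).clm_apply contDiffAt_const

theorem pd_congr {f g : Base → ℝ} (h : f =ᶠ[𝓝 z] g) (i : Fin 3) : pd i f =ᶠ[𝓝 z] pd i g := by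
  filter_upwards [h.fderiv (𝕜 := ℝ)] with w hw
  simp only [pd, hw]

theorem eventually_differentiableAt {E F : Type*} [NormedAddCommGroup E] [NormedSpace ℝ E]
    [NormedAddCommGroup F] [NormedSpace ℝ F] {f : E → F} {x : E} (hf : ContDiffAt ℝ ∞ f x) :
    ∀ᶠ w in 𝓝 x, DifferentiableAt ℝ f w := by
  filter_upwards [(hf.of_le (m := 1) (by simp)).eventually (by simp)] with w hw
  exact hw.differentiableAt (by simp)

/-- The underlying function of the partial derivative. -/
def pdFun (i : Fin 3) (a : SGerm z) : SGerm z :=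
  ⟨Germ.map' (pd i) (fun _ _ h => pd_congr h i) a.1, by
    obtain ⟨_, f, hf, rfl⟩ := a
    exact ⟨pd i f, contDiffAt_pd hf i, rfl⟩⟩

theorem pdFun_of (i : Fin 3) {f : Base → ℝ} (hf : ContDiffAt ℝ ∞ f z) :
    pdFun i (of f hf) = of (pd i f) (contDiffAt_pd hf i) := rfl

/-- The partial derivatives as derivations of the ring of germs. -/
def d (z : Base) (i : Fin 3) : Derivation ℤ (SGerm z) (SGerm z) :=
  Derivation.mk'
    (AddMonoidHom.toIntLinearMap
      { toFun := pdFun i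
        map_zero' := by
          have : (0 : SGerm z) = of (fun _ => (0 : ℝ)) contDiffAt_const := rfl
          rw [this, pdFun_of, of_eq_of]
          exact Eventually.of_forall fun w => by simp [pd]
        map_add' := fun a b => by
          obtain ⟨f, hf, rfl⟩ := a.exists_rep
          obtain ⟨g, hg, rfl⟩ := b.exists_rep
          rw [of_add, pdFun_of, pdFun_of, pdFun_of, of_add, of_eq_of]
          filter_upwards [eventually_differentiableAt hf, eventually_differentiableAt hg]
            with w h₁ h₂
          simp [pd, fderiv_fun_add h₁ h₂] })
    (fun a b => by
      obtain ⟨f, hf, rfl⟩ := a.exists_rep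
      obtain ⟨g, hg, rfl⟩ := b.exists_rep
      change pdFun i (of f hf * of g hg) = of f hf * pdFun i (of g hg) + of g hg * pdFun i (of f hf)
      rw [of_mul, pdFun_of, pdFun_of, pdFun_of, of_mul, of_mul, of_add, of_eq_of]
      filter_upwards [eventually_differentiableAt hf, eventually_differentiableAt hg] with w h₁ h₂
      simp [pd, fderiv_fun_mul h₁ h₂])

theorem d_of (i : Fin 3) {f : Base → ℝ} (hf : ContDiffAt ℝ ∞ f z) :
    d z i (of f hf) = of (pd i f) (contDiffAt_pd hf i) := rfl

@[simp] theorem d_C (i : Fin 3) (c : ℝ) : d z i (C z c) = 0 := by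
  rw [C_apply, d_of, ← map_zero (C z), C_apply, of_eq_of]
  exact Eventually.of_forall fun w => by simp [pd]

theorem d_mul (i : Fin 3) (a b : SGerm z) : d z i (a * b) = a * d z i b + b * d z i a := by
  simp

theorem d_X (i j : Fin 3) : d z i (X z j) = if i = j then 1 else 0 := by
  have h : ∀ w : Base, pd i (fun w : Base => w j - z j) w = if i = j then 1 else 0 := fun w => by
    have : HasFDerivAt (fun w : Base => w j - z j)
        (ContinuousLinearMap.proj (R := ℝ) (φ := fun _ : Fin 3 => ℝ) j) w :=
      (ContinuousLinearMap.proj (R := ℝ) (φ := fun _ : Fin 3 => ℝ) j).hasFDerivAt.sub_const _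
    simp [pd, this.fderiv, Pi.single_apply, eq_comm]
  rw [X, d_of]
  split_ifs with hij
  · rw [← map_one (C z), C_apply, of_eq_of]
    exact Eventually.of_forall fun w => (h w).trans (if_pos hij)
  · rw [← map_zero (C z), C_apply, of_eq_of]
    exact Eventually.of_forall fun w => (h w).trans (if_neg hij)

@[simp] theorem d_X_self (i : Fin 3) : d z i (X z i) = 1 := by simp [d_X]

theorem d_X_ne {i j : Fin 3} (h : i ≠ j) : d z i (X z j) = 0 := by simp [d_X, h]

theorem d_comm (i j : Fin 3) (a : SGerm z) : d z i (d z j a) = d z j (d z i a) := by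
  obtain ⟨f, hf, rfl⟩ := a.exists_rep
  simp only [d_of]
  rw [of_eq_of]
  filter_upwards [(contDiffAt_infty.1 hf 2).eventually (by simp)] with w hw
  have h2 : DifferentiableAt ℝ (fderiv ℝ f) w :=
    (hw.fderiv_right (m := 1) (by norm_num)).differentiableAt (by simp)
  have hs : IsSymmSndFDerivAt ℝ f w := hw.isSymmSndFDerivAt (by simp)
  have key : ∀ i j : Fin 3, pd i (pd j f) w
      = fderiv ℝ (fderiv ℝ f) w (Pi.single i 1) (Pi.single j 1) := fun i j => by
    have : pd j f = fun y => fderiv ℝ f y (Pi.single j 1) := rfl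
    rw [pd, this, fderiv_clm_apply h2 (differentiableAt_const _)]
    simp
  rw [key, key, hs.eq]

/-- The pullback of germs along a smooth map. -/
def pull (F : Base → Base) (hF : ContDiffAt ℝ ∞ F z) (h : F z = z') : SGerm z' →+* SGerm z where
  toFun a := ⟨a.1.compTendsto F (h ▸ hF.continuousAt), by
    obtain ⟨_, f, hf, rfl⟩ := a
    subst h
    exact ⟨f ∘ F, hf.comp z hF, rfl⟩⟩
  map_one' := rfl
  map_zero' := rfl
  map_mul' a b := by
    obtain ⟨f, hf, rfl⟩ := a.exists_rep
    obtain ⟨g, hg, rfl⟩ := b.exists_rep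
    rfl
  map_add' a b := by
    obtain ⟨f, hf, rfl⟩ := a.exists_rep
    obtain ⟨g, hg, rfl⟩ := b.exists_rep
    rfl

theorem pull_of {F : Base → Base} (hF : ContDiffAt ℝ ∞ F z) (h : F z = z') {f : Base → ℝ}
    (hf : ContDiffAt ℝ ∞ f z') :
    pull F hF h (of f hf) = of (fun w => f (F w)) (by subst h; exact hf.comp z hF) := rfl

@[simp] theorem ev_pull {F : Base → Base} (hF : ContDiffAt ℝ ∞ F z) (h : F z = z') (a : SGerm z') :
    ev z (pull F hF h a) = ev z' a := by
  obtain ⟨f, hf, rfl⟩ := a.exists_rep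
  simp [pull_of, h]

theorem pull_X {F : Base → Base} (hF : ContDiffAt ℝ ∞ F z) (h : F z = z') (i : Fin 3) :
    pull F hF h (X z' i) = of (fun w => F w i) (contDiffAt_pi.1 hF i) - C z (z' i) := rfl

theorem fderiv_eq_sum (g : Base → ℝ) (w v : Base) : fderiv ℝ g w v = ∑ j, v j * pd j g w := by
  conv_lhs => rw [← Finset.univ_sum_single v]
  rw [map_sum]
  refine Finset.sum_congr rfl fun j _ => ?_
  have : (Pi.single j (v j) : Base) = v j • Pi.single j 1 := by
    rw [← Pi.single_smul, smul_eq_mul, mul_one]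
  rw [this, map_smul, smul_eq_mul, pd]

/-- The chain rule. -/
theorem d_pull {F : Base → Base} (hF : ContDiffAt ℝ ∞ F z) (h : F z = z') (i : Fin 3)
    (a : SGerm z') :
    d z i (pull F hF h a) = ∑ j, d z i (pull F hF h (X z' j)) * pull F hF h (d z' j a) := by
  obtain ⟨f, hf, rfl⟩ := a.exists_rep
  subst h
  simp only [Fin.sum_univ_three, pull_X, map_sub, d_C, sub_zero, pull_of, d_of, of_mul, of_add]
  rw [of_eq_of]
  filter_upwards [hF.continuousAt.eventually (eventually_differentiableAt hf),
    eventually_differentiableAt hF] with w h₁ h₂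
  have h₃ : ∀ j, pd i (fun w => F w j) w = fderiv ℝ F w (Pi.single i 1) j := fun j => by
    have := (hasFDerivAt_pi'.1 h₂.hasFDerivAt j).fderiv
    rw [pd, this]
    rfl
  have h₄ := fderiv_comp w h₁ h₂
  rw [Function.comp_def] at h₄
  rw [pd, h₄, ContinuousLinearMap.comp_apply, fderiv_eq_sum, Fin.sum_univ_three, h₃, h₃, h₃]

end SGerm

/-! ### The equation and fourth order jets in terms of germs. -/

namespace SGerm

variable {z z' : Base}

/-- The Laplacian in `x, y` of a germ. -/
def lap (a : SGerm z) : SGerm z := d z 1 (d z 1 a) + d z 2 (d z 2 a)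

theorem lap_add (a b : SGerm z) : lap (a + b) = lap a + lap b := by
  simp only [lap, map_add]; ring

theorem lap_mul (a b : SGerm z) :
    lap (a * b) = a * lap b + 2 * (d z 1 a * d z 1 b + d z 2 a * d z 2 b) + b * lap a := by
  simp only [lap, d_mul, map_add]; ring

/-- The arguments of the arbitrary element at the jet of a germ. -/
def args (a : SGerm z) : Arg :=
  (z, ![ev z (lap a), ev z (d z 1 (lap a)), ev z (d z 2 (lap a)), ev z (d z 1 (d z 1 (lap a))),
    ev z (d z 1 (d z 2 (lap a))), ev z (d z 2 (d z 2 (lap a)))])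

/-- The left hand side of the equation at the jet of a germ. -/
def lhs (a : SGerm z) : ℝ :=
  ev z (d z 0 (lap a)) + ev z (d z 1 a) * ev z (d z 2 (lap a))
    - ev z (d z 2 a) * ev z (d z 1 (lap a))

/-- The jet of `a` satisfies the equation with the arbitrary element `f`. -/
def Solves (f : ArbElem) (a : SGerm z) : Prop := args a ∈ f.dom ∧ lhs a = f.H (args a)

theorem iterate_d_of (i : Fin 3) (n : ℕ) {f : Base → ℝ} (hf : ContDiffAt ℝ ∞ f z) :
    ∃ h : ContDiffAt ℝ ∞ ((pd i)^[n] f) z, (d z i)^[n] (of f hf) = of ((pd i)^[n] f) h := by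
  induction n with
  | zero => exact ⟨hf, rfl⟩
  | succ n ih =>
    obtain ⟨h, e⟩ := ih
    rw [Function.iterate_succ_apply', Function.iterate_succ_apply', e, d_of]
    exact ⟨contDiffAt_pd h i, rfl⟩

/-- The fourth order jet of a germ. -/
def jet (a : SGerm z) : Jet :=
  (z, fun α => ev z ((d z 0)^[(α.1.1 : ℕ)] ((d z 1)^[(α.1.2.1 : ℕ)]
    ((d z 2)^[(α.1.2.2 : ℕ)] a))))

theorem jet_of {f : Base → ℝ} (hf : ContDiffAt ℝ ∞ f z) : jet (of f hf) = jetOf f z := by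
  refine Prod.ext rfl (funext fun α => ?_)
  obtain ⟨h₁, e₁⟩ := iterate_d_of 2 (α.1.2.2 : ℕ) hf
  obtain ⟨h₂, e₂⟩ := iterate_d_of 1 (α.1.2.1 : ℕ) h₁
  obtain ⟨h₃, e₃⟩ := iterate_d_of 0 (α.1.1 : ℕ) h₂
  simp only [jet, jetOf, e₁, e₂, e₃, ev_of]

theorem pt_jet (a : SGerm z) : pt (jet a) = (z, ev z a) := rfl

theorem ζ_jet (a : SGerm z) : ζ (jet a) = ev z (lap a) := by
  simp only [lap, map_add]
  rfl

theorem ζ_x_jet (a : SGerm z) : ζ_x (jet a) = ev z (d z 1 (lap a)) := by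
  simp only [lap, map_add]
  rfl

/-- Jet coordinates fix the order `∂ₜ ∂ₓ ∂ᵧ` of differentiation, so `∂ᵧ` has to be commuted past
`∂ₓ` before both sides agree by definition. -/
theorem ζ_y_jet (a : SGerm z) : ζ_y (jet a) = ev z (d z 2 (lap a)) := by
  simp only [lap, map_add]
  rw [d_comm 2 1 (d z 1 a), d_comm 2 1 a]
  rfl

theorem arg_jet (a : SGerm z) : arg (jet a) = args a := by
  refine Prod.ext rfl ?_
  simp only [arg, args, ζ_x_jet, ζ_y_jet, ζ_jet]
  have h₁ : ζ_xx (jet a) = ev z (d z 1 (d z 1 (lap a))) := by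
    simp only [lap, map_add]
    rfl
  have h₂ : ζ_xy (jet a) = ev z (d z 1 (d z 2 (lap a))) := by
    simp only [lap, map_add]
    rw [d_comm 2 1 (d z 1 a), d_comm 2 1 a]
    rfl
  have h₃ : ζ_yy (jet a) = ev z (d z 2 (d z 2 (lap a))) := by
    simp only [lap, map_add]
    rw [d_comm 2 1 (d z 1 a), d_comm 2 1 a, d_comm 2 1 (d z 1 (d z 2 a)), d_comm 2 1 (d z 2 a)]
    rfl
  rw [h₁, h₂, h₃]

theorem lhs_jet (a : SGerm z) :
    ζ_t (jet a) + D (jet a) 0 1 0 * ζ_y (jet a) - D (jet a) 0 0 1 * ζ_x (jet a) = lhs a := by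
  have h : ζ_t (jet a) = ev z (d z 0 (lap a)) := by
    simp only [lap, map_add]
    rfl
  rw [lhs, h, ζ_x_jet, ζ_y_jet]
  rfl

theorem jet_mem_eqn (f : ArbElem) (a : SGerm z) : jet a ∈ f.eqn ↔ Solves f a := by
  simp only [ArbElem.eqn, mem_ofPred_eq, arg_jet, lhs_jet, Solves]

theorem iterate_d_mul_X_pow {u : SGerm z} {i : Fin 3} (hu : d z i u = 0) (m n : ℕ) :
    (d z i)^[n] (u * X z i ^ m) = u * m.descFactorial n * X z i ^ (m - n) := by
  induction n with
  | zero => simp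
  | succ n ih =>
    rw [Function.iterate_succ_apply', ih, d_mul, d_mul, hu, Derivation.leibniz_pow,
      Derivation.map_natCast, d_X_self, Nat.descFactorial_succ, Nat.sub_sub]
    simp only [nsmul_eq_mul, smul_eq_mul, Nat.cast_mul]
    ring

theorem ev_descFactorial (m n : ℕ) (i : Fin 3) :
    (m.descFactorial n : ℝ) * ev z (X z i) ^ (m - n) = if m = n then (n.factorial : ℝ) else 0 := by
  rcases lt_trichotomy m n with h | h | h
  · rw [Nat.descFactorial_of_lt h, if_neg h.ne]; simp
  · subst h; simp [Nat.descFactorial_self]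
  · rw [ev_X, zero_pow (Nat.sub_pos_of_lt h).ne', if_neg h.ne']; simp

/-- Up to factorials the derivatives at `z` are dual to the centred monomials; Taylor polynomials
therefore realise every jet. -/
theorem ev_iterate_d_monomial (c : ℝ) (k l m a b e : ℕ) :
    ev z ((d z 0)^[a] ((d z 1)^[b] ((d z 2)^[e] (C z c * X z 0 ^ k * X z 1 ^ l * X z 2 ^ m)))) =
      if k = a ∧ l = b ∧ m = e then c * a.factorial * b.factorial * e.factorial else 0 := by
  have h01 : d z 0 (X z 1) = 0 := d_X_ne (by decide)
  have h02 : d z 0 (X z 2) = 0 := d_X_ne (by decide)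
  have h10 : d z 1 (X z 0) = 0 := d_X_ne (by decide)
  have h12 : d z 1 (X z 2) = 0 := d_X_ne (by decide)
  have h20 : d z 2 (X z 0) = 0 := d_X_ne (by decide)
  have h21 : d z 2 (X z 1) = 0 := d_X_ne (by decide)
  rw [iterate_d_mul_X_pow (by simp [Derivation.leibniz_pow, h20, h21]),
    show C z c * X z 0 ^ k * X z 1 ^ l * (m.descFactorial e : SGerm z) * X z 2 ^ (m - e)
      = (C z c * X z 0 ^ k * (m.descFactorial e : SGerm z) * X z 2 ^ (m - e)) * X z 1 ^ l by ring,
    iterate_d_mul_X_pow (by simp [Derivation.leibniz_pow, h10, h12]),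
    show C z c * X z 0 ^ k * (m.descFactorial e : SGerm z) * X z 2 ^ (m - e)
        * (l.descFactorial b : SGerm z) * X z 1 ^ (l - b)
      = (C z c * (m.descFactorial e : SGerm z) * X z 2 ^ (m - e)
        * (l.descFactorial b : SGerm z) * X z 1 ^ (l - b)) * X z 0 ^ k by ring,
    iterate_d_mul_X_pow (by simp [Derivation.leibniz_pow, h01, h02])]
  simp only [map_mul, map_natCast, map_pow, ev_C]
  have h0 := ev_descFactorial (z := z) k a 0
  have h1 := ev_descFactorial (z := z) l b 1
  have h2 := ev_descFactorial (z := z) m e 2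
  calc _ = c * ((k.descFactorial a : ℝ) * ev z (X z 0) ^ (k - a))
        * ((l.descFactorial b : ℝ) * ev z (X z 1) ^ (l - b))
        * ((m.descFactorial e : ℝ) * ev z (X z 2) ^ (m - e)) := by ring
    _ = _ := by
      rw [h0, h1, h2]
      split_ifs <;> simp_all

theorem iterate_d_sum {ι : Type*} (s : Finset ι) (g : ι → SGerm z) (i : Fin 3) (n : ℕ) :
    (d z i)^[n] (∑ α ∈ s, g α) = ∑ α ∈ s, (d z i)^[n] (g α) := by
  induction n with
  | zero => rfl
  | succ n ih => simp only [Function.iterate_succ_apply', ih, map_sum]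

/-- Every jet is the jet of a germ. -/
theorem exists_jet_eq (j : Jet) : ∃ a : SGerm j.1, jet a = j := by
  obtain ⟨z, v⟩ := j
  refine ⟨∑ α : MultiIdx, C z (v α / ((α.1.1 : ℕ).factorial * (α.1.2.1 : ℕ).factorial
    * (α.1.2.2 : ℕ).factorial)) * X z 0 ^ (α.1.1 : ℕ) * X z 1 ^ (α.1.2.1 : ℕ)
    * X z 2 ^ (α.1.2.2 : ℕ), Prod.ext rfl (funext fun α => ?_)⟩
  simp only [jet, iterate_d_sum, map_sum, ev_iterate_d_monomial]
  rw [Finset.sum_eq_single α]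
  · have h : ∀ n : ℕ, (n.factorial : ℝ) ≠ 0 := fun n => by exact_mod_cast n.factorial_ne_zero
    simp only [and_self, if_true]
    field_simp [h]
  · intro β _ hne
    rw [if_neg]
    rintro ⟨h₁, h₂, h₃⟩
    exact hne (Subtype.ext (Prod.ext (Fin.ext h₁) (Prod.ext (Fin.ext h₂) (Fin.ext h₃))))
  · simp

end SGerm

/-! ### Taylor expansion with a smooth remainder. -/

open MeasureTheory in
/-- Integrals over `[0, 1]` depend smoothly on parameters. -/
theorem contDiffOn_integral_unit {P : Type*} [NormedAddCommGroup P] [NormedSpace ℝ P] {n : ℕ∞}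
    {s : Set P} (hs : IsOpen s) {G : P × ℝ → ℝ} (hG : ContDiffOn ℝ n G (s ×ˢ Ioo (-1) 2)) :
    ContDiffOn ℝ n (fun p => ∫ θ in (0 : ℝ)..1, G (p, θ)) s := by
  -- `χ` is `1` on `[0, 1]` and vanishes outside `(-1/2, 3/2)`, well inside the interval where `G`
  -- is smooth, so `χ G` extends by zero to all `θ`.
  let χ : ContDiffBump (1 / 2 : ℝ) := ⟨1 / 2, 1, by norm_num, by norm_num⟩
  let g : P → ℝ → ℝ := fun p θ => χ θ * G (p, θ)
  have hk : Metric.closedBall (1 / 2 : ℝ) 1 ⊆ Ioo (-1) 2 := by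
    intro θ hθ
    rw [Metric.mem_closedBall, Real.dist_eq, abs_le] at hθ
    constructor <;> linarith [hθ.1, hθ.2]
  have hχ : ∀ θ ∉ Metric.closedBall (1 / 2 : ℝ) 1, χ θ = 0 := fun θ hθ => by
    refine χ.zero_of_le_dist ?_
    rw [Metric.mem_closedBall, not_le] at hθ
    exact hθ.le
  have hg : ContDiffOn ℝ n ↿g (s ×ˢ univ) := by
    rintro ⟨p, θ⟩ ⟨hp, -⟩
    by_cases hθ : θ ∈ Ioo (-1 : ℝ) 2
    · have h₁ : ContDiffAt ℝ n G (p, θ) :=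
        hG.contDiffAt ((hs.prod isOpen_Ioo).mem_nhds ⟨hp, hθ⟩)
      have h₂ : ContDiffAt ℝ n (fun q : P × ℝ => χ q.2) (p, θ) :=
        (χ.contDiff.contDiffAt).comp (p, θ) contDiffAt_snd
      exact (h₂.mul h₁).contDiffWithinAt
    · have h : ↿g =ᶠ[𝓝 (p, θ)] fun _ => 0 := by
        have : ∀ᶠ q : P × ℝ in 𝓝 (p, θ), q.2 ∉ Metric.closedBall (1 / 2 : ℝ) 1 :=
          continuousAt_snd.eventually
            (Metric.isClosed_closedBall.isOpen_compl.mem_nhds fun h => hθ (hk h))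
        filter_upwards [this] with q hq
        change χ q.2 * G (q.1, q.2) = 0
        rw [hχ _ hq, zero_mul]
      exact (contDiffAt_const.congr_of_eventuallyEq h).contDiffWithinAt
  -- The integral over `[0, 1]` is the value at `0` of the convolution of `χ G` with the indicator
  -- of `[-1, 0]`, and convolution is smooth in parameters.
  have key := contDiffOn_convolution_right_with_param_comp (μ := volume) (𝕜 := ℝ)
    (ContinuousLinearMap.mul ℝ ℝ) (v := fun _ : P => (0 : ℝ)) (n := n) contDiffOn_const
    (f := indicator (Icc (-1 : ℝ) 0) fun _ => (1 : ℝ)) (g := g) hs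
    (isCompact_closedBall (1 / 2 : ℝ) 1)
    (fun p θ _ hθ => by simp only [g, hχ θ hθ, zero_mul])
    ((integrable_indicator_iff measurableSet_Icc).2
      (integrableOn_const (by simp))).locallyIntegrable hg
  refine key.congr fun p _ => ?_
  rw [convolution]
  have h₁ : ∀ t : ℝ, (ContinuousLinearMap.mul ℝ ℝ) (indicator (Icc (-1 : ℝ) 0) (fun _ => (1 : ℝ)) t)
      (g p (0 - t)) = indicator (Icc (-1 : ℝ) 0) (fun t => g p (-t)) t := fun t => by
    by_cases ht : t ∈ Icc (-1 : ℝ) 0 <;> simp [ht]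
  simp_rw [h₁]
  rw [integral_indicator measurableSet_Icc, integral_Icc_eq_integral_Ioc,
    ← intervalIntegral.integral_of_le (by norm_num),
    intervalIntegral.integral_comp_neg (fun t => g p t), neg_zero, neg_neg]
  refine intervalIntegral.integral_congr fun θ hθ => ?_
  rw [uIcc_of_le zero_le_one] at hθ
  have : χ θ = 1 := χ.one_of_mem_closedBall (by
    rw [Metric.mem_closedBall, Real.dist_eq, abs_le]
    constructor <;> linarith [hθ.1, hθ.2])
  simp only [g, this, one_mul]

/-- Taylor expansion in the last variable, with a smooth remainder. -/
theorem exists_taylor {S : Total → ℝ} {z : Base} {y : ℝ} (hS : ContDiffAt ℝ ∞ S (z, y)) :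
    ∃ Q : Base × ℝ × ℝ → ℝ, ContDiffAt ℝ ∞ Q (z, y, 0) ∧ ∀ᶠ q in 𝓝 ((z, y, 0) : Base × ℝ × ℝ),
      S (q.1, q.2.1 + q.2.2)
        = S (q.1, q.2.1) + fderiv ℝ S (q.1, q.2.1) (0, 1) * q.2.2 + q.2.2 ^ 2 * Q q := by
  let e : Total := (0, 1)
  let S₁ : Total → ℝ := fun p => fderiv ℝ S p e
  let S₂ : Total → ℝ := fun p => fderiv ℝ S₁ p e
  let m : (Base × ℝ × ℝ) × ℝ → Total := fun q => (q.1.1, q.1.2.1 + q.2 * q.1.2.2)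
  have hm : ContDiff ℝ ∞ m := by fun_prop
  -- Smoothness of order `∞` at a point provides a neighbourhood for each finite order only, so the
  -- orders are treated one by one. With radius `r / 4` and `|θ| ≤ 2` the point `b + θ k` stays
  -- within `r / 4 + 2 (r / 4) < r` of `y`.
  have nhd : ∀ n : ℕ, ∃ s : Set (Base × ℝ × ℝ), IsOpen s ∧ (z, y, 0) ∈ s ∧
      ∀ q ∈ s, ∀ θ ∈ Ioo (-1 : ℝ) 2, ContDiffAt ℝ (n + 1 + 1 : ℕ) S (m (q, θ)) := fun n => by
    have h := (contDiffAt_infty.1 hS (n + 1 + 1)).eventually (by simp)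
    obtain ⟨r, hr, hball⟩ := Metric.eventually_nhds_iff_ball.1 h
    refine ⟨Metric.ball (z, y, 0) (r / 4), Metric.isOpen_ball, Metric.mem_ball_self (by linarith),
      fun q hq θ hθ => hball _ ?_⟩
    obtain ⟨w, b, k⟩ := q
    simp only [Metric.mem_ball, Prod.dist_eq, max_lt_iff, Real.dist_eq, sub_zero] at hq
    obtain ⟨h₁, h₂, h₃⟩ := hq
    simp only [m, Metric.mem_ball, Prod.dist_eq, max_lt_iff, Real.dist_eq]
    refine ⟨by linarith, ?_⟩
    have h₄ : |θ * k| ≤ 2 * |k| := by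
      rw [abs_mul]
      exact mul_le_mul_of_nonneg_right (abs_le.2 ⟨by linarith [hθ.1], hθ.2.le⟩) (abs_nonneg _)
    calc |b + θ * k - y| = |(b - y) + θ * k| := by ring_nf
      _ ≤ |b - y| + |θ * k| := abs_add_le _ _
      _ < r := by linarith
  have smooth₁ : ∀ (n : ℕ) p, ContDiffAt ℝ (n + 1 : ℕ) S p → ContDiffAt ℝ n S₁ p := fun n p h =>
    (h.fderiv_right (m := n) (by simp)).clm_apply contDiffAt_const
  have smooth₂ : ∀ (n : ℕ) p, ContDiffAt ℝ (n + 1 + 1 : ℕ) S p → ContDiffAt ℝ n S₂ p := fun n p h =>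
    ((smooth₁ (n + 1) p h).fderiv_right (m := n) (by simp)).clm_apply contDiffAt_const
  refine ⟨fun q => ∫ θ in (0 : ℝ)..1, (1 - θ) * S₂ (m (q, θ)), contDiffAt_infty.2 fun n => ?_, ?_⟩
  · obtain ⟨s, hs, hmem, hsm⟩ := nhd n
    refine (contDiffOn_integral_unit (n := n) hs
      (G := fun q => (1 - q.2) * S₂ (m q)) ?_).contDiffAt (hs.mem_nhds hmem)
    rintro ⟨q, θ⟩ ⟨hq, hθ⟩
    have h₁ : ContDiffAt ℝ n (fun q => S₂ (m q)) (q, θ) :=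
      (smooth₂ n _ (hsm q hq θ hθ)).comp (q, θ) (hm.contDiffAt.of_le (by exact_mod_cast le_top))
    exact ((contDiffAt_const.sub contDiffAt_snd).mul h₁).contDiffWithinAt
  · obtain ⟨s, hs, hmem, hsm⟩ := nhd 0
    filter_upwards [hs.mem_nhds hmem] with q hq
    obtain ⟨w, b, k⟩ := q
    have hline : ∀ θ : ℝ, HasDerivAt (fun θ => m ((w, b, k), θ)) (k • e) θ := fun θ => by
      have h₂ : HasDerivAt (fun θ : ℝ => b + θ * k) k θ := by
        simpa using ((hasDerivAt_id θ).mul_const k).const_add b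
      simpa [e] using (hasDerivAt_const θ w).prodMk h₂
    have hsub : uIcc (0 : ℝ) 1 ⊆ Ioo (-1) 2 := by
      rw [uIcc_of_le zero_le_one]
      exact fun θ hθ => ⟨by linarith [hθ.1], by linarith [hθ.2]⟩
    -- The primitive comes from integrating the remainder by parts; its values at `1` and `0` are
    -- the two sides of Taylor's formula.
    have hder : ∀ θ ∈ uIcc (0 : ℝ) 1, HasDerivAt
        (fun θ => S (m ((w, b, k), θ)) + (1 - θ) * k * S₁ (m ((w, b, k), θ)))
        (k ^ 2 * ((1 - θ) * S₂ (m ((w, b, k), θ)))) θ := fun θ hθ => by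
      have hc := hsm _ hq θ (hsub hθ)
      have d₀ : HasDerivAt (fun θ => S (m ((w, b, k), θ))) (k * S₁ (m ((w, b, k), θ))) θ := by
        have := (hc.differentiableAt (by simp)).hasFDerivAt.comp_hasDerivAt θ (hline θ)
        simpa [S₁, Function.comp_def] using this
      have d₁ : HasDerivAt (fun θ => S₁ (m ((w, b, k), θ))) (k * S₂ (m ((w, b, k), θ))) θ := by
        have := ((smooth₁ 1 _ hc).differentiableAt (by simp)).hasFDerivAt.comp_hasDerivAt θ
          (hline θ)
        simpa [S₂, Function.comp_def] using this
      have d₂ : HasDerivAt (fun θ : ℝ => (1 - θ) * k) (-k) θ := by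
        simpa using ((hasDerivAt_id θ).const_sub 1).mul_const k
      convert! d₀.add (d₂.mul d₁) using 1
      ring
    have hcont : ContinuousOn (fun θ => k ^ 2 * ((1 - θ) * S₂ (m ((w, b, k), θ)))) (uIcc 0 1) := by
      intro θ hθ
      have h₁ : ContinuousAt (fun θ => S₂ (m ((w, b, k), θ))) θ :=
        ContinuousAt.comp (f := fun θ => m ((w, b, k), θ)) (g := S₂)
          (smooth₂ 0 _ (hsm _ hq θ (hsub hθ))).continuousAt (hline θ).continuousAt
      have h₂ : ContinuousAt (fun θ : ℝ => 1 - θ) θ := by fun_prop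
      exact (continuousAt_const.mul (h₂.mul h₁)).continuousWithinAt
    have := intervalIntegral.integral_eq_sub_of_hasDerivAt hder hcont.intervalIntegrable
    rw [intervalIntegral.integral_const_mul] at this
    simp only [m, one_mul, zero_mul, add_zero, sub_self, sub_zero] at this
    simp only [m]
    change _ = S (w, b) + S₁ (w, b) * k + _
    linarith

namespace SGerm

variable {z : Base}

theorem contDiffAt_along {E : Type*} [NormedAddCommGroup E] [NormedSpace ℝ E] {S : Total → E}
    {ψ : Base → ℝ} (hS : ContDiffAt ℝ ∞ S (z, ψ z)) (hψ : ContDiffAt ℝ ∞ ψ z) :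
    ContDiffAt ℝ ∞ (fun w => S (w, ψ w)) z :=
  hS.comp (f := fun w => (w, ψ w)) z (contDiffAt_id.prodMk hψ)

theorem contDiffAt_fderiv_apply {S : Total → ℝ} {p : Total} (hS : ContDiffAt ℝ ∞ S p) (v : Total) :
    ContDiffAt ℝ ∞ (fun p => fderiv ℝ S p v) p :=
  (hS.fderiv_right (m := ∞) (by simp)).clm_apply contDiffAt_const

theorem exists_taylor {S : Total → ℝ} {ψ u : Base → ℝ} (hS : ContDiffAt ℝ ∞ S (z, ψ z))
    (hψ : ContDiffAt ℝ ∞ ψ z) (hu : ContDiffAt ℝ ∞ u z) (h0 : u z = 0) :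
    ∃ (h : ContDiffAt ℝ ∞ (fun w => S (w, ψ w + u w)) z) (q : SGerm z),
      of _ h = of _ (contDiffAt_along hS hψ)
        + of _ (contDiffAt_along (contDiffAt_fderiv_apply hS (0, 1)) hψ) * of u hu
        + of u hu ^ 2 * q := by
  obtain ⟨Q, hQ, hq⟩ := GenVorticity.exists_taylor hS
  have hψu : ContDiffAt ℝ ∞ (fun w => ψ w + u w) z := hψ.add hu
  have h3 : ContDiffAt ℝ ∞ (fun w => (w, ψ w, u w)) z := contDiffAt_id.prodMk (hψ.prodMk hu)
  have e3 : (z, ψ z, (0 : ℝ)) = (fun w => (w, ψ w, u w)) z := by simp [h0]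
  refine ⟨contDiffAt_along (S := S) (by simpa [h0] using hS) hψu,
    of (fun w => Q (w, ψ w, u w)) (ContDiffAt.comp (g := Q) z (by rw [h0]; exact hQ) h3), ?_⟩
  rw [pow_two]
  simp only [of_mul, of_add]
  rw [of_eq_of]
  rw [e3] at hq
  filter_upwards [h3.continuousAt.eventually hq] with w hw
  rw [hw]
  ring

end SGerm

/-! ### Graphs, transversality and the effect of perturbations on image graphs. -/

namespace SGerm

variable {z z' : Base}

/-- Pulling back along a local diffeomorphism is bijective. -/
theorem pull_bijective {F : Base → Base} (hF : ContDiffAt ℝ ∞ F z) (h : F z = z')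
    (hinj : ∀ v, fderiv ℝ F z v = 0 → v = 0) : Function.Bijective (pull F hF h) := by
  subst h
  have hker : LinearMap.ker (fderiv ℝ F z : Base →ₗ[ℝ] Base) = ⊥ :=
    LinearMap.ker_eq_bot'.2 hinj
  let e : Base ≃L[ℝ] Base := (LinearEquiv.ofInjectiveEndo (fderiv ℝ F z : Base →ₗ[ℝ] Base)
    (LinearMap.ker_eq_bot.1 hker)).toContinuousLinearEquiv
  have he : HasFDerivAt F (e : Base →L[ℝ] Base) z := by
    have : (e : Base →L[ℝ] Base) = fderiv ℝ F z := ContinuousLinearMap.ext fun v => rfl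
    rw [this]
    exact (hF.differentiableAt (by simp)).hasFDerivAt
  let Φ := hF.toOpenPartialHomeomorph F he (by simp)
  have hz : z ∈ Φ.source := hF.mem_toOpenPartialHomeomorph_source he (by simp)
  have hFz : F z ∈ Φ.target := hF.image_mem_toOpenPartialHomeomorph_target he (by simp)
  have hg : ContDiffAt ℝ ∞ Φ.symm (F z) := hF.to_localInverse he (by simp)
  have hgz : Φ.symm (F z) = z := Φ.left_inv hz
  constructor
  · intro a b hab
    obtain ⟨f, hf, rfl⟩ := a.exists_rep
    obtain ⟨f', hf', rfl⟩ := b.exists_rep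
    rw [pull_of, pull_of, of_eq_of] at hab
    rw [of_eq_of]
    have h₁ : ∀ᶠ w in 𝓝 (F z), f (F (Φ.symm w)) = f' (F (Φ.symm w)) := by
      have h₂ : Tendsto Φ.symm (𝓝 (F z)) (𝓝 z) := by
        have := hg.continuousAt.tendsto
        rwa [hgz] at this
      exact h₂.eventually hab
    filter_upwards [h₁, Φ.open_target.mem_nhds hFz] with w hw hw'
    have : F (Φ.symm w) = w := Φ.right_inv hw'
    rwa [this] at hw
  · intro b
    obtain ⟨f, hf, rfl⟩ := b.exists_rep
    refine ⟨of (fun w => f (Φ.symm w)) (ContDiffAt.comp (F z) (by rwa [hgz]) hg), ?_⟩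
    rw [pull_of, of_eq_of]
    filter_upwards [Φ.open_source.mem_nhds hz] with w hw
    exact congrArg f (Φ.left_inv hw)

end SGerm

/-- The map of the base space that `φ` induces on the graph of `ψ`. -/
def graphMap (φ : Total → Total) (ψ : Base → ℝ) (w : Base) : Base := (φ (w, ψ w)).1

/-- The image of the graph of a function with differential `a` at `p` projects diffeomorphically
to the base space. -/
def Transversal (φ : Total → Total) (p : Total) (a : Base →L[ℝ] ℝ) : Prop :=
  ∀ v, (fderiv ℝ φ p (v, a v)).1 = 0 → v = 0

theorem fderiv_along {E : Type*} [NormedAddCommGroup E] [NormedSpace ℝ E] {S : Total → E}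
    {ψ : Base → ℝ} {z : Base} (hS : DifferentiableAt ℝ S (z, ψ z)) (hψ : DifferentiableAt ℝ ψ z)
    (v : Base) :
    fderiv ℝ (fun w => S (w, ψ w)) z v = fderiv ℝ S (z, ψ z) (v, fderiv ℝ ψ z v) := by
  have h := hS.hasFDerivAt.comp (f := fun w => (w, ψ w)) z
    ((hasFDerivAt_id z).prodMk hψ.hasFDerivAt)
  rw [Function.comp_def] at h
  rw [h.fderiv]
  rfl

theorem contDiffAt_graphMap {φ : Total → Total} {ψ : Base → ℝ} {z : Base}
    (hφ : ContDiffAt ℝ ∞ φ (z, ψ z)) (hψ : ContDiffAt ℝ ∞ ψ z) :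
    ContDiffAt ℝ ∞ (graphMap φ ψ) z :=
  (SGerm.contDiffAt_along hφ hψ).fst

theorem fderiv_graphMap {φ : Total → Total} {ψ : Base → ℝ} {z : Base}
    (hφ : ContDiffAt ℝ ∞ φ (z, ψ z)) (hψ : ContDiffAt ℝ ∞ ψ z) (v : Base) :
    fderiv ℝ (graphMap φ ψ) z v = (fderiv ℝ φ (z, ψ z) (v, fderiv ℝ ψ z v)).1 := by
  have h := (SGerm.contDiffAt_along hφ hψ).differentiableAt (by simp)
  rw [← fderiv_along (hφ.differentiableAt (by simp)) (hψ.differentiableAt (by simp))]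
  have := (h.hasFDerivAt.fst).fderiv
  unfold graphMap
  rw [this]
  rfl

theorem Transversal.bijective_pull {φ : Total → Total} {ψ : Base → ℝ} {z z' : Base}
    (hφ : ContDiffAt ℝ ∞ φ (z, ψ z)) (hψ : ContDiffAt ℝ ∞ ψ z)
    (ht : Transversal φ (z, ψ z) (fderiv ℝ ψ z)) (h : graphMap φ ψ z = z') :
    Function.Bijective (SGerm.pull (graphMap φ ψ) (contDiffAt_graphMap hφ hψ) h) :=
  SGerm.pull_bijective _ h fun v hv => ht v (by rwa [fderiv_graphMap hφ hψ] at hv)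

open SGerm

/-- The image of the graph of `ψ` under `φ` is, near the point over `z`, the graph of `a'`. -/
def MapsGraph (φ : Total → Total) (ψ : Base → ℝ) {z z' : Base} (a' : SGerm z') : Prop :=
  ∃ (hφ : ContDiffAt ℝ ∞ φ (z, ψ z)) (hψ : ContDiffAt ℝ ∞ ψ z) (h : graphMap φ ψ z = z'),
    pull (graphMap φ ψ) (contDiffAt_graphMap hφ hψ) h a' = of _ (contDiffAt_along hφ.snd hψ)

/-- Together with `Prolong.mapsGraph` this exchanges the prolongation relation on jets for an
identity of germs, in which the unknown image enters through a ring homomorphism. -/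
theorem MapsGraph.prolong {Ω : Set Total} {φ : Total → Total} {ψ : Base → ℝ} {z z' : Base}
    {a' : SGerm z'} (h : MapsGraph φ ψ (z := z) a') (hΩ : (z, ψ z) ∈ Ω)
    (hψ : ContDiffAt ℝ ∞ ψ z) : Prolong Ω φ (jet (of ψ hψ)) (jet a') := by
  obtain ⟨ψ', hψ', rfl⟩ := a'.exists_rep
  obtain ⟨hφ, _, hz, ha⟩ := h
  rw [pull_of, of_eq_of] at ha
  exact ⟨hΩ, ψ, ψ', hψ, (jet_of hψ).symm, hψ', (jet_of hψ').symm, hz.symm, ha⟩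

theorem Prolong.mapsGraph {Ω : Set Total} {φ : Total → Total} {j j' : Jet}
    (h : Prolong Ω φ j j') (hφ : ContDiffAt ℝ ∞ φ (pt j)) :
    ∃ (ψ : Base → ℝ) (hψ : ContDiffAt ℝ ∞ ψ j.1) (a' : SGerm j'.1),
      jet (of ψ hψ) = j ∧ jet a' = j' ∧ (j.1, ψ j.1) = pt j ∧ MapsGraph φ ψ (z := j.1) a' := by
  obtain ⟨-, ψ, ψ', hψ, hj, hψ', hj', hz, hw⟩ := h
  have hpt : (j.1, ψ j.1) = pt j := by
    conv_rhs => rw [← hj, ← jet_of hψ, pt_jet, ev_of]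
  refine ⟨ψ, hψ, of ψ' hψ', by rw [jet_of, hj], by rw [jet_of, hj'], hpt, ?_⟩
  refine ⟨by rwa [hpt], hψ, by rw [graphMap, hpt, hz], ?_⟩
  rw [pull_of, of_eq_of]
  exact hw

/-- Transversality makes the pullback of germs surjective, so the last component along the graph is
a function of the new base point. -/
theorem Transversal.exists_mapsGraph {φ : Total → Total} {ψ : Base → ℝ} {z z' : Base}
    (ht : Transversal φ (z, ψ z) (fderiv ℝ ψ z)) (hφ : ContDiffAt ℝ ∞ φ (z, ψ z))
    (hψ : ContDiffAt ℝ ∞ ψ z) (h : (φ (z, ψ z)).1 = z') :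
    ∃ a' : SGerm z', MapsGraph φ ψ (z := z) a' := by
  obtain ⟨a', ha⟩ := (ht.bijective_pull hφ hψ h).2 (of _ (contDiffAt_along hφ.snd hψ))
  exact ⟨a', hφ, hψ, h, ha⟩

theorem IsPointTransf.contDiffAt {Ω : Set Total} {φ : Total → Total} (h : IsPointTransf Ω φ)
    (hΩ : IsOpen Ω) {p : Total} (hp : p ∈ Ω) : ContDiffAt ℝ ∞ φ p :=
  h.1.contDiffAt (hΩ.mem_nhds hp)

theorem IsPointTransf.bijective_fderiv {Ω : Set Total} {φ : Total → Total}
    (h : IsPointTransf Ω φ) {p : Total} (hp : p ∈ Ω) : Function.Bijective (fderiv ℝ φ p) := by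
  have hu : IsUnit (LinearMap.det (fderiv ℝ φ p : Total →ₗ[ℝ] Total)) :=
    isUnit_iff_ne_zero.2 (h.2 p hp)
  exact (LinearEquiv.ofIsUnitDet (v := Module.finBasis ℝ Total) (v' := Module.finBasis ℝ Total)
    (f := (fderiv ℝ φ p : Total →ₗ[ℝ] Total)) (by rwa [LinearMap.det_toMatrix])).bijective

theorem IsAdmissible.solves_iff {Ω : Set Total} {f f' : ArbElem} {φ : Total → Total}
    (h : IsAdmissible Ω f f' φ) {ψ : Base → ℝ} {z z' : Base} (hΩ : (z, ψ z) ∈ Ω)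
    (hψ : ContDiffAt ℝ ∞ ψ z) {a' : SGerm z'} (ha : MapsGraph φ ψ (z := z) a') :
    Solves f (of ψ hψ) ↔ Solves f' a' := by
  rw [← jet_mem_eqn, ← jet_mem_eqn]
  exact h.maps_eqn _ _ (ha.prolong hΩ hψ)

/-- The slopes for which a graph is not transversal to `φ` lie in a hyperplane. -/
theorem exists_transversal_of_ne {Ω : Set Total} {φ : Total → Total} (h : IsPointTransf Ω φ)
    {p : Total} (hp : p ∈ Ω) : ∃ n : Total, n ≠ 0 ∧
      (∀ m : Total, (fderiv ℝ φ p m).1 = 0 → ∃ c : ℝ, m = c • n) ∧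
      ∀ a : Base →L[ℝ] ℝ, a n.1 ≠ n.2 → Transversal φ p a := by
  have hinj := (h.bijective_fderiv hp).1
  set L := fderiv ℝ φ p
  -- `n` spans the preimage of the vertical line. A graph fails to be transversal exactly when its
  -- tangent space contains `n`.
  obtain ⟨n, hn⟩ := (h.bijective_fderiv hp).2 (0, 1)
  have hn0 : n ≠ 0 := by
    rintro rfl
    simpa using congrArg Prod.snd hn
  have hprop : ∀ m : Total, (L m).1 = 0 → ∃ c : ℝ, m = c • n := fun m hm => by
    refine ⟨(L m).2, hinj ?_⟩
    rw [map_smul, hn]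
    exact Prod.ext (by simpa using hm) (by simp)
  refine ⟨n, hn0, hprop, fun a ha v hv => ?_⟩
  obtain ⟨c, hc⟩ := hprop _ hv
  have h₁ : v = c • n.1 := congrArg Prod.fst hc
  have h₂ : a v = c * n.2 := congrArg Prod.snd hc
  rw [h₁, map_smul, smul_eq_mul] at h₂
  rcases eq_or_ne c 0 with rfl | hc0
  · simp [h₁]
  · exact absurd (mul_left_cancel₀ hc0 h₂) ha

/-- The effect on the image of a graph of a perturbation that vanishes to second order. -/
theorem IsAdmissible.exists_perturbation {Ω : Set Total} {f f' : ArbElem} {φ : Total → Total}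
    (h : IsAdmissible Ω f f' φ) (hopen : IsOpen Ω) {ψ u : Base → ℝ} {z z' : Base}
    (hΩ : (z, ψ z) ∈ Ω) (hψ : ContDiffAt ℝ ∞ ψ z) (hu : ContDiffAt ℝ ∞ u z)
    (ht : Transversal φ (z, ψ z) (fderiv ℝ ψ z)) (hu0 : u z = 0) (hu1 : fderiv ℝ u z = 0)
    (hz : (φ (z, ψ z)).1 = z') :
    ∃ (hG : ContDiffAt ℝ ∞ (graphMap φ fun w => ψ w + u w) z)
      (hGz : graphMap φ (fun w => ψ w + u w) z = z') (a' b' : SGerm z') (P q : SGerm z),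
      (Solves f (of ψ hψ) ↔ Solves f' a') ∧
      (Solves f (of ψ hψ + of u hu) ↔ Solves f' (a' + b')) ∧
      Function.Bijective (pull _ hG hGz) ∧
      pull _ hG hGz b' = (P + of u hu * q) * of u hu ∧ ev z P ≠ 0 ∧
      ((∀ᶠ p in 𝓝 (z, ψ z), (fderiv ℝ φ p (0, 1)).1 = 0) →
        ∃ hP, P = of (fun w => (fderiv ℝ φ (w, ψ w) (0, 1)).2) hP) := by
  have hφ := h.pointTransf.contDiffAt hopen hΩ
  have hψu : ContDiffAt ℝ ∞ (fun w => ψ w + u w) z := hψ.add hu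
  have e0 : ψ z + u z = ψ z := by rw [hu0, add_zero]
  have e1 : fderiv ℝ (fun w => ψ w + u w) z = fderiv ℝ ψ z := by
    rw [fderiv_fun_add (hψ.differentiableAt (by simp)) (hu.differentiableAt (by simp)), hu1,
      add_zero]
  have hφ₁ : ContDiffAt ℝ ∞ φ (z, ψ z + u z) := by rwa [e0]
  have hΩ₁ : (z, ψ z + u z) ∈ Ω := by rwa [e0]
  have ht₁ : Transversal φ (z, ψ z + u z) (fderiv ℝ (fun w => ψ w + u w) z) := by rwa [e0, e1]
  have hz₁ : graphMap φ (fun w => ψ w + u w) z = z' := by rw [graphMap, e0, hz]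
  obtain ⟨a', ha⟩ := ht.exists_mapsGraph hφ hψ hz
  obtain ⟨a₁, ha₁⟩ := Transversal.exists_mapsGraph (ψ := fun w => ψ w + u w) ht₁ hφ₁ hψu hz₁
  have hs := h.solves_iff hΩ hψ ha
  have hs₁ := h.solves_iff hΩ₁ hψu ha₁
  obtain ⟨f₀, hf₀, rfl⟩ := a'.exists_rep
  have hf₀' : ContDiffAt ℝ ∞ f₀ (φ (z, ψ z)).1 := by rwa [hz]
  -- `R` is the height of the image point above the image of the graph of `ψ`. It vanishes along
  -- `ψ`, and along `ψ + u` it is the pullback of `b'`; its Taylor expansion in `u` gives `P` and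
  -- `q`.
  let R : Total → ℝ := fun p => (φ p).2 - f₀ (φ p).1
  have hR : ContDiffAt ℝ ∞ R (z, ψ z) :=
    hφ.snd.sub (ContDiffAt.comp (g := f₀) (z, ψ z) hf₀' hφ.fst)
  obtain ⟨hRu, q, hq⟩ := SGerm.exists_taylor hR hψ hu hu0
  have hR0 : (fun w => R (w, ψ w)) =ᶠ[𝓝 z] fun _ => 0 := by
    obtain ⟨_, _, _, ha⟩ := ha
    rw [pull_of, of_eq_of] at ha
    filter_upwards [ha] with w hw
    exact sub_eq_zero.2 hw.symm
  have hR0' : of _ (contDiffAt_along hR hψ) = (0 : SGerm z) := by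
    rw [← map_zero (C z), C_apply, of_eq_of]
    exact hR0
  refine ⟨contDiffAt_graphMap (ψ := fun w => ψ w + u w) hφ₁ hψu, hz₁, of f₀ hf₀,
    a₁ - of f₀ hf₀, of _ (contDiffAt_along (contDiffAt_fderiv_apply hR (0, 1)) hψ), q, hs, ?_,
    ht₁.bijective_pull (ψ := fun w => ψ w + u w) hφ₁ hψu hz₁, ?_, ?_, ?_⟩
  · rw [add_sub_cancel]
    exact hs₁
  · rw [map_sub]
    obtain ⟨_, _, _, ha₁⟩ := ha₁
    rw [ha₁, pull_of, of_sub]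
    refine Eq.trans (b := of _ hRu) rfl ?_
    rw [hq, hR0']
    ring
  · rw [ev_of]
    -- If `R_ψ` vanished, `dR` would vanish on the tangent space of the graph and on the vertical
    -- line, hence everywhere. But `dR` is `1` on the direction that `dφ` sends to `(0, 1)`.
    intro hzero
    have h₁ : ∀ v, fderiv ℝ R (z, ψ z) (v, fderiv ℝ ψ z v) = 0 := fun v => by
      rw [← fderiv_along (hR.differentiableAt (by simp)) (hψ.differentiableAt (by simp)),
        hR0.fderiv_eq]
      simp
    have h₂ : ∀ m : Total, fderiv ℝ R (z, ψ z) m = 0 := fun m => by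
      have : m = (m.1, fderiv ℝ ψ z m.1) + (m.2 - fderiv ℝ ψ z m.1) • ((0, 1) : Total) :=
        Prod.ext (by simp) (by simp)
      rw [this, map_add, map_smul, h₁, hzero, smul_zero, add_zero]
    obtain ⟨n, hn⟩ := (h.pointTransf.bijective_fderiv hΩ).2 (0, 1)
    have hd := (hφ.differentiableAt (by simp)).hasFDerivAt
    have h₃ := hd.snd.sub ((hf₀'.differentiableAt (by simp)).hasFDerivAt.comp (z, ψ z) hd.fst)
    have h₄ : fderiv ℝ R (z, ψ z) n = 1 := by
      rw [show fderiv ℝ R (z, ψ z) = _ from h₃.fderiv]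
      simp [hn]
    exact zero_ne_one ((h₂ n).symm.trans h₄)
  · intro hev
    refine ⟨(contDiffAt_along ((hφ.fderiv_right (m := ∞) (by simp)).clm_apply
      contDiffAt_const) hψ).snd, ?_⟩
    rw [of_eq_of]
    have hc : ContinuousAt (fun w => (w, ψ w)) z := continuousAt_id.prodMk hψ.continuousAt
    have hdf : ∀ᶠ p in 𝓝 (z, ψ z), DifferentiableAt ℝ f₀ (φ p).1 :=
      (hφ.fst.continuousAt).eventually (eventually_differentiableAt hf₀')
    filter_upwards [hc.eventually hev, hc.eventually hdf,
      hc.eventually (eventually_differentiableAt hφ)] with w h₁ h₂ h₃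
    have h₄ := h₃.hasFDerivAt.snd.sub (h₂.hasFDerivAt.comp (w, ψ w) h₃.hasFDerivAt.fst)
    have h₅ : fderiv ℝ R (w, ψ w) = _ := h₄.fderiv
    rw [h₅]
    simp [h₁]

/-! ### Perturbations at a fixed time; the new time depends on the old time alone. -/

namespace SGerm

variable {z z' : Base}

@[simp] theorem d_one_X_zero : d z 1 (X z 0) = 0 := d_X_ne (by decide)
@[simp] theorem d_two_X_zero : d z 2 (X z 0) = 0 := d_X_ne (by decide)
@[simp] theorem d_two_X_one : d z 2 (X z 1) = 0 := d_X_ne (by decide)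
@[simp] theorem d_one_X_two : d z 1 (X z 2) = 0 := d_X_ne (by decide)

theorem lap_X_zero_mul (k : SGerm z) : lap (X z 0 * k) = X z 0 * lap k := by
  simp [lap, Derivation.leibniz]; ring

/-- A perturbation that vanishes at the present time changes only `ζ_t`. -/
theorem Solves.add_time_mul_iff {f : ArbElem} {a : SGerm z} (ha : Solves f a) (k : SGerm z) :
    Solves f (a + X z 0 * k) ↔ ev z (lap k) = 0 := by
  have h₁ : args (a + X z 0 * k) = args a := by
    simp [args, lap_add, lap_X_zero_mul, Derivation.leibniz]
  have h₂ : lhs (a + X z 0 * k) = lhs a + ev z (lap k) := by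
    simp [lhs, lap_add, lap_X_zero_mul, Derivation.leibniz]
    ring
  rw [Solves, h₁, h₂, ← ha.2]
  simp [ha.1]

/-- The derivatives that enter the equation can be prescribed. -/
theorem exists_germ (z : Base) (y : ℝ) (s : Fin 3 → ℝ) (v : Fin 6 → ℝ) (c : ℝ) :
    ∃ a : SGerm z, ev z a = y ∧ (∀ i, ev z (d z i a) = s i) ∧ args a = (z, v) ∧
      ev z (d z 0 (lap a)) = c := by
  -- Each argument of `H` is carried by one coordinate: `ζ, ζ_x, ζ_xx, ζ_xy, ζ_t` by the one with
  -- two more `x`-derivatives, `ζ_y` and `ζ_yy` by pure `y`-derivatives. The companion terms are set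
  -- to zero.
  let j : Jet := (z, fun α => if α.1 = (0, 0, 0) then y else if α.1 = (1, 0, 0) then s 0
    else if α.1 = (0, 1, 0) then s 1 else if α.1 = (0, 0, 1) then s 2
    else if α.1 = (0, 2, 0) then v 0 else if α.1 = (0, 3, 0) then v 1
    else if α.1 = (0, 0, 3) then v 2 else if α.1 = (0, 4, 0) then v 3
    else if α.1 = (0, 3, 1) then v 4 else if α.1 = (0, 0, 4) then v 5
    else if α.1 = (1, 2, 0) then c else 0)
  obtain ⟨a, ha⟩ := exists_jet_eq j
  refine ⟨a, ?_, ?_, ?_, ?_⟩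
  · have : ev z a = D (jet a) 0 0 0 := rfl
    rw [this, ha]
    simp [D, j]
  · intro i
    have h : ev z (d z i a) = ![D (jet a) 1 0 0, D (jet a) 0 1 0, D (jet a) 0 0 1] i := by
      fin_cases i <;> rfl
    rw [h, ha]
    fin_cases i <;> simp [D, j]
  · rw [← arg_jet, ha]
    refine Prod.ext rfl (funext fun i => ?_)
    fin_cases i <;> simp [arg, ζ, ζ_x, ζ_y, ζ_xx, ζ_xy, ζ_yy, D, j]
  · have : ev z (d z 0 (lap a)) = D (jet a) 1 2 0 + D (jet a) 1 0 2 := by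
      simp only [lap, map_add]
      rfl
    rw [this, ha]
    simp [D, j]

theorem ev_d_of {f : Base → ℝ} (hf : ContDiffAt ℝ ∞ f z) (i : Fin 3) :
    ev z (d z i (of f hf)) = fderiv ℝ f z (Pi.single i 1) := rfl

theorem fderiv_eq_of_ev {f : Base → ℝ} (hf : ContDiffAt ℝ ∞ f z) {L : Base →L[ℝ] ℝ}
    (h : ∀ i, ev z (d z i (of f hf)) = L (Pi.single i 1)) : fderiv ℝ f z = L := by
  refine ContinuousLinearMap.coe_inj.1 (LinearMap.pi_ext' fun i => LinearMap.ext_ring (h i))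

theorem ev_d_pull_X {F : Base → Base} (hF : ContDiffAt ℝ ∞ F z) (h : F z = z') (i j : Fin 3) :
    ev z (d z i (pull F hF h (X z' j))) = fderiv ℝ F z (Pi.single i 1) j := by
  rw [pull_X, map_sub, d_C, sub_zero, ev_d_of,
    (hasFDerivAt_pi'.1 (hF.differentiableAt (by simp)).hasFDerivAt j).fderiv]
  rfl

end SGerm

open SGerm

/-- Through every point of `Ω` there are solutions with given slope and given arguments. -/
theorem exists_solves {f : ArbElem} {z : Base} (y : ℝ) (a : Base →L[ℝ] ℝ) {v : Fin 6 → ℝ}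
    (hv : (z, v) ∈ f.dom) : ∃ (ψ : Base → ℝ) (hψ : ContDiffAt ℝ ∞ ψ z), ψ z = y ∧
      fderiv ℝ ψ z = a ∧ args (of ψ hψ) = (z, v) ∧ Solves f (of ψ hψ) := by
  -- The last value is the `ζ_t` that the equation demands for these slopes and arguments.
  obtain ⟨g, h₀, h₁, h₂, h₃⟩ := exists_germ z y (fun i => a (Pi.single i 1)) v
    (f.H (z, v) - a (Pi.single 1 1) * v 2 + a (Pi.single 2 1) * v 1)
  obtain ⟨ψ, hψ, rfl⟩ := g.exists_rep
  refine ⟨ψ, hψ, h₀, fderiv_eq_of_ev hψ h₁, h₂, by rwa [h₂], ?_⟩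
  have e₁ : ev z (d z 1 (lap (of ψ hψ))) = v 1 := congrArg (fun A : Arg => A.2 1) h₂
  have e₂ : ev z (d z 2 (lap (of ψ hψ))) = v 2 := congrArg (fun A : Arg => A.2 2) h₂
  rw [lhs, h₂, h₃, h₁, h₁, e₁, e₂]
  ring

theorem IsAdmissible.exists_mem_dom {Ω : Set Total} {f f' : ArbElem} {φ : Total → Total}
    (h : IsAdmissible Ω f f' φ) {p : Total} (hp : p ∈ Ω) : ∃ v : Fin 6 → ℝ, (p.1, v) ∈ f.dom := by
  have : p.1 ∈ f.base := h.source ▸ mem_image_of_mem _ hp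
  obtain ⟨⟨_, v⟩, hq, rfl⟩ := this
  exact ⟨v, hq⟩

/-- A large set of transversal slopes. -/
theorem IsPointTransf.exists_slopes {Ω : Set Total} {φ : Total → Total} (h : IsPointTransf Ω φ)
    {p : Total} (hp : p ∈ Ω) : ∃ N : Set (Base →L[ℝ] ℝ), N.Nonempty ∧
      (∀ a ∈ N, Transversal φ p a) ∧ ∀ a ∈ N, ∀ b, ∃ ε : ℝ, ε ≠ 0 ∧ a + ε • b ∈ N := by
  obtain ⟨n, hn, -, ht⟩ := exists_transversal_of_ne h hp
  refine ⟨{a | a n.1 ≠ n.2}, ?_, ht, ?_⟩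
  · by_cases h1 : n.1 = 0
    · refine ⟨0, fun h2 => hn (Prod.ext h1 ?_)⟩
      simpa using h2.symm
    · obtain ⟨i, hi⟩ := Function.ne_iff.1 h1
      refine ⟨((n.2 + 1) / n.1 i) • ContinuousLinearMap.proj (R := ℝ) (φ := fun _ : Fin 3 => ℝ) i,
        fun h2 => ?_⟩
      have : (n.2 + 1) / n.1 i * n.1 i = n.2 + 1 := div_mul_cancel₀ _ hi
      simp [this] at h2
  · intro a ha b
    by_cases hb : b n.1 = 0
    · refine ⟨1, one_ne_zero, ?_⟩
      change (a + (1 : ℝ) • b) n.1 ≠ n.2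
      simpa [hb] using ha
    · have ha' : n.2 - a n.1 ≠ 0 := sub_ne_zero.2 (Ne.symm ha)
      -- Half of the step at which `a + ε • b` would hit the excluded hyperplane.
      refine ⟨(n.2 - a n.1) / (2 * b n.1), by positivity, fun h2 => ha' ?_⟩
      have h3 : a n.1 + (n.2 - a n.1) / (2 * b n.1) * b n.1 = n.2 := by simpa using h2
      have h4 : (n.2 - a n.1) / (2 * b n.1) * b n.1 = (n.2 - a n.1) / 2 := by field_simp
      rw [h4] at h3
      linarith

/-- A linear functional that vanishes on the lifts of a vector along many slopes vanishes on the
vector and on the vertical direction. -/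
theorem eq_zero_of_slopes {N : Set (Base →L[ℝ] ℝ)} (hne : N.Nonempty)
    (hN : ∀ a ∈ N, ∀ b, ∃ ε : ℝ, ε ≠ 0 ∧ a + ε • b ∈ N) {L : Total →ₗ[ℝ] ℝ} {v : Base} (hv : v ≠ 0)
    (h : ∀ a ∈ N, L (v, a v) = 0) : L (v, 0) = 0 ∧ L (0, 1) = 0 := by
  obtain ⟨i, hi⟩ := Function.ne_iff.1 hv
  obtain ⟨a, ha⟩ := hne
  obtain ⟨ε, hε, ha'⟩ := hN a ha (ContinuousLinearMap.proj (R := ℝ) (φ := fun _ : Fin 3 => ℝ) i)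
  have key : ∀ s : ℝ, L (v, s) = L (v, 0) + s * L (0, 1) := fun s => by
    rw [← smul_eq_mul, ← map_smul, ← map_add]
    congr 1
    exact Prod.ext (by simp) (by simp)
  have h₁ := h a ha
  have h₂ := h _ ha'
  rw [key] at h₁ h₂
  simp only [add_apply, smul_apply, ContinuousLinearMap.proj_apply, smul_eq_mul] at h₂
  have h₃ : L (0, 1) = 0 := by
    have : ε * v i * L (0, 1) = 0 := by linarith
    exact (mul_eq_zero.1 this).resolve_left (mul_ne_zero hε hi)
  exact ⟨by rw [h₃] at h₁; linarith, h₃⟩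

theorem fderiv_graphMap_add {φ : Total → Total} {ψ u : Base → ℝ} {z : Base}
    (hφ : ContDiffAt ℝ ∞ φ (z, ψ z)) (hψ : ContDiffAt ℝ ∞ ψ z) (hu : ContDiffAt ℝ ∞ u z)
    (hu0 : u z = 0) (hu1 : fderiv ℝ u z = 0) (v : Base) :
    fderiv ℝ (graphMap φ fun w => ψ w + u w) z v
      = (fderiv ℝ φ (z, ψ z) (v, fderiv ℝ ψ z v)).1 := by
  have e0 : ψ z + u z = ψ z := by rw [hu0, add_zero]
  have hψu : ContDiffAt ℝ ∞ (fun w => ψ w + u w) z := hψ.add hu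
  rw [fderiv_graphMap (ψ := fun w => ψ w + u w) (by rwa [e0]) hψu, e0,
    fderiv_fun_add (hψ.differentiableAt (by simp)) (hu.differentiableAt (by simp)), hu1, add_zero]

/-- Let `T` be the increment of the new time along the graph and perturb by `(t - t₀)² T`. The
equation is not affected, while in the new coordinates the perturbation is the new time increment
times `θ² ρ`, with `θ` the old time increment and `ρ` a unit. Hence `Δ(θ² ρ) = 2 ρ |∇θ|²` vanishes:
spatially the old time is stationary in the new coordinates, and the chain rule reverses this. -/
theorem IsAdmissible.fderiv_time_of_transversal {Ω : Set Total} {f f' : ArbElem}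
    {φ : Total → Total} (h : IsAdmissible Ω f f' φ) (hopen : IsOpen Ω) {p : Total} (hp : p ∈ Ω)
    {a : Base →L[ℝ] ℝ} (ht : Transversal φ p a) {i : Fin 3} (hi : i ≠ 0) :
    (fderiv ℝ φ p (Pi.single i 1, a (Pi.single i 1))).1 0 = 0 := by
  obtain ⟨v, hv⟩ := h.exists_mem_dom hp
  obtain ⟨z, y⟩ := p
  replace hv : (z, v) ∈ f.dom := hv
  obtain ⟨ψ, hψ, rfl, rfl, -, hsol⟩ := exists_solves y a hv
  have hφ := h.pointTransf.contDiffAt hopen hp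
  have hS : ContDiffAt ℝ ∞ (fun q => (φ q).1 0) (z, ψ z) := contDiffAt_pi.1 hφ.fst 0
  set T : SGerm z := of _ (contDiffAt_along hS hψ) - C z ((φ (z, ψ z)).1 0) with hT
  have hT0 : ev z T = 0 := by simp [hT]
  obtain ⟨u, hu, huT⟩ := (X z 0 * (X z 0 * T)).exists_rep
  have hu0 : u z = 0 := by
    rw [← ev_of u hu, huT]
    simp
  have hu1 : fderiv ℝ u z = 0 := fderiv_eq_of_ev hu fun i => by
    rw [huT]
    simp [Derivation.leibniz]
  obtain ⟨hG, hGz, a', b', P, q, hs, hs', hbij, hb, hP, -⟩ :=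
    h.exists_perturbation hopen hp hψ hu ht hu0 hu1 rfl
  obtain ⟨hSu, q', hq'⟩ := SGerm.exists_taylor hS hψ hu hu0
  set E := of _ (contDiffAt_along (contDiffAt_fderiv_apply hS (0, 1)) hψ)
  have hsol' : Solves f (of ψ hψ + of u hu) := by
    rw [huT, hsol.add_time_mul_iff, lap_X_zero_mul]
    simp
  -- The new time along the perturbed graph is `T` plus a multiple of `u`, and `u` contains `T` as a
  -- factor. So it is `T` times a unit, and `T` may be traded for the new time increment.
  set W : SGerm z := 1 + X z 0 * (X z 0 * (E + of u hu * q')) with hW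
  have hX : pull _ hG hGz (X (φ (z, ψ z)).1 0) = T * W := by
    rw [pull_X]
    refine Eq.trans (b := of _ hSu - C z ((φ (z, ψ z)).1 0)) rfl ?_
    rw [hq', hW, hT]
    linear_combination (E + of u hu * q') * (huT)
  have hWu : IsUnit W := isUnit_iff.2 (by simp [hW])
  obtain ⟨W', hW'⟩ := hWu.exists_right_inv
  obtain ⟨θ, hθ⟩ := hbij.2 (X z 0)
  obtain ⟨ρ, hρ⟩ := hbij.2 ((P + of u hu * q) * W')
  have hθ0 : ev _ θ = 0 := by
    rw [← ev_pull hG hGz, hθ, ev_X]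
  have hρ0 : ev _ ρ ≠ 0 := by
    have e₁ : ev z W * ev z W' = 1 := by rw [← map_mul, hW', map_one]
    rw [← ev_pull hG hGz, hρ]
    simp only [map_mul, map_add, ev_of, hu0, zero_mul, add_zero]
    exact mul_ne_zero hP (right_ne_zero_of_mul_eq_one e₁)
  have hb' : b' = X _ 0 * (θ * (θ * ρ)) := hbij.1 (by
    rw [hb, map_mul, map_mul, map_mul, hX, hθ, hρ, huT]
    linear_combination (-(X z 0 * (X z 0 * T)) * (P + X z 0 * (X z 0 * T) * q)) * hW')
  have hlap := ((hs.1 hsol).add_time_mul_iff _).1 (hb' ▸ hs'.1 hsol')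
  -- Since `θ` vanishes at the point, only the gradient term of `Δ(θ² ρ)` survives there.
  have hsum : ev _ (d _ 1 θ) ^ 2 + ev _ (d _ 2 θ) ^ 2 = 0 := by
    simp only [lap_mul, map_add, map_mul, d_mul, hθ0, map_ofNat] at hlap
    ring_nf at hlap
    refine (mul_eq_zero.1 (?_ : ev _ ρ * _ = 0)).resolve_left hρ0
    linear_combination hlap / 2
  have h1 : ev _ (d _ 1 θ) = 0 := by nlinarith [sq_nonneg (ev _ (d _ 1 θ)), sq_nonneg (ev _ (d _ 2 θ))]
  have h2 : ev _ (d _ 2 θ) = 0 := by nlinarith [sq_nonneg (ev _ (d _ 1 θ)), sq_nonneg (ev _ (d _ 2 θ))]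
  -- Only the time term of the chain rule remains. For `k = 0` it shows that `∂θ/∂t'` is nonzero;
  -- for spatial `k` the left side is zero, so the other factor is.
  have key : ∀ k, ev z (d z k (X z 0))
      = (fderiv ℝ φ (z, ψ z) (Pi.single k 1, fderiv ℝ ψ z (Pi.single k 1))).1 0 * ev _ (d _ 0 θ) := by
    intro k
    rw [← hθ, d_pull, Fin.sum_univ_three]
    simp only [map_add, map_mul, ev_pull, h1, h2, mul_zero, add_zero, ev_d_pull_X]
    rw [fderiv_graphMap_add hφ hψ hu hu0 hu1]
  have k0 := key 0
  have ki := key i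
  rw [d_X_self, map_one] at k0
  rw [d_X_ne hi, map_zero] at ki
  exact (mul_eq_zero.1 ki.symm).resolve_right (right_ne_zero_of_mul_eq_one k0.symm)

/-- The new time depends on the old time only. -/
theorem IsAdmissible.fderiv_time {Ω : Set Total} {f f' : ArbElem}
    {φ : Total → Total} (h : IsAdmissible Ω f f' φ) (hopen : IsOpen Ω) {p : Total} (hp : p ∈ Ω)
    {m : Total} (hm : m.1 0 = 0) : (fderiv ℝ φ p m).1 0 = 0 := by
  obtain ⟨N, hne, hN, hN'⟩ := h.pointTransf.exists_slopes hp
  let L : Total →ₗ[ℝ] ℝ := LinearMap.proj 0 ∘ₗ LinearMap.fst ℝ Base ℝ ∘ₗ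
    (fderiv ℝ φ p : Total →ₗ[ℝ] Total)
  have key : ∀ i : Fin 3, i ≠ 0 → L (Pi.single i 1, 0) = 0 ∧ L (0, 1) = 0 := fun i hi =>
    eq_zero_of_slopes hne hN' (Pi.single_ne_zero_iff.2 one_ne_zero) fun a ha =>
      h.fderiv_time_of_transversal hopen hp (hN a ha) hi
  have hm' : m = m.1 1 • ((Pi.single 1 1, 0) : Total) + m.1 2 • ((Pi.single 2 1, 0) : Total)
      + m.2 • ((0, 1) : Total) := by
    refine Prod.ext (funext fun i => ?_) (by simp)
    fin_cases i <;> simp [hm]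
  change L m = 0
  rw [hm', map_add, map_add, map_smul, map_smul, map_smul, (key 1 (by decide)).1,
    (key 2 (by decide)).1, (key 1 (by decide)).2]
  simp

/-! ### Functions on `Ω` that are constant along its sections. -/

theorem LocalDomain.isOpen_base {Ω : Set Total} (hΩ : LocalDomain Ω) : IsOpen (base Ω) :=
  isOpenMap_fst _ hΩ.isOpen

theorem LocalDomain.isOpen_times {Ω : Set Total} (hΩ : LocalDomain Ω) : IsOpen (times Ω) := by
  have : times Ω = (fun z : Base => z 0) '' base Ω := by
    rw [times, base, image_image]
  rw [this]
  exact isOpenMap_eval 0 _ hΩ.isOpen_base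

theorem LocalDomain.isPreconnected_times {Ω : Set Total} (hΩ : LocalDomain Ω) :
    IsPreconnected (times Ω) :=
  hΩ.preconnected.image _ (by fun_prop)

theorem mem_times {Ω : Set Total} {p : Total} (hp : p ∈ Ω) : p.1 0 ∈ times Ω :=
  mem_image_of_mem _ hp

theorem mem_base {Ω : Set Total} {p : Total} (hp : p ∈ Ω) : p.1 ∈ base Ω :=
  mem_image_of_mem _ hp

theorem mem_times_of_mem_base {Ω : Set Total} {z : Base} (hz : z ∈ base Ω) : z 0 ∈ times Ω := by
  obtain ⟨p, hp, rfl⟩ := hz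
  exact mem_times hp

/-- A function with vanishing derivatives in the directions `t = const` is a function of `t`. -/
theorem LocalDomain.exists_eq_time {Ω : Set Total} (hΩ : LocalDomain Ω) {F : Total → ℝ}
    (hF : ContDiffOn ℝ ∞ F Ω) (h : ∀ p ∈ Ω, ∀ m : Total, m.1 0 = 0 → fderiv ℝ F p m = 0) :
    ∃ g : ℝ → ℝ, ContDiffOn ℝ ∞ g (times Ω) ∧ ∀ p ∈ Ω, F p = g (p.1 0) := by
  let e : Total := (Pi.single 0 1, 0)
  have he : e.1 0 = 1 := by simp [e]
  have key : ∀ p ∈ Ω, ∀ p' ∈ Ω, p'.1 0 = p.1 0 → F p' = F p := by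
    intro p hp p' hp' ht
    -- `A` is the projection along `∂_t`, and `i` retracts onto the slice through `p`. The preimage
    -- of `Ω` under `i` is the slice times a line, hence open and connected, and `F ∘ i` has zero
    -- differential there.
    let A : Total →L[ℝ] Total := ContinuousLinearMap.id ℝ Total -
      ((ContinuousLinearMap.proj (R := ℝ) (φ := fun _ : Fin 3 => ℝ) 0).comp
        (ContinuousLinearMap.fst ℝ Base ℝ)).smulRight e
    have hA : ∀ m, A m = m - m.1 0 • e := fun m => rfl
    let i : Total → Total := fun q => A q + p.1 0 • e
    have hi0 : ∀ q : Total, (i q).1 0 = p.1 0 := fun q => by simp [i, hA, e]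
    have hid : ∀ q : Total, q.1 0 = p.1 0 → i q = q := fun q hq => by simp [i, hA, hq]
    have hopen : IsOpen (i ⁻¹' Ω) := hΩ.isOpen.preimage (by fun_prop)
    have hconn : IsPreconnected (i ⁻¹' Ω) := by
      have : i ⁻¹' Ω = (fun q : Total × ℝ => q.1 + q.2 • e) ''
          ({q | q ∈ Ω ∧ q.1 0 = p.1 0} ×ˢ univ) := by
        ext q
        constructor
        · intro hq
          exact ⟨(i q, q.1 0 - p.1 0), ⟨⟨hq, hi0 q⟩, mem_univ _⟩, by
            simp only [i, hA, sub_smul]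
            abel⟩
        · rintro ⟨⟨r, s⟩, ⟨⟨hr, hr0⟩, -⟩, rfl⟩
          have : i (r + s • e) = r := by
            have h0 : (r + s • e).1 0 = p.1 0 + s := by simp [e, show r.1 0 = p.1 0 from hr0]
            simp only [i, hA, h0, add_smul]
            abel
          rw [mem_preimage]
          dsimp only
          rw [this]
          exact hr
      rw [this]
      exact ((hΩ.preconnected_time _).prod isPreconnected_univ).image _ (by fun_prop)
    have hder : ∀ q ∈ i ⁻¹' Ω, HasFDerivAt (F ∘ i) ((fderiv ℝ F (i q)).comp A) q := fun q hq =>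
      ((hF.contDiffAt (hΩ.isOpen.mem_nhds hq)).differentiableAt (by simp)).hasFDerivAt.comp q
        (A.hasFDerivAt.add_const _)
    have := hopen.is_const_of_fderiv_eq_zero hconn
      (fun q hq => (hder q hq).differentiableAt.differentiableWithinAt)
      (fun q hq => by
        rw [(hder q hq).fderiv]
        ext m
        · exact h _ hq _ (by simp [hA, e])
        · exact h _ hq _ (by simp [hA, e]))
      (x := p') (y := p) (by rwa [mem_preimage, hid _ ht]) (by rwa [mem_preimage, hid _ rfl])
    simpa only [Function.comp_apply, hid _ ht, hid _ rfl] using this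
  classical
  let g : ℝ → ℝ := fun t => if ht : ∃ p ∈ Ω, p.1 0 = t then F ht.choose else 0
  have hg : ∀ p ∈ Ω, F p = g (p.1 0) := fun p hp => by
    have hex : ∃ p' ∈ Ω, p'.1 0 = p.1 0 := ⟨p, hp, rfl⟩
    simp only [g, dif_pos hex]
    exact (key p hp _ hex.choose_spec.1 hex.choose_spec.2).symm
  refine ⟨g, ?_, hg⟩
  rintro _ ⟨p, hp, rfl⟩
  let c : ℝ → Total := fun t => p + (t - p.1 0) • e
  have hc : c (p.1 0) = p := by simp [c]
  have hcs : ContDiff ℝ ∞ c := by fun_prop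
  have h₁ : ContDiffAt ℝ ∞ (fun t => F (c t)) (p.1 0) :=
    ContDiffAt.comp (g := F) _ (by rw [hc]; exact hF.contDiffAt (hΩ.isOpen.mem_nhds hp))
      hcs.contDiffAt
  refine (h₁.congr_of_eventuallyEq ?_).contDiffWithinAt
  have h₂ : ∀ᶠ t in 𝓝 (p.1 0), c t ∈ Ω :=
    hcs.continuous.continuousAt.eventually (by rw [hc]; exact hΩ.isOpen.mem_nhds hp)
  filter_upwards [h₂] with t ht
  rw [hg _ ht]
  simp [c, he]

/-- A function whose derivative with respect to `ψ` vanishes is a function of `(t, x, y)`. -/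
theorem LocalDomain.exists_eq_base {Ω : Set Total} (hΩ : LocalDomain Ω) {F : Total → ℝ}
    (hF : ContDiffOn ℝ ∞ F Ω) (h : ∀ p ∈ Ω, fderiv ℝ F p (0, 1) = 0) :
    ∃ g : Base → ℝ, ContDiffOn ℝ ∞ g (base Ω) ∧ ∀ p ∈ Ω, F p = g p.1 := by
  have key : ∀ p ∈ Ω, ∀ p' ∈ Ω, p'.1 = p.1 → F p' = F p := by
    intro p hp p' hp' ht
    have hopen : IsOpen {y : ℝ | (p.1, y) ∈ Ω} := hΩ.isOpen.preimage (by fun_prop)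
    have hconn : IsPreconnected {y : ℝ | (p.1, y) ∈ Ω} := by
      have : {y : ℝ | (p.1, y) ∈ Ω} = Prod.snd '' {q | q ∈ Ω ∧ q.1 = p.1} := by
        ext y
        constructor
        · exact fun hy => ⟨(p.1, y), ⟨hy, rfl⟩, rfl⟩
        · rintro ⟨⟨w, y⟩, ⟨hq, rfl⟩, rfl⟩
          exact hq
      rw [this]
      exact (hΩ.preconnected_fiber _).image _ continuous_snd.continuousOn
    have hder : ∀ y ∈ {y : ℝ | (p.1, y) ∈ Ω}, HasDerivAt (fun y => F (p.1, y)) 0 y := by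
      intro y hy
      have h₁ := ((hF.contDiffAt (hΩ.isOpen.mem_nhds hy)).differentiableAt
        (by simp)).hasFDerivAt.comp_hasDerivAt y ((hasDerivAt_const y p.1).prodMk (hasDerivAt_id y))
      rwa [h _ hy] at h₁
    have := hopen.is_const_of_deriv_eq_zero hconn
      (fun y hy => (hder y hy).differentiableAt.differentiableWithinAt)
      (fun y hy => (hder y hy).deriv) (x := p'.2) (y := p.2)
      (by rw [mem_ofPred_eq, ← ht]; exact hp') hp
    rw [← Prod.eta p', ht]
    exact this
  classical
  let g : Base → ℝ := fun z => if hz : ∃ p ∈ Ω, p.1 = z then F hz.choose else 0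
  have hg : ∀ p ∈ Ω, F p = g p.1 := fun p hp => by
    have hex : ∃ p' ∈ Ω, p'.1 = p.1 := ⟨p, hp, rfl⟩
    simp only [g, dif_pos hex]
    exact (key p hp _ hex.choose_spec.1 hex.choose_spec.2).symm
  refine ⟨g, ?_, hg⟩
  rintro _ ⟨p, hp, rfl⟩
  have hc : ContDiff ℝ ∞ (fun w : Base => (w, p.2)) := by fun_prop
  have h₁ : ContDiffAt ℝ ∞ (fun w => F (w, p.2)) p.1 :=
    ContDiffAt.comp (g := F) _ (hF.contDiffAt (hΩ.isOpen.mem_nhds hp)) hc.contDiffAt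
  refine (h₁.congr_of_eventuallyEq ?_).contDiffWithinAt
  have h₂ : ∀ᶠ w in 𝓝 p.1, (w, p.2) ∈ Ω :=
    hc.continuous.continuousAt.eventually (hΩ.isOpen.mem_nhds hp)
  filter_upwards [h₂] with w hw
  exact (hg _ hw).symm

/-- A function of `(t, x, y)` whose derivatives in `x` and `y` vanish is a function of `t`. -/
theorem LocalDomain.exists_eq_time_of_base {Ω : Set Total} (hΩ : LocalDomain Ω) {F : Base → ℝ}
    (hF : ContDiffOn ℝ ∞ F (base Ω)) (h₁ : ∀ z ∈ base Ω, pd 1 F z = 0)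
    (h₂ : ∀ z ∈ base Ω, pd 2 F z = 0) :
    ∃ g : ℝ → ℝ, ContDiffOn ℝ ∞ g (times Ω) ∧ ∀ z ∈ base Ω, F z = g (z 0) := by
  obtain ⟨g, hg, hFg⟩ := hΩ.exists_eq_time (F := fun p => F p.1)
    (hF.comp contDiff_fst.contDiffOn fun p hp => mem_base hp) (by
      intro p hp m hm
      have hd := ((hF.contDiffAt (hΩ.isOpen_base.mem_nhds (mem_base hp))).differentiableAt
        (by simp)).hasFDerivAt.comp p (hasFDerivAt_fst (p := p))
      rw [Function.comp_def] at hd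
      rw [hd.fderiv, ContinuousLinearMap.comp_apply, SGerm.fderiv_eq_sum, Fin.sum_univ_three,
        h₁ _ (mem_base hp), h₂ _ (mem_base hp)]
      simp [hm])
  refine ⟨g, hg, ?_⟩
  rintro _ ⟨p, hp, rfl⟩
  exact hFg p hp

theorem SGerm.lap_sub {z : Base} (a b : SGerm z) : lap (a - b) = lap a - lap b := by
  simp only [lap, map_sub]; ring

/-! ### Conformality along transversal graphs. -/

open SGerm

theorem IsAdmissible.exists_time {Ω : Set Total} {f f' : ArbElem} {φ : Total → Total}
    (h : IsAdmissible Ω f f' φ) (hΩ : LocalDomain Ω) :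
    ∃ τ : ℝ → ℝ, ContDiffOn ℝ ∞ τ (times Ω) ∧ ∀ p ∈ Ω, (φ p).1 0 = τ (p.1 0) := by
  refine hΩ.exists_eq_time (contDiffOn_pi.1 (contDiff_fst.comp_contDiffOn h.pointTransf.1) 0)
    fun p hp m hm => ?_
  have hd := ((h.pointTransf.contDiffAt hΩ.isOpen hp).differentiableAt (by simp)).hasFDerivAt
  have := (hasFDerivAt_pi'.1 hd.fst 0).fderiv
  change fderiv ℝ (fun p => (φ p).1 0) p m = 0
  rw [this]
  exact h.fderiv_time hΩ.isOpen hp hm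

/-- The differential of `φ` is onto, so the time component of some image direction is `1`; that
component is a multiple of `τ'`. -/
theorem IsPointTransf.deriv_time_ne_zero {Ω : Set Total} {φ : Total → Total}
    (h : IsPointTransf Ω φ) (hΩ : LocalDomain Ω) {τ : ℝ → ℝ} (hτ : ContDiffOn ℝ ∞ τ (times Ω))
    (hT : ∀ p ∈ Ω, (φ p).1 0 = τ (p.1 0)) {t : ℝ} (ht : t ∈ times Ω) : deriv τ t ≠ 0 := by
  obtain ⟨p, hp, rfl⟩ := ht
  obtain ⟨m, hm⟩ := (h.bijective_fderiv hp).2 (Pi.single 0 1, 0)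
  have hd := ((h.contDiffAt hΩ.isOpen hp).differentiableAt (by simp)).hasFDerivAt
  have h₁ := (hasFDerivAt_pi'.1 hd.fst 0).fderiv
  have h₂ : (fun p => (φ p).1 0) =ᶠ[𝓝 p] fun p => τ (p.1 0) := by
    filter_upwards [hΩ.isOpen.mem_nhds hp] with q hq using hT q hq
  have h₃ : HasFDerivAt (fun p : Total => p.1 0)
    ((ContinuousLinearMap.proj (R := ℝ) (φ := fun _ : Fin 3 => ℝ) 0).comp
        (ContinuousLinearMap.fst ℝ Base ℝ)) p :=
    ((ContinuousLinearMap.proj (R := ℝ) (φ := fun _ : Fin 3 => ℝ) 0).comp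
      (ContinuousLinearMap.fst ℝ Base ℝ)).hasFDerivAt
  have h₄ := ((hτ.contDiffAt (hΩ.isOpen_times.mem_nhds (mem_times hp))).differentiableAt
    (by simp)).hasDerivAt.comp_hasFDerivAt p h₃
  rw [Function.comp_def] at h₄
  rw [h₂.fderiv_eq, h₄.fderiv] at h₁
  intro h0
  have := DFunLike.congr_fun h₁ m
  simp [h0, hm] at this

/-- The increment of a function of time, divided by the increment of time. -/
theorem SGerm.exists_time_quotient {z : Base} {τ : ℝ → ℝ} (hτ : ContDiffAt ℝ ∞ τ (z 0)) :
    ∃ (h : ContDiffAt ℝ ∞ (fun w : Base => τ (w 0)) z) (q : SGerm z),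
      of _ h - C z (τ (z 0)) = X z 0 * (C z (deriv τ (z 0)) + X z 0 * q) := by
  have hS : ContDiffAt ℝ ∞ (fun p : Total => τ p.2) (z, z 0) :=
    ContDiffAt.comp (g := τ) (z, z 0) hτ contDiffAt_snd
  have hψ : ContDiffAt ℝ ∞ (fun _ : Base => z 0) z := contDiffAt_const
  -- The fibre variable plays the role of time here: the graph is constant and the displacement is
  -- `t - t₀`.
  obtain ⟨h, q, hq⟩ := SGerm.exists_taylor (ψ := fun _ => z 0) (u := fun w => w 0 - z 0) hS hψ
    (by fun_prop) (sub_self _)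
  simp only [add_sub_cancel] at h
  refine ⟨h, q, ?_⟩
  have e₁ : of (fun w : Base => τ (w 0)) h = _ := Eq.trans (by
    rw [of_eq_of]
    exact Eventually.of_forall fun w => by simp) hq
  have e₂ : of _ (contDiffAt_along (contDiffAt_fderiv_apply hS (0, 1)) hψ)
      = C z (deriv τ (z 0)) := by
    rw [C_apply, of_eq_of]
    refine Eventually.of_forall fun w => ?_
    have h₁ : HasDerivAt τ (deriv τ (z 0)) ((w, z 0) : Total).2 :=
      (hτ.differentiableAt (by simp)).hasDerivAt
    have h₀ : HasFDerivAt (fun p : Total => p.2) (ContinuousLinearMap.snd ℝ Base ℝ) (w, z 0) :=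
      hasFDerivAt_snd
    have h₂ := h₁.comp_hasFDerivAt ((w, z 0) : Total) h₀
    rw [Function.comp_def] at h₂
    change fderiv ℝ (fun p : Total => τ p.2) (w, z 0) (0, 1) = deriv τ (z 0)
    erw [h₂.fderiv]
    simp
  rw [e₁, e₂]
  have e₃ : of _ (contDiffAt_along hS hψ) = C z (τ (z 0)) := rfl
  rw [e₃]
  have e₄ : of (fun w : Base => w 0 - z 0) (by fun_prop) = X z 0 := rfl
  rw [e₄]
  ring

/-- The effect of a perturbation that vanishes at the present time. -/
theorem IsAdmissible.exists_time_perturbation {Ω : Set Total} {f f' : ArbElem} {φ : Total → Total}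
    (h : IsAdmissible Ω f f' φ) (hΩ : LocalDomain Ω) {ψ : Base → ℝ} {z : Base}
    (hp : (z, ψ z) ∈ Ω) (hψ : ContDiffAt ℝ ∞ ψ z)
    (ht : Transversal φ (z, ψ z) (fderiv ℝ ψ z)) (hsol : Solves f (of ψ hψ)) {τ : ℝ → ℝ}
    (hτ : ContDiffOn ℝ ∞ τ (times Ω)) (hT : ∀ p ∈ Ω, (φ p).1 0 = τ (p.1 0))
    {k : SGerm z} (hk : ev z k = 0) (hk' : ev z (lap k) = 0) :
    ∃ (u : Base → ℝ) (hG : ContDiffAt ℝ ∞ (graphMap φ fun w => ψ w + u w) z)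
      (hGz : graphMap φ (fun w => ψ w + u w) z = (φ (z, ψ z)).1) (P q E : SGerm z),
      ContDiffAt ℝ ∞ u z ∧ u z = 0 ∧ fderiv ℝ u z = 0 ∧
      Function.Bijective (pull _ hG hGz) ∧ ev z P ≠ 0 ∧
      ((∀ᶠ p in 𝓝 (z, ψ z), (fderiv ℝ φ p (0, 1)).1 = 0) →
        ∃ hP, P = of (fun w => (fderiv ℝ φ (w, ψ w) (0, 1)).2) hP) ∧
      ev z E ≠ 0 ∧ ev z (d z 1 E) = 0 ∧ ev z (d z 2 E) = 0 ∧
      ∀ r, pull _ hG hGz r = (P + X z 0 * q) * E * k → ev _ (lap r) = 0 := by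
  have hφ := h.pointTransf.contDiffAt hΩ.isOpen hp
  -- As `k` vanishes at `z`, the product with `t - t₀` vanishes to second order and leaves the
  -- tangent space of the graph alone.
  obtain ⟨u, hu, hk0⟩ := (X z 0 * k).exists_rep
  have hu0 : u z = 0 := by
    rw [← ev_of u hu, hk0]
    simp
  have hu1 : fderiv ℝ u z = 0 := fderiv_eq_of_ev hu fun i => by
    rw [hk0]
    simp [Derivation.leibniz, hk]
  obtain ⟨hG, hGz, a', b', P, q, hs, hs', hbij, hb, hP, hP'⟩ :=
    h.exists_perturbation hΩ.isOpen hp hψ hu ht hu0 hu1 rfl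
  obtain ⟨hτz, q', hq'⟩ := exists_time_quotient
    (hτ.contDiffAt (hΩ.isOpen_times.mem_nhds (mem_times hp)))
  have hτ0 := h.pointTransf.deriv_time_ne_zero hΩ hτ hT (mem_times hp)
  set W : SGerm z := C z (deriv τ (z 0)) + X z 0 * q' with hW
  have hX : pull _ hG hGz (X (φ (z, ψ z)).1 0) = X z 0 * W := by
    rw [← hq', pull_X, hT _ hp]
    congr 1
    rw [of_eq_of]
    have hc : ContinuousAt (fun w => (w, ψ w + u w)) z :=
      continuousAt_id.prodMk (hψ.continuousAt.add hu.continuousAt)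
    have hc' : Tendsto (fun w => (w, ψ w + u w)) (𝓝 z) (𝓝 (z, ψ z)) := by
      have := hc.tendsto
      simpa [hu0] using this
    filter_upwards [hc'.eventually (hΩ.isOpen.mem_nhds hp)] with w hw
    exact hT _ hw
  have hWu : IsUnit W := isUnit_iff.2 (by simpa [hW] using hτ0)
  obtain ⟨E, hE⟩ := hWu.exists_right_inv
  have hE0 : ev z W * ev z E = 1 := by rw [← map_mul, hE, map_one]
  have hW0 : ev z W ≠ 0 := left_ne_zero_of_mul_eq_one hE0
  -- `W` is `τ_t` plus a multiple of `t - t₀`, so it has no spatial gradient at `z`, and therefore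
  -- neither has its inverse.
  have hdE : ∀ i, ev z (d z i W) = 0 → ev z (d z i E) = 0 := fun i hi => by
    have h₁ := congrArg (fun a => ev z (d z i a)) hE
    simp only [d_mul, map_add, map_mul, hi, mul_zero, add_zero, Derivation.map_one_eq_zero,
      map_zero] at h₁
    exact (mul_eq_zero.1 h₁).resolve_left hW0
  refine ⟨u, hG, hGz, P, k * q, E, hu, hu0, hu1, hbij, hP, hP', right_ne_zero_of_mul_eq_one hE0,
    hdE 1 (by simp [hW, Derivation.leibniz]), hdE 2 (by simp [hW, Derivation.leibniz]), ?_⟩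
  intro r hr
  -- The factor `t - t₀` is `E` times the new time increment, so the image perturbation is again of
  -- the kind that affects only `ζ_t`.
  have hb' : b' = X _ 0 * r := hbij.1 (by
    rw [hb, map_mul, hX, hr, hk0]
    linear_combination (-(X z 0 * k) * (P + X z 0 * k * q)) * hE)
  refine ((hs.1 hsol).add_time_mul_iff _).1 ?_
  rw [← hb', ← hs', hk0, hsol.add_time_mul_iff]
  exact hk'

/-- Harmonic quadratic polynomials must stay harmonic at the point, up to a unit factor `ρ`. With
the old coordinates `κ` as functions of the new ones, `x² - y²` gives `|∇κ₁|² = |∇κ₂|²` and `xy`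
gives `∇κ₁ · ∇κ₂ = 0`, so the inverse Jacobian is conformal and with it the Jacobian. -/
theorem IsAdmissible.conformal_of_transversal {Ω : Set Total} {f f' : ArbElem}
    {φ : Total → Total} (h : IsAdmissible Ω f f' φ) (hΩ : LocalDomain Ω) {p : Total} (hp : p ∈ Ω)
    {a : Base →L[ℝ] ℝ} (ht : Transversal φ p a) :
    (let c := fun i : Fin 3 => (fderiv ℝ φ p (Pi.single i 1, a (Pi.single i 1))).1
    c 1 1 * c 2 1 + c 1 2 * c 2 2 = 0 ∧
      c 1 1 ^ 2 + c 1 2 ^ 2 = c 2 1 ^ 2 + c 2 2 ^ 2) := by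
  obtain ⟨τ, hτ, hT⟩ := h.exists_time hΩ
  obtain ⟨v, hv⟩ := h.exists_mem_dom hp
  obtain ⟨z, y⟩ := p
  replace hv : (z, v) ∈ f.dom := hv
  obtain ⟨ψ, hψ, rfl, rfl, -, hsol⟩ := exists_solves y a hv
  have hφ := h.pointTransf.contDiffAt hΩ.isOpen hp
  intro c
  have main : ∀ k : SGerm z, ev z k = 0 → ev z (lap k) = 0 →
      ∃ (κ : Fin 3 → SGerm (φ (z, ψ z)).1) (F : SGerm (φ (z, ψ z)).1 →+* SGerm z)
        (ρ : SGerm (φ (z, ψ z)).1), (∀ i, F (κ i) = X z i) ∧ (∀ i, ev _ (κ i) = 0) ∧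
        ev _ ρ ≠ 0 ∧
        (∀ i j, ev z (d z i (X z j)) = ∑ l, c i l * ev _ (d _ l (κ j))) ∧
        ∀ k', F k' = k → ev _ (lap (ρ * k')) = 0 := by
    intro k hk hk'
    obtain ⟨u, hG, hGz, P, q, E, hu, hu0, hu1, hbij, hP, -, hE, -, -, hr⟩ :=
      h.exists_time_perturbation hΩ hp hψ ht hsol hτ hT hk hk'
    choose κ hκ using fun i => hbij.2 (X z i)
    obtain ⟨ρ, hρ⟩ := hbij.2 ((P + X z 0 * q) * E)
    refine ⟨κ, pull _ hG hGz, ρ, hκ, fun i => ?_, ?_, fun i j => ?_, fun k' hk' => ?_⟩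
    · rw [← ev_pull hG hGz, hκ, ev_X]
    · rw [← ev_pull hG hGz, hρ]
      simpa using ⟨hP, hE⟩
    · rw [← hκ j, d_pull, map_sum]
      refine Finset.sum_congr rfl fun l _ => ?_
      rw [map_mul, ev_pull, ev_d_pull_X, fderiv_graphMap_add hφ hψ hu hu0 hu1]
    · exact hr _ (by rw [map_mul, hρ, hk'])
  have hc0 : ∀ i : Fin 3, i ≠ 0 → c i 0 = 0 := fun i hi =>
    h.fderiv_time hΩ.isOpen hp (by simp [hi.symm])
  have conf : ∀ k : SGerm z, ev z k = 0 → ev z (lap k) = 0 →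
      k = X z 1 * X z 1 - X z 2 * X z 2 ∨ k = X z 1 * X z 2 →
      ∃ n : Fin 3 → Fin 3 → ℝ,
        (c 1 1 * n 1 1 + c 1 2 * n 2 1 = 1 ∧ c 1 1 * n 1 2 + c 1 2 * n 2 2 = 0 ∧
        c 2 1 * n 1 1 + c 2 2 * n 2 1 = 0 ∧ c 2 1 * n 1 2 + c 2 2 * n 2 2 = 1) ∧
        (k = X z 1 * X z 1 - X z 2 * X z 2 → n 1 1 ^ 2 + n 2 1 ^ 2 = n 1 2 ^ 2 + n 2 2 ^ 2) ∧
        (k = X z 1 * X z 2 → n 1 1 * n 1 2 + n 2 1 * n 2 2 = 0) := by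
    intro k hk hk' _
    obtain ⟨κ, F, ρ, hκ, hκ0, hρ, hn, hlap⟩ := main k hk hk'
    refine ⟨fun l j => ev _ (d _ l (κ j)), ?_, ?_, ?_⟩
    · have h11 := hn 1 1
      have h12 := hn 1 2
      have h21 := hn 2 1
      have h22 := hn 2 2
      simp only [Fin.sum_univ_three, hc0 1 (by decide), hc0 2 (by decide), d_X_self, d_one_X_two,
        d_two_X_one, map_one, map_zero, zero_mul, zero_add] at h11 h12 h21 h22
      exact ⟨h11.symm, h12.symm, h21.symm, h22.symm⟩
    · rintro rfl
      have := hlap (κ 1 * κ 1 - κ 2 * κ 2) (by simp [hκ])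
      simp only [lap_mul, lap_sub, map_add, map_sub, map_mul, d_mul, hκ0, map_ofNat] at this
      ring_nf at this
      refine sub_eq_zero.1 ((mul_eq_zero.1 (?_ : ev _ ρ * _ = 0)).resolve_left hρ)
      linear_combination this / 2
    · rintro rfl
      have := hlap (κ 1 * κ 2) (by simp [hκ])
      simp only [lap_mul, map_add, map_mul, d_mul, hκ0, map_ofNat] at this
      ring_nf at this
      refine (mul_eq_zero.1 (?_ : ev _ ρ * _ = 0)).resolve_left hρ
      linear_combination this / 2
  -- The two perturbed graphs differ and so do their coordinate functions; `n` and `n'` are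
  -- introduced separately, each being inverse to the spatial block of `c`.
  obtain ⟨n, ⟨hn1, hn2, hn3, hn4⟩, hn5, -⟩ := conf (X z 1 * X z 1 - X z 2 * X z 2) (by simp) (by
    simp [lap, Derivation.leibniz]) (Or.inl rfl)
  obtain ⟨n', ⟨hm1, hm2, hm3, hm4⟩, -, hm5⟩ := conf (X z 1 * X z 2) (by simp) (by
    simp [lap, Derivation.leibniz]) (Or.inr rfl)
  replace hn5 := hn5 rfl
  replace hm5 := hm5 rfl
  set Δ := c 1 1 * c 2 2 - c 1 2 * c 2 1 with hΔ
  -- Cramer's rule, in a form that does not divide by `Δ`.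
  have e11 : Δ * n 1 1 = c 2 2 := by linear_combination c 2 2 * hn1 - c 1 2 * hn3
  have e12 : Δ * n 1 2 = -c 1 2 := by linear_combination c 2 2 * hn2 - c 1 2 * hn4
  have e21 : Δ * n 2 1 = -c 2 1 := by linear_combination c 1 1 * hn3 - c 2 1 * hn1
  have e22 : Δ * n 2 2 = c 1 1 := by linear_combination c 1 1 * hn4 - c 2 1 * hn2
  have f11 : Δ * n' 1 1 = c 2 2 := by linear_combination c 2 2 * hm1 - c 1 2 * hm3
  have f12 : Δ * n' 1 2 = -c 1 2 := by linear_combination c 2 2 * hm2 - c 1 2 * hm4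
  have f21 : Δ * n' 2 1 = -c 2 1 := by linear_combination c 1 1 * hm3 - c 2 1 * hm1
  have f22 : Δ * n' 2 2 = c 1 1 := by linear_combination c 1 1 * hm4 - c 2 1 * hm2
  constructor
  · have h₁ : Δ * n' 1 1 * (Δ * n' 1 2) + Δ * n' 2 1 * (Δ * n' 2 2) = 0 := by
      linear_combination Δ ^ 2 * hm5
    rw [f11, f12, f21, f22] at h₁
    linear_combination -h₁
  · have h₁ : (Δ * n 1 1) ^ 2 + (Δ * n 2 1) ^ 2 = (Δ * n 1 2) ^ 2 + (Δ * n 2 2) ^ 2 := by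
      linear_combination Δ ^ 2 * hn5
    rw [e11, e12, e21, e22] at h₁
    linear_combination -h₁

/-! ### Germs of functions of time, and calculus for transformations of conformal form. -/

namespace SGerm

variable {z z' : Base}

/-- The germ of a function of time. -/
def tm (z : Base) (τ : ℝ → ℝ) (hτ : ContDiffAt ℝ ∞ τ (z 0)) : SGerm z :=
  of (fun w => τ (w 0)) (ContDiffAt.comp z hτ (by fun_prop))

@[simp] theorem ev_tm {τ : ℝ → ℝ} (hτ : ContDiffAt ℝ ∞ τ (z 0)) : ev z (tm z τ hτ) = τ (z 0) := rfl

theorem contDiffAt_deriv {τ : ℝ → ℝ} {t : ℝ} (hτ : ContDiffAt ℝ ∞ τ t) :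
    ContDiffAt ℝ ∞ (deriv τ) t := by
  have : deriv τ = fun t => fderiv ℝ τ t 1 := funext fun t => by simp
  rw [this]
  exact (hτ.fderiv_right (m := ∞) (by simp)).clm_apply contDiffAt_const

theorem pd_time {τ : ℝ → ℝ} {w : Base} (hτ : DifferentiableAt ℝ τ (w 0)) (i : Fin 3) :
    pd i (fun w => τ (w 0)) w = if i = 0 then deriv τ (w 0) else 0 := by
  have h₁ : HasFDerivAt (fun w : Base => w 0)
      (ContinuousLinearMap.proj (R := ℝ) (φ := fun _ : Fin 3 => ℝ) 0) w :=
    (ContinuousLinearMap.proj (R := ℝ) (φ := fun _ : Fin 3 => ℝ) 0).hasFDerivAt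
  have h₂ := hτ.hasDerivAt.comp_hasFDerivAt w h₁
  rw [Function.comp_def] at h₂
  rw [pd, h₂.fderiv]
  by_cases hi : i = 0
  · subst hi
    simp
  · simp [hi, Ne.symm hi]

theorem eventually_differentiableAt_time {τ : ℝ → ℝ} (hτ : ContDiffAt ℝ ∞ τ (z 0)) :
    ∀ᶠ w : Base in 𝓝 z, DifferentiableAt ℝ τ (w 0) :=
  (continuous_apply (0 : Fin 3)).continuousAt.eventually (eventually_differentiableAt hτ)

@[simp] theorem d_zero_tm {τ : ℝ → ℝ} (hτ : ContDiffAt ℝ ∞ τ (z 0)) :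
    d z 0 (tm z τ hτ) = tm z (deriv τ) (contDiffAt_deriv hτ) := by
  rw [tm, d_of, tm, of_eq_of]
  filter_upwards [eventually_differentiableAt_time hτ] with w hw
  simp [pd_time hw]

theorem d_tm_of_ne {τ : ℝ → ℝ} (hτ : ContDiffAt ℝ ∞ τ (z 0)) {i : Fin 3} (hi : i ≠ 0) :
    d z i (tm z τ hτ) = 0 := by
  rw [tm, d_of, ← map_zero (C z), C_apply, of_eq_of]
  filter_upwards [eventually_differentiableAt_time hτ] with w hw
  simp [pd_time hw, hi]

@[simp] theorem d_one_tm {τ : ℝ → ℝ} (hτ : ContDiffAt ℝ ∞ τ (z 0)) : d z 1 (tm z τ hτ) = 0 :=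
  d_tm_of_ne hτ (by decide)

@[simp] theorem d_two_tm {τ : ℝ → ℝ} (hτ : ContDiffAt ℝ ∞ τ (z 0)) : d z 2 (tm z τ hτ) = 0 :=
  d_tm_of_ne hτ (by decide)

theorem pull_congr {F G : Base → Base} (hF : ContDiffAt ℝ ∞ F z) (hG : ContDiffAt ℝ ∞ G z)
    (h : F =ᶠ[𝓝 z] G) (hFz : F z = z') (hGz : G z = z') : pull F hF hFz = pull G hG hGz := by
  ext a
  obtain ⟨f, hf, rfl⟩ := a.exists_rep
  rw [pull_of, pull_of, of_eq_of]
  filter_upwards [h] with w hw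
  rw [hw]

end SGerm

open SGerm

/-- Transformations that preserve time, act conformally on the plane and affinely on `ψ`. -/
structure ConformalForm (Ω : Set Total) (φ : Total → Total) (ε : ℝ) (τ : ℝ → ℝ)
    (X Y : Base → ℝ) (κ : ℝ → ℝ) (χ : Base → ℝ) : Prop where
  sign : ε = 1 ∨ ε = -1
  smooth_time : ContDiffOn ℝ ∞ τ (times Ω)
  smooth_fst : ContDiffOn ℝ ∞ X (base Ω)
  smooth_snd : ContDiffOn ℝ ∞ Y (base Ω)
  smooth_coeff : ContDiffOn ℝ ∞ κ (times Ω)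
  smooth_shift : ContDiffOn ℝ ∞ χ (base Ω)
  eq : ∀ p ∈ Ω, φ p = (![τ (p.1 0), X p.1, Y p.1], κ (p.1 0) * p.2 + χ p.1)
  pd_two_snd : ∀ z ∈ base Ω, pd 2 Y z = ε * pd 1 X z
  pd_one_snd : ∀ z ∈ base Ω, pd 1 Y z = -ε * pd 2 X z
  scale_pos : ∀ z ∈ base Ω, 0 < pd 1 X z ^ 2 + pd 2 X z ^ 2
  deriv_time : ∀ t ∈ times Ω, deriv τ t ≠ 0
  coeff_ne_zero : ∀ t ∈ times Ω, κ t ≠ 0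

namespace ConformalForm

variable {Ω : Set Total} {φ : Total → Total} {ε : ℝ} {τ : ℝ → ℝ} {X Y : Base → ℝ}
  {κ : ℝ → ℝ} {χ : Base → ℝ} {z : Base}

/-- The transformation of the base space. -/
def map (τ : ℝ → ℝ) (X Y : Base → ℝ) (w : Base) : Base := ![τ (w 0), X w, Y w]

section

variable (h : ConformalForm Ω φ ε τ X Y κ χ) (hΩ : LocalDomain Ω) (hz : z ∈ base Ω)

include h in
theorem sign_sq : ε * ε = 1 := by
  rcases h.sign with h | h <;> rw [h] <;> norm_num

include h hΩ hz

theorem time : ContDiffAt ℝ ∞ τ (z 0) :=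
  h.smooth_time.contDiffAt (hΩ.isOpen_times.mem_nhds (mem_times_of_mem_base hz))

theorem coeff : ContDiffAt ℝ ∞ κ (z 0) :=
  h.smooth_coeff.contDiffAt (hΩ.isOpen_times.mem_nhds (mem_times_of_mem_base hz))

theorem fst : ContDiffAt ℝ ∞ X z := h.smooth_fst.contDiffAt (hΩ.isOpen_base.mem_nhds hz)

theorem snd : ContDiffAt ℝ ∞ Y z := h.smooth_snd.contDiffAt (hΩ.isOpen_base.mem_nhds hz)

theorem shift : ContDiffAt ℝ ∞ χ z := h.smooth_shift.contDiffAt (hΩ.isOpen_base.mem_nhds hz)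

theorem contDiffAt_map : ContDiffAt ℝ ∞ (map τ X Y) z := by
  refine contDiffAt_pi.2 fun i => ?_
  fin_cases i
  · exact ContDiffAt.comp (g := τ) z (h.time hΩ hz) (by fun_prop)
  · exact h.fst hΩ hz
  · exact h.snd hΩ hz

/-- The pullback along the transformation of the base space. -/
def pb : SGerm (map τ X Y z) →+* SGerm z := pull (map τ X Y) (h.contDiffAt_map hΩ hz) rfl

theorem d_pb (i : Fin 3) (a : SGerm (map τ X Y z)) : d z i (h.pb hΩ hz a)
    = d z i (tm z τ (h.time hΩ hz)) * h.pb hΩ hz (d _ 0 a)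
      + d z i (of X (h.fst hΩ hz)) * h.pb hΩ hz (d _ 1 a)
      + d z i (of Y (h.snd hΩ hz)) * h.pb hΩ hz (d _ 2 a) := by
  rw [pb, d_pull, Fin.sum_univ_three]
  simp only [pull_X, map_sub, d_C, sub_zero]
  rfl

theorem d_one_snd : d z 1 (of Y (h.snd hΩ hz)) = -C z ε * d z 2 (of X (h.fst hΩ hz)) := by
  rw [d_of, d_of, C_apply, ← neg_one_mul, ← map_one (C z), ← map_neg, C_apply, of_mul, of_mul,
    of_eq_of]
  filter_upwards [hΩ.isOpen_base.mem_nhds hz] with w hw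
  rw [h.pd_one_snd w hw]
  ring

theorem d_two_snd : d z 2 (of Y (h.snd hΩ hz)) = C z ε * d z 1 (of X (h.fst hΩ hz)) := by
  rw [d_of, d_of, C_apply, of_mul, of_eq_of]
  filter_upwards [hΩ.isOpen_base.mem_nhds hz] with w hw
  rw [h.pd_two_snd w hw]

theorem d_one_pb (a : SGerm (map τ X Y z)) : d z 1 (h.pb hΩ hz a)
    = d z 1 (of X (h.fst hΩ hz)) * h.pb hΩ hz (d _ 1 a)
      - C z ε * d z 2 (of X (h.fst hΩ hz)) * h.pb hΩ hz (d _ 2 a) := by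
  rw [d_pb, d_one_tm, h.d_one_snd hΩ hz]
  ring

theorem d_two_pb (a : SGerm (map τ X Y z)) : d z 2 (h.pb hΩ hz a)
    = d z 2 (of X (h.fst hΩ hz)) * h.pb hΩ hz (d _ 1 a)
      + C z ε * d z 1 (of X (h.fst hΩ hz)) * h.pb hΩ hz (d _ 2 a) := by
  rw [d_pb, d_two_tm, h.d_two_snd hΩ hz]
  ring

omit hΩ hz in
theorem C_sign_sq : C z ε * C z ε = 1 := by rw [← map_mul, h.sign_sq, map_one]

/-- The square of the local scale of the conformal map. -/
def scale : SGerm z := d z 1 (of X (h.fst hΩ hz)) ^ 2 + d z 2 (of X (h.fst hΩ hz)) ^ 2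

/-- The Cauchy–Riemann equations express both second derivatives of `X` through the mixed derivative
of `Y`, where they cancel. -/
theorem lap_fst : lap (of X (h.fst hΩ hz)) = 0 := by
  have h₁ := congrArg (d z 2) (h.d_one_snd hΩ hz)
  have h₂ := congrArg (d z 1) (h.d_two_snd hΩ hz)
  rw [neg_mul, map_neg, d_mul, d_C, d_comm 2 1] at h₁
  rw [d_mul, d_C] at h₂
  rw [lap]
  linear_combination C z ε * h₁ - C z ε * h₂ - (d z 1 (d z 1 (of X (h.fst hΩ hz)))
    + d z 2 (d z 2 (of X (h.fst hΩ hz)))) * h.C_sign_sq (z := z)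

/-- Conformal covariance of the Laplacian: the Cauchy–Riemann equations remove the mixed second
order terms, and harmonicity of the map removes the first order ones. -/
theorem lap_pb (a : SGerm (map τ X Y z)) :
    lap (h.pb hΩ hz a) = h.scale hΩ hz * h.pb hΩ hz (lap a) := by
  have h₁ := h.lap_fst hΩ hz
  have h₂ := h.C_sign_sq (z := z)
  rw [lap] at h₁
  rw [lap, d_one_pb, d_two_pb, map_sub, map_add, d_mul, d_mul, d_mul, d_mul, d_mul, d_mul, d_C, d_C,
    d_one_pb, d_one_pb, d_two_pb, d_two_pb, lap, map_add, scale, d_comm 2 1 (of X _), d_comm 2 1 a]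
  linear_combination h.pb hΩ hz (d _ 1 a) * h₁ + (d z 1 (of X (h.fst hΩ hz)) ^ 2
    + d z 2 (of X (h.fst hΩ hz)) ^ 2) * h.pb hΩ hz (d _ 2 (d _ 2 a)) * h₂

/-- The factor is the Jacobian determinant of the plane map, with orientation `ε`. This controls the
advection term of the equation. -/
theorem bracket_pb (a b : SGerm (map τ X Y z)) :
    d z 1 (h.pb hΩ hz a) * d z 2 (h.pb hΩ hz b) - d z 2 (h.pb hΩ hz a) * d z 1 (h.pb hΩ hz b)
      = C z ε * h.scale hΩ hz * h.pb hΩ hz (d _ 1 a * d _ 2 b - d _ 2 a * d _ 1 b) := by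
  simp only [d_one_pb, d_two_pb, map_sub, map_mul, scale]
  ring

theorem ev_scale : ev z (h.scale hΩ hz) = pd 1 X z ^ 2 + pd 2 X z ^ 2 := by
  simp [scale, d_of]

theorem isUnit_scale : IsUnit (h.scale hΩ hz) :=
  isUnit_iff.2 (by rw [ev_scale]; exact (h.scale_pos z hz).ne')

theorem ev_pb (a : SGerm (map τ X Y z)) : ev z (h.pb hΩ hz a) = ev _ a := ev_pull _ _ a

/-- The differential is block triangular, with the blocks `τ_t` and a Cauchy–Riemann matrix of
determinant `ε` times the scale. -/
theorem eq_zero_of_fderiv_map {v : Base} (hv : fderiv ℝ (map τ X Y) z v = 0) : v = 0 := by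
  have hd := (h.contDiffAt_map hΩ hz).differentiableAt (by simp)
  have key : ∀ i, fderiv ℝ (map τ X Y) z v i = fderiv ℝ (fun w => map τ X Y w i) z v := fun i => by
    rw [(hasFDerivAt_pi'.1 hd.hasFDerivAt i).fderiv]
    rfl
  have h0 : fderiv ℝ (fun w : Base => τ (w 0)) z v = 0 := by
    have := key 0
    rw [hv] at this
    exact this.symm
  have h1 : fderiv ℝ X z v = 0 := by
    have := key 1
    rw [hv] at this
    exact this.symm
  have h2 : fderiv ℝ Y z v = 0 := by
    have := key 2
    rw [hv] at this
    exact this.symm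
  have hτ := (h.time hΩ hz).differentiableAt (by simp)
  rw [fderiv_eq_sum, Fin.sum_univ_three] at h0 h1 h2
  rw [pd_time hτ, pd_time hτ, pd_time hτ] at h0
  simp only [if_true, one_ne_zero, if_false, mul_zero, add_zero, Fin.reduceEq] at h0
  have v0 : v 0 = 0 := (mul_eq_zero.1 h0).resolve_right (h.deriv_time _ (mem_times_of_mem_base hz))
  rw [h.pd_two_snd z hz, h.pd_one_snd z hz, v0] at h2
  rw [v0] at h1
  have hs := h.scale_pos z hz
  have hε := h.sign_sq
  have v1 : v 1 = 0 := by
    refine (mul_eq_zero.1 (?_ : (pd 1 X z ^ 2 + pd 2 X z ^ 2) * v 1 = 0)).resolve_left hs.ne'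
    linear_combination pd 1 X z * h1 - ε * pd 2 X z * h2
      - (v 1 * pd 2 X z ^ 2 - v 2 * pd 1 X z * pd 2 X z) * hε
  have v2 : v 2 = 0 := by
    refine (mul_eq_zero.1 (?_ : (pd 1 X z ^ 2 + pd 2 X z ^ 2) * v 2 = 0)).resolve_left hs.ne'
    linear_combination pd 2 X z * h1 + ε * pd 1 X z * h2
      - (-v 1 * pd 1 X z * pd 2 X z + v 2 * pd 1 X z ^ 2) * hε
  ext i
  fin_cases i
  exacts [v0, v1, v2]

theorem pb_bijective : Function.Bijective (h.pb hΩ hz) :=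
  pull_bijective _ _ fun _ hv => h.eq_zero_of_fderiv_map hΩ hz hv

omit hz in
theorem graphMap_eventuallyEq {ψ : Base → ℝ} (hψ : ContDiffAt ℝ ∞ ψ z) (hp : (z, ψ z) ∈ Ω) :
    graphMap φ ψ =ᶠ[𝓝 z] map τ X Y := by
  have hc : ContinuousAt (fun w => (w, ψ w)) z := continuousAt_id.prodMk hψ.continuousAt
  filter_upwards [hc.eventually (hΩ.isOpen.mem_nhds hp)] with w hw
  rw [graphMap, h.eq _ hw]
  rfl

omit hz in
theorem contDiffAt {p : Total} (hp : p ∈ Ω) : ContDiffAt ℝ ∞ φ p := by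
  have hb := hΩ.isOpen_base.mem_nhds (mem_base hp)
  have h₁ : ContDiffAt ℝ ∞ (fun p : Total => (map τ X Y p.1, κ (p.1 0) * p.2 + χ p.1)) p := by
    refine ContDiffAt.prodMk ?_ (ContDiffAt.add (ContDiffAt.mul ?_ contDiffAt_snd) ?_)
    · exact ContDiffAt.comp (g := map τ X Y) p (h.contDiffAt_map hΩ (mem_base hp)) contDiffAt_fst
    · exact ContDiffAt.comp (g := κ) p (h.coeff hΩ (mem_base hp)) (by fun_prop)
    · exact ContDiffAt.comp (g := χ) p (h.shift hΩ (mem_base hp)) contDiffAt_fst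
  refine h₁.congr_of_eventuallyEq ?_
  filter_upwards [hΩ.isOpen.mem_nhds hp] with q hq using h.eq q hq

omit hΩ hz in
theorem graphMap_eq {ψ : Base → ℝ} (hp : (z, ψ z) ∈ Ω) : graphMap φ ψ z = map τ X Y z := by
  rw [graphMap, h.eq _ hp]
  rfl

/-- The base map no longer depends on `ψ`, so the image germ is affine in `ψ`; from here on
perturbations of source and image correspond linearly. -/
theorem mapsGraph_iff {ψ : Base → ℝ} (hψ : ContDiffAt ℝ ∞ ψ z) (hp : (z, ψ z) ∈ Ω)
    (a' : SGerm (map τ X Y z)) : MapsGraph φ ψ (z := z) a' ↔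
      h.pb hΩ hz a' = tm z κ (h.coeff hΩ hz) * of ψ hψ + of χ (h.shift hΩ hz) := by
  have hφ := h.contDiffAt hΩ hp
  have hmap := h.graphMap_eventuallyEq hΩ hψ hp
  have h₁ : of _ (contDiffAt_along hφ.snd hψ)
      = tm z κ (h.coeff hΩ hz) * of ψ hψ + of χ (h.shift hΩ hz) := by
    rw [tm, of_mul, of_add, of_eq_of]
    have hc : ContinuousAt (fun w => (w, ψ w)) z := continuousAt_id.prodMk hψ.continuousAt
    filter_upwards [hc.eventually (hΩ.isOpen.mem_nhds hp)] with w hw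
    rw [h.eq _ hw]
  have h₂ := pull_congr (contDiffAt_graphMap hφ hψ) (h.contDiffAt_map hΩ hz) hmap
    (h.graphMap_eq hp) rfl
  rw [← h₁]
  constructor
  · rintro ⟨_, _, _, ha⟩
    rw [h₂] at ha
    exact ha
  · intro ha
    refine ⟨hφ, hψ, h.graphMap_eq hp, ?_⟩
    rw [h₂]
    exact ha

end

end ConformalForm

open SGerm

theorem eq_zero_of_sq_add_sq {a b : ℝ} (h : a ^ 2 + b ^ 2 = 0) : a = 0 ∧ b = 0 := by
  constructor <;> nlinarith [sq_nonneg a, sq_nonneg b]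

/-- Lagrange's identity makes the squared determinant of a conformal matrix equal to `(a² + b²)²`,
so its columns span the plane and nothing else is orthogonal to both. -/
theorem eq_zero_of_conformal {a b c d n m : ℝ} (o : a * c + b * d = 0)
    (q : a ^ 2 + b ^ 2 = c ^ 2 + d ^ 2) (h : a ^ 2 + b ^ 2 ≠ 0) (h₁ : n * c + m * d = 0)
    (h₂ : n * a + m * b = 0) : n = 0 ∧ m = 0 := by
  have hdet : (a * d - b * c) ^ 2 = (a ^ 2 + b ^ 2) ^ 2 := by
    linear_combination (-(a ^ 2 + b ^ 2)) * q - (a * c + b * d) * o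
  have hdet0 : a * d - b * c ≠ 0 := fun h0 => by
    rw [h0] at hdet
    exact h (pow_eq_zero_iff two_ne_zero |>.1 (by linarith))
  constructor
  · refine (mul_eq_zero.1 (?_ : (a * d - b * c) * n = 0)).resolve_left hdet0
    linear_combination d * h₂ - b * h₁
  · refine (mul_eq_zero.1 (?_ : (a * d - b * c) * m = 0)).resolve_left hdet0
    linear_combination a * h₁ - c * h₂

theorem ConformalForm.ev_lap_pull {Ω : Set Total} {φ : Total → Total} {ε : ℝ} {τ : ℝ → ℝ}
    {X Y : Base → ℝ} {κ : ℝ → ℝ} {χ : Base → ℝ} {z z' : Base}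
    (h : ConformalForm Ω φ ε τ X Y κ χ) (hΩ : LocalDomain Ω) (hz : z ∈ base Ω) {F : Base → Base}
    (hF : ContDiffAt ℝ ∞ F z) (hFz : F z = z') (hmap : F =ᶠ[𝓝 z] ConformalForm.map τ X Y)
    (r : SGerm z') :
    ev z (lap (pull F hF hFz r)) = ev z (h.scale hΩ hz) * ev z' (lap r) := by
  obtain rfl : ConformalForm.map τ X Y z = z' := hmap.eq_of_nhds ▸ hFz
  rw [pull_congr hF (h.contDiffAt_map hΩ hz) hmap hFz rfl]
  have := congrArg (ev z) (h.lap_pb hΩ hz r)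
  rwa [map_mul, h.ev_pb hΩ hz] at this

/-! ### From admissibility to conformal form. -/

section

variable {Ω : Set Total} {f f' : ArbElem} {φ : Total → Total}

/-- The new independent variables do not depend on `ψ`. -/
theorem IsAdmissible.fderiv_vertical (h : IsAdmissible Ω f f' φ) (hΩ : LocalDomain Ω) {p : Total}
    (hp : p ∈ Ω) : (fderiv ℝ φ p (0, 1)).1 = 0 := by
  obtain ⟨N, ⟨a, ha⟩, hN, hN'⟩ := h.pointTransf.exists_slopes hp
  let pr : Fin 3 → Base →L[ℝ] ℝ := ContinuousLinearMap.proj (R := ℝ) (φ := fun _ : Fin 3 => ℝ)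
  obtain ⟨ε₁, hε₁, ha₁⟩ := hN' a ha (pr 1)
  obtain ⟨ε₂, hε₂, ha₂⟩ := hN' a ha (pr 2)
  set n := (fderiv ℝ φ p (0, 1)).1 with hn
  have shift : ∀ (v : Base) (b : Base →L[ℝ] ℝ) (ε : ℝ),
      (fderiv ℝ φ p (v, (a + ε • b) v)).1 = (fderiv ℝ φ p (v, a v)).1 + (ε * b v) • n := by
    intro v b ε
    have : ((v, (a + ε • b) v) : Total) = (v, a v) + (ε * b v) • ((0, 1) : Total) :=
      Prod.ext (by simp) (by simp)
    rw [this, map_add, map_smul, hn]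
    rfl
  have c₀ := h.conformal_of_transversal hΩ hp (hN a ha)
  have c₁ := h.conformal_of_transversal hΩ hp (hN _ ha₁)
  have c₂ := h.conformal_of_transversal hΩ hp (hN _ ha₂)
  have s11 : pr 1 (Pi.single 1 1) = 1 := by simp [pr]
  have s12 : pr 1 (Pi.single 2 1) = 0 := by simp [pr]
  have s21 : pr 2 (Pi.single 1 1) = 0 := by simp [pr]
  have s22 : pr 2 (Pi.single 2 1) = 1 := by simp [pr]
  simp only [shift, s11, s12, s21, s22, mul_one, mul_zero, zero_smul, add_zero, Pi.add_apply,
    Pi.smul_apply, Pi.zero_apply, smul_eq_mul] at c₁ c₂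
  set c := fun i : Fin 3 => (fderiv ℝ φ p (Pi.single i 1, a (Pi.single i 1))).1 with hc
  dsimp only at c₀
  obtain ⟨o₀, q₀⟩ := c₀
  have o₁ := c₁.1
  have o₂ := c₂.1
  -- Tilting the graph in the direction `x` adds `ε₁ n` to `c 1` and leaves `c 2` alone.
  -- Orthogonality before and after gives `n ⊥ c 2`; a tilt along `y` gives `n ⊥ c 1`.
  have e₁ : n 1 * c 2 1 + n 2 * c 2 2 = 0 := by
    refine (mul_eq_zero.1 (?_ : ε₁ * _ = 0)).resolve_left hε₁
    linear_combination o₁ - o₀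
  have e₂ : n 1 * c 1 1 + n 2 * c 1 2 = 0 := by
    refine (mul_eq_zero.1 (?_ : ε₂ * _ = 0)).resolve_left hε₂
    linear_combination o₂ - o₀
  have n0 : n 0 = 0 := h.fderiv_time hΩ.isOpen hp rfl
  -- Otherwise the lift of `∂_x` would be sent to a vertical vector, against transversality.
  have hpos : c 1 1 ^ 2 + c 1 2 ^ 2 ≠ 0 := by
    intro h0
    obtain ⟨h1, h2⟩ := eq_zero_of_sq_add_sq h0
    have h3 : c 1 0 = 0 := h.fderiv_time hΩ.isOpen hp (by simp)
    have : (Pi.single 1 1 : Base) = 0 := hN a ha _ (funext fun i => by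
      fin_cases i
      exacts [h3, h1, h2])
    simpa using congrFun this 1
  obtain ⟨n1, n2⟩ := eq_zero_of_conformal o₀ q₀ hpos e₁ e₂
  funext i
  fin_cases i
  exacts [n0, n1, n2]

theorem IsPointTransf.contDiffOn_fderiv (h : IsPointTransf Ω φ) (hΩ : LocalDomain Ω) :
    ContDiffOn ℝ ∞ (fun p => fderiv ℝ φ p (0, 1)) Ω := fun p hp =>
  (((h.contDiffAt hΩ.isOpen hp).fderiv_right (m := ∞) (by simp)).clm_apply
    contDiffAt_const).contDiffWithinAt

/-- The transformation of the independent variables is conformal in the plane. -/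
theorem IsAdmissible.exists_base (h : IsAdmissible Ω f f' φ) (hΩ : LocalDomain Ω) :
    ∃ (ε : ℝ) (τ : ℝ → ℝ) (X Y : Base → ℝ), (ε = 1 ∨ ε = -1) ∧ ContDiffOn ℝ ∞ τ (times Ω) ∧
      ContDiffOn ℝ ∞ X (base Ω) ∧ ContDiffOn ℝ ∞ Y (base Ω) ∧
      (∀ p ∈ Ω, (φ p).1 = ![τ (p.1 0), X p.1, Y p.1]) ∧
      (∀ z ∈ base Ω, pd 2 Y z = ε * pd 1 X z) ∧ (∀ z ∈ base Ω, pd 1 Y z = -ε * pd 2 X z) ∧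
      (∀ z ∈ base Ω, 0 < pd 1 X z ^ 2 + pd 2 X z ^ 2) ∧ ∀ t ∈ times Ω, deriv τ t ≠ 0 := by
  obtain ⟨τ, hτ, hT⟩ := h.exists_time hΩ
  have hcomp : ∀ i : Fin 3, ∃ g : Base → ℝ, ContDiffOn ℝ ∞ g (base Ω) ∧
      ∀ p ∈ Ω, (φ p).1 i = g p.1 := fun i => by
    refine hΩ.exists_eq_base
      (contDiffOn_pi.1 (contDiff_fst.comp_contDiffOn h.pointTransf.1) i) fun p hp => ?_
    have hd := ((h.pointTransf.contDiffAt hΩ.isOpen hp).differentiableAt (by simp)).hasFDerivAt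
    have := (hasFDerivAt_pi'.1 hd.fst i).fderiv
    change fderiv ℝ (fun p => (φ p).1 i) p (0, 1) = 0
    rw [this]
    exact congrFun (h.fderiv_vertical hΩ hp) i
  obtain ⟨X, hX, hX'⟩ := hcomp 1
  obtain ⟨Y, hY, hY'⟩ := hcomp 2
  have hconf : ∀ z ∈ base Ω, pd 1 X z * pd 2 X z + pd 1 Y z * pd 2 Y z = 0 ∧
      pd 1 X z ^ 2 + pd 1 Y z ^ 2 = pd 2 X z ^ 2 + pd 2 Y z ^ 2 ∧
      pd 1 X z ^ 2 + pd 1 Y z ^ 2 ≠ 0 := by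
    rintro _ ⟨p, hp, rfl⟩
    obtain ⟨N, ⟨a, ha⟩, hN, -⟩ := h.pointTransf.exists_slopes hp
    have hd := ((h.pointTransf.contDiffAt hΩ.isOpen hp).differentiableAt (by simp)).hasFDerivAt
    have key : ∀ (j : Fin 3) (g : Base → ℝ), ContDiffOn ℝ ∞ g (base Ω) →
        (∀ p ∈ Ω, (φ p).1 j = g p.1) → ∀ i : Fin 3,
        (fderiv ℝ φ p (Pi.single i 1, a (Pi.single i 1))).1 j = pd i g p.1 := by
      intro j g hg hg' i
      have h₁ := (hasFDerivAt_pi'.1 hd.fst j).fderiv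
      have h₂ : (fun p => (φ p).1 j) =ᶠ[𝓝 p] fun p => g p.1 := by
        filter_upwards [hΩ.isOpen.mem_nhds hp] with q hq using hg' q hq
      have h₃ := ((hg.contDiffAt (hΩ.isOpen_base.mem_nhds (mem_base hp))).differentiableAt
        (by simp)).hasFDerivAt.comp p (hasFDerivAt_fst (p := p))
      rw [Function.comp_def] at h₃
      rw [h₂.fderiv_eq, h₃.fderiv] at h₁
      exact (DFunLike.congr_fun h₁ (Pi.single i 1, a (Pi.single i 1))).symm
    have hc := h.conformal_of_transversal hΩ hp (hN a ha)
    simp only [key 1 X hX hX', key 2 Y hY hY'] at hc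
    refine ⟨hc.1, hc.2, fun h0 => ?_⟩
    obtain ⟨h1, h2⟩ := eq_zero_of_sq_add_sq h0
    have : (Pi.single 1 1 : Base) = 0 := hN a ha _ (funext fun i => by
      fin_cases i
      · exact h.fderiv_time hΩ.isOpen hp (by simp)
      · exact (key 1 X hX hX' 1).trans h1
      · exact (key 2 Y hY hY' 1).trans h2)
    simpa using congrFun this 1
  let J : Base → ℝ := fun z => pd 1 X z * pd 2 Y z - pd 2 X z * pd 1 Y z
  have hpd : ∀ (i : Fin 3) (g : Base → ℝ), ContDiffOn ℝ ∞ g (base Ω) →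
      ContinuousOn (pd i g) (base Ω) := fun i g hg z hz =>
    (contDiffAt_pd (hg.contDiffAt (hΩ.isOpen_base.mem_nhds hz)) i).continuousAt.continuousWithinAt
  have hJc : ContinuousOn J (base Ω) :=
    ((hpd 1 X hX).mul (hpd 2 Y hY)).sub ((hpd 2 X hX).mul (hpd 1 Y hY))
  have hJ2 : ∀ z ∈ base Ω, J z ^ 2 = (pd 1 X z ^ 2 + pd 1 Y z ^ 2) ^ 2 := fun z hz => by
    obtain ⟨h₁, h₂, -⟩ := hconf z hz
    simp only [J]
    linear_combination (-(pd 1 X z ^ 2 + pd 1 Y z ^ 2)) * h₂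
      - (pd 1 X z * pd 2 X z + pd 1 Y z * pd 2 Y z) * h₁
  have hJ0 : ∀ z ∈ base Ω, J z ≠ 0 := fun z hz h0 => by
    have := hJ2 z hz
    rw [h0] at this
    exact (hconf z hz).2.2 (pow_eq_zero_iff two_ne_zero |>.1 (by linarith))
  have hconn : IsPreconnected (base Ω) := hΩ.preconnected.image _ continuous_fst.continuousOn
  -- The Jacobian determinant is continuous without zeros on a connected set; its constant sign is
  -- `ε`.
  have hsign : (∀ z ∈ base Ω, 0 < J z) ∨ ∀ z ∈ base Ω, J z < 0 := by
    by_contra! hcon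
    obtain ⟨⟨z₁, hz₁, h₁⟩, z₂, hz₂, h₂⟩ := hcon
    obtain ⟨z, hz, h₀⟩ := hconn.intermediate_value hz₁ hz₂ hJc ⟨h₁, h₂⟩
    exact hJ0 z hz h₀
  have hcr : ∃ ε : ℝ, (ε = 1 ∨ ε = -1) ∧
      ∀ z ∈ base Ω, pd 2 Y z = ε * pd 1 X z ∧ pd 1 Y z = -ε * pd 2 X z := by
    have hpos : ∀ z, 0 ≤ pd 1 X z ^ 2 + pd 1 Y z ^ 2 := fun z => by positivity
    rcases hsign with hs | hs
    · refine ⟨1, Or.inl rfl, fun z hz => ?_⟩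
      obtain ⟨h₁, h₂, -⟩ := hconf z hz
      have hJz : pd 1 X z * pd 2 Y z - pd 2 X z * pd 1 Y z = pd 1 X z ^ 2 + pd 1 Y z ^ 2 :=
        (sq_eq_sq₀ (hs z hz).le (hpos z)).1 (hJ2 z hz)
      -- For orientation preserving conformal matrices the defects in the Cauchy–Riemann equations
      -- have square sum zero, because the determinant equals the squared length of either column.
      have h₃ : (pd 2 Y z - pd 1 X z) ^ 2 + (pd 1 Y z + pd 2 X z) ^ 2 = 0 := by
        linear_combination -2 * hJz - h₂
      obtain ⟨h₄, h₅⟩ := eq_zero_of_sq_add_sq h₃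
      exact ⟨by linarith, by linarith⟩
    · refine ⟨-1, Or.inr rfl, fun z hz => ?_⟩
      obtain ⟨h₁, h₂, -⟩ := hconf z hz
      have hJz : -(pd 1 X z * pd 2 Y z - pd 2 X z * pd 1 Y z) = pd 1 X z ^ 2 + pd 1 Y z ^ 2 :=
        (sq_eq_sq₀ (neg_pos.2 (hs z hz)).le (hpos z)).1 (by rw [neg_sq]; exact hJ2 z hz)
      have h₃ : (pd 2 Y z + pd 1 X z) ^ 2 + (pd 1 Y z - pd 2 X z) ^ 2 = 0 := by
        linear_combination -2 * hJz - h₂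
      obtain ⟨h₄, h₅⟩ := eq_zero_of_sq_add_sq h₃
      exact ⟨by linarith, by linarith⟩
  obtain ⟨ε, hε, hcr⟩ := hcr
  have hε2 : ε ^ 2 = 1 := by rcases hε with rfl | rfl <;> norm_num
  refine ⟨ε, τ, X, Y, hε, hτ, hX, hY, fun p hp => ?_, fun z hz => (hcr z hz).1,
    fun z hz => (hcr z hz).2, fun z hz => ?_,
    fun t ht => h.pointTransf.deriv_time_ne_zero hΩ hτ hT ht⟩
  · funext i
    fin_cases i
    exacts [hT p hp, hX' p hp, hY' p hp]
  · have h₁ := (hconf z hz).2.2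
    rw [(hcr z hz).2] at h₁
    have h₂ : pd 1 X z ^ 2 + (-ε * pd 2 X z) ^ 2 = pd 1 X z ^ 2 + pd 2 X z ^ 2 := by
      linear_combination pd 2 X z ^ 2 * hε2
    rw [h₂] at h₁
    positivity

/-- With `k = x` or `k = y` the image perturbation must be harmonic at the point, and by conformal
covariance this can be tested in the old coordinates. There the Laplacian is `2 E ∂_i P`, since `E`
is spatially stationary. As `P` is `∂ψ'/∂ψ` along the graph, varying the slope shows that this
coefficient depends on time only. -/
theorem IsAdmissible.exists_conformalForm (h : IsAdmissible Ω f f' φ) (hΩ : LocalDomain Ω) :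
    ∃ (ε : ℝ) (τ : ℝ → ℝ) (X Y : Base → ℝ) (κ : ℝ → ℝ) (χ : Base → ℝ),
      ConformalForm Ω φ ε τ X Y κ χ := by
  obtain ⟨ε, τ, X, Y, hε, hτ, hX, hY, hφ, h2, h1, hpos, hτ'⟩ := h.exists_base hΩ
  let S : Total → ℝ := fun p => (fderiv ℝ φ p (0, 1)).2
  have hS : ContDiffOn ℝ ∞ S Ω :=
    contDiff_snd.comp_contDiffOn (h.pointTransf.contDiffOn_fderiv hΩ)
  -- the transformation of the base space alone, extended trivially
  have hform : ConformalForm Ω (fun p => (![τ (p.1 0), X p.1, Y p.1], 1 * p.2 + 0)) ε τ X Y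
      (fun _ => 1) (fun _ => 0) :=
    ⟨hε, hτ, hX, hY, contDiffOn_const, contDiffOn_const, fun p _ => rfl, h2, h1, hpos, hτ',
      fun _ _ => one_ne_zero⟩
  have hslope : ∀ p ∈ Ω, ∀ a, Transversal φ p a → ∀ i : Fin 3, i ≠ 0 →
      fderiv ℝ S p (Pi.single i 1, a (Pi.single i 1)) = 0 := by
    intro p hp a ht i hi
    obtain ⟨v, hv⟩ := h.exists_mem_dom hp
    obtain ⟨z, y⟩ := p
    replace hv : (z, v) ∈ f.dom := hv
    obtain ⟨ψ, hψ, rfl, rfl, -, hsol⟩ := exists_solves y a hv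
    have hT : ∀ p ∈ Ω, (φ p).1 0 = τ (p.1 0) := fun p hp => by rw [hφ p hp]; rfl
    have hlapX : lap (SGerm.X z i) = 0 := by
      fin_cases i
      · exact absurd rfl hi
      all_goals simp [lap]
    obtain ⟨u, hG, hGz, P, q, E, hu, hu0, -, hbij, -, hP, hE, hE1, hE2, hr⟩ :=
      h.exists_time_perturbation hΩ hp hψ ht hsol hτ hT (k := SGerm.X z i) (by simp)
        (by rw [hlapX, map_zero])
    obtain ⟨hP₁, rfl⟩ := hP (by
      filter_upwards [hΩ.isOpen.mem_nhds hp] with p hp using h.fderiv_vertical hΩ hp)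
    obtain ⟨r, hr'⟩ := hbij.2 ((of _ hP₁ + SGerm.X z 0 * q) * E * SGerm.X z i)
    have hz : z ∈ base Ω := mem_base hp
    have hGmap : graphMap φ (fun w => ψ w + u w) =ᶠ[𝓝 z] ConformalForm.map τ X Y := by
      have hc : Tendsto (fun w => (w, ψ w + u w)) (𝓝 z) (𝓝 (z, ψ z)) := by
        have := (continuousAt_id.prodMk (hψ.continuousAt.add hu.continuousAt) :
          ContinuousAt (fun w => (w, ψ w + u w)) z).tendsto
        simpa [hu0] using this
      filter_upwards [hc.eventually (hΩ.isOpen.mem_nhds hp)] with w hw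
      exact hφ _ hw
    have hlap : ev z (lap (pull _ hG hGz r)) = 0 := by
      rw [hform.ev_lap_pull hΩ hz hG hGz hGmap, hr r hr', mul_zero]
    rw [hr', lap_mul, hlapX] at hlap
    have hd : ev z (d z i (of _ hP₁)) = 0 := by
      fin_cases i
      · exact absurd rfl hi
      · simp only [Fin.mk_one, map_add, map_mul, d_mul, ev_X, d_X_self, d_two_X_one, d_one_X_zero,
          map_zero, map_one, map_ofNat, hE1] at hlap ⊢
        refine (mul_eq_zero.1 (?_ : ev z E * _ = 0)).resolve_left hE
        linear_combination hlap / 2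
      · simp only [Fin.reduceFinMk, map_add, map_mul, d_mul, ev_X, d_X_self, d_one_X_two,
          d_two_X_zero, map_zero, map_one, map_ofNat, hE2] at hlap ⊢
        refine (mul_eq_zero.1 (?_ : ev z E * _ = 0)).resolve_left hE
        linear_combination hlap / 2
    rw [ev_d_of] at hd
    rw [← hd, fderiv_along (S := S)
      ((hS.contDiffAt (hΩ.isOpen.mem_nhds hp)).differentiableAt (by simp))
      (hψ.differentiableAt (by simp))]
  have hS0 : ∀ p ∈ Ω, ∀ m : Total, m.1 0 = 0 → fderiv ℝ S p m = 0 := by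
    intro p hp m hm
    obtain ⟨N, hne, hN, hN'⟩ := h.pointTransf.exists_slopes hp
    let L : Total →ₗ[ℝ] ℝ := (fderiv ℝ S p : Total →ₗ[ℝ] ℝ)
    have key : ∀ i : Fin 3, i ≠ 0 → L (Pi.single i 1, 0) = 0 ∧ L (0, 1) = 0 := fun i hi =>
      eq_zero_of_slopes hne hN' (Pi.single_ne_zero_iff.2 one_ne_zero) fun a ha =>
        hslope p hp a (hN a ha) i hi
    have hm' : m = m.1 1 • ((Pi.single 1 1, 0) : Total) + m.1 2 • ((Pi.single 2 1, 0) : Total)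
        + m.2 • ((0, 1) : Total) := by
      refine Prod.ext (funext fun i => ?_) (by simp)
      fin_cases i <;> simp [hm]
    change L m = 0
    rw [hm', map_add, map_add, map_smul, map_smul, map_smul, (key 1 (by decide)).1,
      (key 2 (by decide)).1, (key 1 (by decide)).2]
    simp
  obtain ⟨κ, hκ, hSκ⟩ := hΩ.exists_eq_time hS hS0
  have hκΩ : ∀ p ∈ Ω, ContDiffAt ℝ ∞ (fun p : Total => κ (p.1 0)) p := fun p hp =>
    ContDiffAt.comp (g := κ) p (hκ.contDiffAt (hΩ.isOpen_times.mem_nhds (mem_times hp)))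
      (by fun_prop)
  obtain ⟨χ, hχ, hχ'⟩ := hΩ.exists_eq_base (F := fun p => (φ p).2 - κ (p.1 0) * p.2)
    (fun p hp => ((h.pointTransf.contDiffAt hΩ.isOpen hp).snd.sub
      ((hκΩ p hp).mul contDiffAt_snd)).contDiffWithinAt) (by
    intro p hp
    have hd := ((h.pointTransf.contDiffAt hΩ.isOpen hp).differentiableAt (by simp)).hasFDerivAt
    have h₁ := ((hκΩ p hp).differentiableAt (by simp)).hasFDerivAt
    have h₂ : fderiv ℝ (fun p : Total => κ (p.1 0)) p (0, 1) = 0 := by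
      have h₃ := ((hκ.contDiffAt (hΩ.isOpen_times.mem_nhds (mem_times hp))).differentiableAt
        (by simp)).hasDerivAt.comp_hasFDerivAt p
        ((ContinuousLinearMap.proj (R := ℝ) (φ := fun _ : Fin 3 => ℝ) 0).comp
          (ContinuousLinearMap.fst ℝ Base ℝ)).hasFDerivAt
      rw [show fderiv ℝ (fun p : Total => κ (p.1 0)) p = _ from h₃.fderiv]
      simp
    have h₄ := hd.snd.sub (h₁.mul hasFDerivAt_snd)
    rw [show fderiv ℝ (fun p : Total => (φ p).2 - κ (p.1 0) * p.2) p = _ from h₄.fderiv]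
    have h₅ : (fderiv ℝ φ p (0, 1)).2 = κ (p.1 0) := hSκ p hp
    simp [h₂, h₅])
  refine ⟨ε, τ, X, Y, κ, χ, hε, hτ, hX, hY, hκ, hχ, fun p hp => ?_, h2, h1, hpos, hτ', ?_⟩
  · refine Prod.ext (hφ p hp) ?_
    have := hχ' p hp
    change (φ p).2 = κ (p.1 0) * p.2 + χ p.1
    linarith
  · rintro _ ⟨p, hp, rfl⟩ h0
    have h₁ : fderiv ℝ φ p (0, 1) = 0 :=
      Prod.ext (h.fderiv_vertical hΩ hp) ((hSκ p hp).trans h0)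
    have := (h.pointTransf.bijective_fderiv hp).1 (h₁.trans (map_zero _).symm)
    simpa using congrArg Prod.snd this

end

/-! ### Conditions on the conformal factor and on the coefficients `κ`, `χ`. -/

open SGerm

namespace ConformalForm

variable {Ω : Set Total} {f f' : ArbElem} {φ : Total → Total} {ε : ℝ} {τ : ℝ → ℝ}
  {X Y : Base → ℝ} {κ : ℝ → ℝ} {χ : Base → ℝ} {z : Base}

theorem pb_X_zero (h : ConformalForm Ω φ ε τ X Y κ χ) (hΩ : LocalDomain Ω) (hz : z ∈ base Ω) :
    ∃ q, h.pb hΩ hz (SGerm.X _ 0) = SGerm.X z 0 * (C z (deriv τ (z 0)) + SGerm.X z 0 * q) := by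
  obtain ⟨hτ, q, hq⟩ := exists_time_quotient (h.time hΩ hz)
  refine ⟨q, ?_⟩
  rw [← hq, pb, pull_X]
  rfl

theorem lap_tm_mul {hκ : ContDiffAt ℝ ∞ κ (z 0)} (u : SGerm z) :
    lap (tm z κ hκ * u) = tm z κ hκ * lap u := by
  simp [lap, Derivation.leibniz]
  ring

/-- The gradient of the new vorticity in terms of the old one. -/
theorem grad_vorticity (h : ConformalForm Ω φ ε τ X Y κ χ) (hΩ : LocalDomain Ω) (hz : z ∈ base Ω)
    (had : IsAdmissible Ω f f' φ) {ψ : Base → ℝ} (hp : (z, ψ z) ∈ Ω) (hψ : ContDiffAt ℝ ∞ ψ z)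
    (hsol : Solves f (of ψ hψ)) {a' : SGerm (map τ X Y z)}
    (ha : h.pb hΩ hz a' = tm z κ (h.coeff hΩ hz) * of ψ hψ + of χ (h.shift hΩ hz)) :
    deriv τ (z 0) * ev z (d z 1 (h.pb hΩ hz (lap a'))) = ε * ev z (d z 1 (lap (of ψ hψ))) ∧
    deriv τ (z 0) * ev z (d z 2 (h.pb hΩ hz (lap a'))) = ε * ev z (d z 2 (lap (of ψ hψ))) := by
  have hsol' : Solves f' a' := (had.solves_iff hp hψ ((h.mapsGraph_iff hΩ hz hψ hp a').2 ha)).1 hsol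
  have hτ0 := h.deriv_time _ (mem_times_of_mem_base hz)
  have hκ0 := h.coeff_ne_zero _ (mem_times_of_mem_base hz)
  have hε := h.sign_sq
  have key : ∀ α β s : ℝ, s + α * ev z (d z 2 (lap (of ψ hψ)))
      - β * ev z (d z 1 (lap (of ψ hψ))) = 0 →
      ε * s + deriv τ (z 0) * (α * ev z (d z 2 (h.pb hΩ hz (lap a')))
        - β * ev z (d z 1 (h.pb hΩ hz (lap a')))) = 0 := by
    intro α β s hs
    -- The gradient moves by `(α, β)` and `ζ_t` by `s`, all other quantities in the equation being
    -- fixed. The hypothesis on `s` says that the left hand side keeps its value.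
    obtain ⟨u, hu, hu'⟩ := (C z α * SGerm.X z 1 + C z β * SGerm.X z 2
      + C z (s / 2) * (SGerm.X z 0 * (SGerm.X z 1 * SGerm.X z 1))).exists_rep
    have hu0 : u z = 0 := by
      rw [← ev_of u hu, hu']
      simp
    have hlap : lap (of u hu) = C z s * SGerm.X z 0 := by
      have h2 : C z s = C z (s / 2) * 2 := by
        rw [← map_ofNat (C z) 2, ← map_mul]
        congr 1
        ring
      rw [hu', h2]
      simp [lap, Derivation.leibniz]
      ring
    have hpu : (z, ψ z + u z) ∈ Ω := by rwa [hu0, add_zero]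
    have e1 : ev z (d z 1 (of u hu)) = α := by
      rw [hu']
      simp [Derivation.leibniz]
    have e2 : ev z (d z 2 (of u hu)) = β := by
      rw [hu']
      simp [Derivation.leibniz]
    have hsolu : Solves f (of ψ hψ + of u hu) := by
      have h₁ : args (of ψ hψ + of u hu) = args (of ψ hψ) := by
        simp [args, lap_add, hlap, Derivation.leibniz]
      have h₂ : lhs (of ψ hψ + of u hu) = lhs (of ψ hψ) := by
        simp [lhs, lap_add, hlap, Derivation.leibniz, e1, e2]
        linear_combination hs
      rwa [Solves, h₁, h₂]
    obtain ⟨b', hb⟩ := (h.pb_bijective hΩ hz).2 (tm z κ (h.coeff hΩ hz) * of u hu)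
    have hsolb : Solves f' (a' + b') := by
      refine (had.solves_iff (ψ := fun w => ψ w + u w) hpu (hψ.add hu)
        ((h.mapsGraph_iff hΩ hz (hψ.add hu) hpu _).2 ?_)).1 hsolu
      rw [map_add, ha, hb, ← of_add hψ hu]
      ring
    obtain ⟨q, hq⟩ := h.pb_X_zero hΩ hz
    set W := C z (deriv τ (z 0)) + SGerm.X z 0 * q with hW
    have hW0 : ev z W = deriv τ (z 0) := by simp [hW]
    obtain ⟨W', hW'⟩ := (isUnit_iff.2 (hW0 ▸ hτ0) : IsUnit W).exists_right_inv
    obtain ⟨M', hM'⟩ := (h.isUnit_scale hΩ hz).exists_right_inv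
    obtain ⟨k, hk⟩ := (h.pb_bijective hΩ hz).2 (tm z κ (h.coeff hΩ hz) * C z s * M' * W')
    -- In the image too the vorticity changes by a multiple of the time increment, so the arguments
    -- of `H` are unchanged and the value of `k` is the change of `ζ_t`.
    have hlapb : lap b' = SGerm.X _ 0 * k := by
      refine (h.pb_bijective hΩ hz).1 ((h.isUnit_scale hΩ hz).mul_left_cancel ?_)
      rw [← h.lap_pb hΩ hz, hb, lap_tm_mul, hlap, map_mul, hq, hk]
      linear_combination (-(tm z κ (h.coeff hΩ hz) * C z s * SGerm.X z 0)) * hM'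
        - h.scale hΩ hz * M' * (tm z κ (h.coeff hΩ hz) * C z s * SGerm.X z 0) * hW'
    have hargs : args (a' + b') = args a' := by
      simp [args, lap_add, hlapb, Derivation.leibniz]
    have hlhs := hsolb.2
    rw [hargs, ← hsol'.2] at hlhs
    simp only [lhs, lap_add, hlapb, map_add, d_mul, map_mul, ev_X, d_X_self, d_one_X_zero,
      d_two_X_zero, mul_zero, zero_mul, add_zero, zero_add, mul_one] at hlhs
    have hbr := congrArg (ev z) (h.bracket_pb hΩ hz b' (lap a'))
    rw [hb] at hbr
    simp only [map_sub, map_mul, h.ev_pb hΩ hz, d_mul, d_one_tm, d_two_tm, e1, e2, ev_tm,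
      mul_zero, add_zero, ev_C] at hbr
    have hkv : ev _ k * (ev z (h.scale hΩ hz) * deriv τ (z 0)) = κ (z 0) * s := by
      have h₁ := congrArg (ev z) hW'
      have h₂ := congrArg (ev z) hM'
      rw [map_mul, map_one, hW0] at h₁
      rw [map_mul, map_one] at h₂
      rw [← h.ev_pb hΩ hz, hk]
      simp only [map_mul, ev_tm, ev_C]
      linear_combination κ (z 0) * s * h₂
        + κ (z 0) * s * ev z M' * ev z (h.scale hΩ hz) * h₁
    refine (mul_eq_zero.1 (?_ : κ (z 0) * _ = 0)).resolve_left hκ0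
    linear_combination (-ε) * hkv + deriv τ (z 0) * hbr
      + deriv τ (z 0) * ε * ev z (h.scale hΩ hz) * hlhs
  -- Unit changes of `ψ_y` and of `ψ_x`, each compensated by the matching change of `ζ_t`.
  have k1 := key 0 1 (ev z (d z 1 (lap (of ψ hψ)))) (by ring)
  have k2 := key 1 0 (-ev z (d z 2 (lap (of ψ hψ)))) (by ring)
  exact ⟨by linear_combination -k1, by linear_combination k2⟩

/-- Inside an open set the two coordinates can be moved one at a time, which isolates the
coefficients. -/
theorem eq_zero_of_affine {A B c : ℝ} {v : Fin 6 → ℝ} {i : Fin 6} (hi : i ≠ 0)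
    {s : Set (Fin 6 → ℝ)} (hs : IsOpen s) (hv : v ∈ s)
    (h : ∀ w ∈ s, A * w 0 + B * w i + c = 0) : A = 0 ∧ B = 0 ∧ c = 0 := by
  have key : ∀ j : Fin 6, ∃ η : ℝ, η ≠ 0 ∧ v + η • Pi.single j 1 ∈ s := fun j => by
    have hc : ContinuousAt (fun η : ℝ => v + η • (Pi.single j 1 : Fin 6 → ℝ)) 0 := by fun_prop
    have h₁ : ∀ᶠ η in 𝓝[≠] (0 : ℝ), v + η • (Pi.single j 1 : Fin 6 → ℝ) ∈ s :=
      (hc.eventually (by simpa using hs.mem_nhds hv)).filter_mono nhdsWithin_le_nhds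
    obtain ⟨η, h₂, h₃⟩ := (h₁.and self_mem_nhdsWithin).exists
    exact ⟨η, h₃, h₂⟩
  obtain ⟨η₀, hη₀, h₀⟩ := key 0
  obtain ⟨η₁, hη₁, h₁⟩ := key i
  have e := h v hv
  have e₀ := h _ h₀
  have e₁ := h _ h₁
  simp only [Pi.add_apply, Pi.smul_apply, Pi.single_eq_same, Pi.single_eq_of_ne hi,
    Pi.single_eq_of_ne hi.symm, smul_eq_mul, mul_one, mul_zero, add_zero] at e₀ e₁
  have hA : A = 0 := (mul_eq_zero.1 (by linear_combination e₀ - e : A * η₀ = 0)).resolve_right hη₀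
  have hB : B = 0 := (mul_eq_zero.1 (by linear_combination e₁ - e : B * η₁ = 0)).resolve_right hη₁
  exact ⟨hA, hB, by rw [hA, hB] at e; linarith⟩

/-- The conditions that the equation imposes on a transformation of conformal form. -/
theorem conditions (h : ConformalForm Ω φ ε τ X Y κ χ) (hΩ : LocalDomain Ω) (hz : z ∈ base Ω)
    (had : IsAdmissible Ω f f' φ) :
    ev z (d z 1 (h.scale hΩ hz)) = 0 ∧ ev z (d z 2 (h.scale hΩ hz)) = 0 ∧
    deriv τ (z 0) * κ (z 0) = ε * ev z (h.scale hΩ hz) ∧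
    ev z (d z 1 (lap (of χ (h.shift hΩ hz)))) = 0 ∧
    ev z (d z 2 (lap (of χ (h.shift hΩ hz)))) = 0 := by
  obtain ⟨⟨z, y⟩, hp, rfl⟩ := id hz
  obtain ⟨v, hv⟩ := had.exists_mem_dom hp
  replace hv : (z, v) ∈ f.dom := hv
  replace hz : z ∈ base Ω := hz
  have hτ0 := h.deriv_time _ (mem_times_of_mem_base hz)
  have hκ0 := h.coeff_ne_zero _ (mem_times_of_mem_base hz)
  have hs : IsOpen {w : Fin 6 → ℝ | (z, w) ∈ f.dom} := f.isOpen_dom.preimage (by fun_prop)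
  have hm0 : ev z (h.scale hΩ hz) ≠ 0 := isUnit_iff.1 (h.isUnit_scale hΩ hz)
  set m := ev z (h.scale hΩ hz)
  set L := lap (of χ (h.shift hΩ hz))
  -- Differentiating `m ζ' = κ ζ + Δχ` and eliminating `ζ'` and its gradient, known from
  -- `grad_vorticity`, leaves a relation affine in the freely varying `ζ` and `ζ_x` or `ζ_y`.
  have key : ∀ w ∈ {w : Fin 6 → ℝ | (z, w) ∈ f.dom},
      (∀ i : Fin 3, i = 1 ∨ i = 2 → ∀ j : Fin 6, (i = 1 → j = 1) → (i = 2 → j = 2) →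
        (ev z (d z i (h.scale hΩ hz)) * deriv τ (z 0) * κ (z 0)) * w 0
        + (m * (ε * m - deriv τ (z 0) * κ (z 0))) * w j
        + (ev z (d z i (h.scale hΩ hz)) * deriv τ (z 0) * ev z L
          - m * deriv τ (z 0) * ev z (d z i L)) = 0) := by
    intro w hw
    obtain ⟨ψ, hψ, rfl, -, hargs, hsol⟩ := exists_solves (f := f) y 0 hw
    obtain ⟨a', ha⟩ := (h.pb_bijective hΩ hz).2
      (tm z κ (h.coeff hΩ hz) * of ψ hψ + of χ (h.shift hΩ hz))
    obtain ⟨g₁, g₂⟩ := h.grad_vorticity hΩ hz had hp hψ hsol ha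
    have hZ := h.lap_pb hΩ hz a'
    rw [ha, lap_add, lap_tm_mul] at hZ
    have z₀ := congrArg (ev z) hZ
    have w₀ : ev z (lap (of ψ hψ)) = w 0 := congrArg (fun A : Arg => A.2 0) hargs
    have w₁ : ev z (d z 1 (lap (of ψ hψ))) = w 1 := congrArg (fun A : Arg => A.2 1) hargs
    have w₂ : ev z (d z 2 (lap (of ψ hψ))) = w 2 := congrArg (fun A : Arg => A.2 2) hargs
    simp only [map_add, map_mul, ev_tm, w₀] at z₀
    intro i hi j h1 h2
    rcases hi with rfl | rfl
    · obtain rfl := h1 rfl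
      have z₁ := congrArg (fun a => ev z (d z 1 a)) hZ
      simp only [map_add, d_mul, map_mul, ev_tm, d_one_tm, mul_zero, add_zero,
        w₁] at z₁
      rw [w₁] at g₁
      linear_combination (-(deriv τ (z 0)) * m) * z₁
        + ev z (d z 1 (h.scale hΩ hz)) * deriv τ (z 0) * z₀ - m ^ 2 * g₁
    · obtain rfl := h2 rfl
      have z₂ := congrArg (fun a => ev z (d z 2 a)) hZ
      simp only [map_add, d_mul, map_mul, ev_tm, d_two_tm, mul_zero, add_zero,
        w₂] at z₂
      rw [w₂] at g₂
      linear_combination (-(deriv τ (z 0)) * m) * z₂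
        + ev z (d z 2 (h.scale hΩ hz)) * deriv τ (z 0) * z₀ - m ^ 2 * g₂
  obtain ⟨a₁, b₁, c₁⟩ := eq_zero_of_affine (i := 1) (by decide) hs hv fun w hw =>
    key w hw 1 (Or.inl rfl) 1 (fun _ => rfl) (fun h => absurd h (by decide))
  obtain ⟨a₂, -, c₂⟩ := eq_zero_of_affine (i := 2) (by decide) hs hv fun w hw =>
    key w hw 2 (Or.inr rfl) 2 (fun h => absurd h (by decide)) (fun _ => rfl)
  have s₁ : ev z (d z 1 (h.scale hΩ hz)) = 0 := by simpa [hτ0, hκ0] using a₁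
  have s₂ : ev z (d z 2 (h.scale hΩ hz)) = 0 := by simpa [hτ0, hκ0] using a₂
  rw [s₁] at c₁
  rw [s₂] at c₂
  refine ⟨s₁, s₂, ?_, ?_, ?_⟩
  · have := (mul_eq_zero.1 b₁).resolve_left hm0
    linarith
  · simpa [hτ0, hm0] using c₁
  · simpa [hτ0, hm0] using c₂

end ConformalForm

/-! ### The explicit family and the transformation of vorticity. -/

namespace SGerm

variable {z : Base}

/-- The germ of a coordinate function. -/
def co (z : Base) (i : Fin 3) : SGerm z := of (fun w => w i) (by fun_prop)

theorem co_eq (i : Fin 3) : co z i = C z (z i) + X z i := by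
  rw [co, X, C_apply, of_add, of_eq_of]
  exact Eventually.of_forall fun w => by simp

@[simp] theorem ev_co (i : Fin 3) : ev z (co z i) = z i := rfl

theorem d_co (i j : Fin 3) : d z i (co z j) = if i = j then 1 else 0 := by
  rw [co_eq, map_add, d_C, d_X, zero_add]

@[simp] theorem d_co_self (i : Fin 3) : d z i (co z i) = 1 := by simp [d_co]
@[simp] theorem d_zero_co_one : d z 0 (co z 1) = 0 := by simp [d_co]
@[simp] theorem d_zero_co_two : d z 0 (co z 2) = 0 := by simp [d_co]
@[simp] theorem d_one_co_two : d z 1 (co z 2) = 0 := by simp [d_co]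
@[simp] theorem d_two_co_one : d z 2 (co z 1) = 0 := by simp [d_co]

theorem tm_congr {f g : ℝ → ℝ} (hf : ContDiffAt ℝ ∞ f (z 0)) (hg : ContDiffAt ℝ ∞ g (z 0))
    (h : f =ᶠ[𝓝 (z 0)] g) : tm z f hf = tm z g hg :=
  of_eq_of.2 ((continuous_apply (0 : Fin 3)).continuousAt.eventually h)

end SGerm

open SGerm

/-- The component `x` of the transformations of the theorem. -/
def fstForm (l β γ₁ : ℝ → ℝ) (z : Base) : ℝ :=
  l (z 0) * (z 1 * Real.cos (β (z 0)) - z 2 * Real.sin (β (z 0))) + γ₁ (z 0)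

/-- The component `y` of the transformations of the theorem. -/
def sndForm (ε : ℝ) (l β γ₂ : ℝ → ℝ) (z : Base) : ℝ :=
  ε * (l (z 0) * (z 1 * Real.sin (β (z 0)) + z 2 * Real.cos (β (z 0))) + γ₂ (z 0))

/-- The coefficient of `ψ` in the transformations of the theorem. -/
def coeffForm (ε : ℝ) (τ l : ℝ → ℝ) (t : ℝ) : ℝ := ε * (l t * (deriv τ t)⁻¹) * l t

/-- The summand of the new `ψ` that is induced by the motion of the frame. -/
def gaugeForm (ε : ℝ) (τ l β γ₁ γ₂ : ℝ → ℝ) (z : Base) : ℝ :=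
  ε * (l (z 0) * (deriv τ (z 0))⁻¹) * (l (z 0) * 2⁻¹ * deriv β (z 0) * (z 1 * z 1 + z 2 * z 2)
    - deriv γ₁ (z 0) * (z 1 * Real.sin (β (z 0)) + z 2 * Real.cos (β (z 0)))
    + deriv γ₂ (z 0) * (z 1 * Real.cos (β (z 0)) - z 2 * Real.sin (β (z 0))))

/-- The summand of the new `ψ` that is independent of `ψ`. -/
def shiftForm (ε : ℝ) (τ l β γ₁ γ₂ σ : ℝ → ℝ) (δ : Base → ℝ) (z : Base) : ℝ :=
  gaugeForm ε τ l β γ₁ γ₂ z + δ z + σ (z 0) * 2⁻¹ * (z 1 * z 1 + z 2 * z 2)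

/-- The component `H` of the transformations of the theorem. -/
def elemForm (ε : ℝ) (τ l β σ : ℝ → ℝ) (δ : Base → ℝ) (z : Base) (v : Fin 3 → ℝ) (H : ℝ) : ℝ :=
  ε / deriv τ (z 0) ^ 2
      * (H - deriv (deriv τ) (z 0) / deriv τ (z 0) * v 0
        - deriv l (z 0) / l (z 0) * (z 1 * v 1 + z 2 * v 2)
        + 2 * deriv (deriv β) (z 0)
        - 2 * (deriv (deriv τ) (z 0) / deriv τ (z 0)) * deriv β (z 0))
    - (pd 2 δ z + σ (z 0) * z 2) / (deriv τ (z 0) * l (z 0) ^ 2) * v 1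
    + (pd 1 δ z + σ (z 0) * z 1) / (deriv τ (z 0) * l (z 0) ^ 2) * v 2
    + 2 / deriv τ (z 0) * deriv (fun s => σ s / l s ^ 2) (z 0)

/-- The transformations of the theorem. -/
structure NormalForm (Ω : Set Total) (φ : Total → Total) (ε : ℝ) (τ l β γ₁ γ₂ σ : ℝ → ℝ)
    (δ : Base → ℝ) : Prop where
  sign : ε = 1 ∨ ε = -1
  smooth_time : ContDiffOn ℝ ∞ τ (times Ω)
  smooth_scale : ContDiffOn ℝ ∞ l (times Ω)
  smooth_angle : ContDiffOn ℝ ∞ β (times Ω)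
  smooth_fst : ContDiffOn ℝ ∞ γ₁ (times Ω)
  smooth_snd : ContDiffOn ℝ ∞ γ₂ (times Ω)
  smooth_vort : ContDiffOn ℝ ∞ σ (times Ω)
  smooth_harm : ContDiffOn ℝ ∞ δ (base Ω)
  scale_pos : ∀ t ∈ times Ω, 0 < l t
  deriv_time : ∀ t ∈ times Ω, deriv τ t ≠ 0
  harmonic : ∀ z ∈ base Ω, pd 1 (pd 1 δ) z + pd 2 (pd 2 δ) z = 0
  eq : ∀ p ∈ Ω, φ p = (ConformalForm.map τ (fstForm l β γ₁) (sndForm ε l β γ₂) p.1,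
    coeffForm ε τ l (p.1 0) * p.2 + shiftForm ε τ l β γ₁ γ₂ σ δ p.1)

section

variable {z : Base} {ε : ℝ} {τ l β γ₁ γ₂ σ : ℝ → ℝ} {δ : Base → ℝ}

theorem contDiffAt_time {τ : ℝ → ℝ} (hτ : ContDiffAt ℝ ∞ τ (z 0)) :
    ContDiffAt ℝ ∞ (fun w : Base => τ (w 0)) z := ContDiffAt.comp z hτ (by fun_prop)

theorem contDiffAt_inv_deriv (hτ : ContDiffAt ℝ ∞ τ (z 0)) (h0 : deriv τ (z 0) ≠ 0) :
    ContDiffAt ℝ ∞ (fun t => (deriv τ t)⁻¹) (z 0) := (contDiffAt_deriv hτ).inv h0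

theorem contDiffAt_fstForm (hl : ContDiffAt ℝ ∞ l (z 0)) (hβ : ContDiffAt ℝ ∞ β (z 0))
    (h₁ : ContDiffAt ℝ ∞ γ₁ (z 0)) : ContDiffAt ℝ ∞ (fstForm l β γ₁) z := by
  have := contDiffAt_time hl
  have := contDiffAt_time hβ
  have := contDiffAt_time h₁
  unfold fstForm
  fun_prop

theorem contDiffAt_sndForm (hl : ContDiffAt ℝ ∞ l (z 0)) (hβ : ContDiffAt ℝ ∞ β (z 0))
    (h₂ : ContDiffAt ℝ ∞ γ₂ (z 0)) : ContDiffAt ℝ ∞ (sndForm ε l β γ₂) z := by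
  have := contDiffAt_time hl
  have := contDiffAt_time hβ
  have := contDiffAt_time h₂
  unfold sndForm
  fun_prop

theorem contDiffAt_gaugeForm (hτ : ContDiffAt ℝ ∞ τ (z 0)) (h0 : deriv τ (z 0) ≠ 0)
    (hl : ContDiffAt ℝ ∞ l (z 0)) (hβ : ContDiffAt ℝ ∞ β (z 0)) (h₁ : ContDiffAt ℝ ∞ γ₁ (z 0))
    (h₂ : ContDiffAt ℝ ∞ γ₂ (z 0)) : ContDiffAt ℝ ∞ (gaugeForm ε τ l β γ₁ γ₂) z := by
  have := contDiffAt_time (contDiffAt_inv_deriv hτ h0)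
  have := contDiffAt_time hl
  have := contDiffAt_time hβ
  have := contDiffAt_time (contDiffAt_deriv hβ)
  have := contDiffAt_time (contDiffAt_deriv h₁)
  have := contDiffAt_time (contDiffAt_deriv h₂)
  unfold gaugeForm
  fun_prop

theorem of_fstForm (hl : ContDiffAt ℝ ∞ l (z 0)) (hβ : ContDiffAt ℝ ∞ β (z 0))
    (h₁ : ContDiffAt ℝ ∞ γ₁ (z 0)) : of (fstForm l β γ₁) (contDiffAt_fstForm hl hβ h₁)
      = tm z l hl * (co z 1 * tm z _ hβ.cos - co z 2 * tm z _ hβ.sin) + tm z γ₁ h₁ := rfl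

theorem of_sndForm (hl : ContDiffAt ℝ ∞ l (z 0)) (hβ : ContDiffAt ℝ ∞ β (z 0))
    (h₂ : ContDiffAt ℝ ∞ γ₂ (z 0)) : of (sndForm ε l β γ₂) (contDiffAt_sndForm hl hβ h₂)
      = C z ε * (tm z l hl * (co z 1 * tm z _ hβ.sin + co z 2 * tm z _ hβ.cos) + tm z γ₂ h₂) := rfl

theorem of_gaugeForm (hτ : ContDiffAt ℝ ∞ τ (z 0)) (h0 : deriv τ (z 0) ≠ 0)
    (hl : ContDiffAt ℝ ∞ l (z 0)) (hβ : ContDiffAt ℝ ∞ β (z 0)) (h₁ : ContDiffAt ℝ ∞ γ₁ (z 0))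
    (h₂ : ContDiffAt ℝ ∞ γ₂ (z 0)) : of (gaugeForm ε τ l β γ₁ γ₂)
        (contDiffAt_gaugeForm hτ h0 hl hβ h₁ h₂)
      = C z ε * (tm z l hl * tm z _ (contDiffAt_inv_deriv hτ h0))
        * (tm z l hl * C z 2⁻¹ * tm z _ (contDiffAt_deriv hβ)
            * (co z 1 * co z 1 + co z 2 * co z 2)
          - tm z _ (contDiffAt_deriv h₁) * (co z 1 * tm z _ hβ.sin + co z 2 * tm z _ hβ.cos)
          + tm z _ (contDiffAt_deriv h₂) * (co z 1 * tm z _ hβ.cos - co z 2 * tm z _ hβ.sin)) :=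
  rfl

theorem C_two_inv : C z 2⁻¹ * 2 = 1 := by
  rw [← map_ofNat (C z) 2, ← map_mul]
  norm_num

/-- At fixed time the terms with `γ₁` and `γ₂` are linear in `x, y`; only the quadratic term of the
rotation contributes. -/
theorem lap_gaugeForm (hτ : ContDiffAt ℝ ∞ τ (z 0)) (h0 : deriv τ (z 0) ≠ 0)
    (hl : ContDiffAt ℝ ∞ l (z 0)) (hβ : ContDiffAt ℝ ∞ β (z 0)) (h₁ : ContDiffAt ℝ ∞ γ₁ (z 0))
    (h₂ : ContDiffAt ℝ ∞ γ₂ (z 0)) :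
    lap (of (gaugeForm ε τ l β γ₁ γ₂) (contDiffAt_gaugeForm hτ h0 hl hβ h₁ h₂))
      = 2 * C z ε * (tm z l hl ^ 2 * tm z _ (contDiffAt_inv_deriv hτ h0))
        * tm z _ (contDiffAt_deriv hβ) := by
  rw [of_gaugeForm hτ h0 hl hβ h₁ h₂]
  simp only [lap, d_mul, map_add, map_sub, d_one_tm, d_two_tm, d_C, d_co_self, d_one_co_two,
    d_two_co_one, map_zero, mul_zero, mul_one, add_zero, zero_add, sub_zero]
  linear_combination (2 * C z ε * tm z l hl ^ 2 * tm z _ (contDiffAt_inv_deriv hτ h0)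
    * tm z _ (contDiffAt_deriv hβ)) * C_two_inv (z := z)

end

open SGerm

namespace NormalForm

variable {Ω : Set Total} {φ : Total → Total} {ε : ℝ} {τ l β γ₁ γ₂ σ : ℝ → ℝ} {δ : Base → ℝ}
  {z : Base} (h : NormalForm Ω φ ε τ l β γ₁ γ₂ σ δ) (hΩ : LocalDomain Ω) (hz : z ∈ base Ω)

include hΩ hz in
theorem at_time {g : ℝ → ℝ} (hg : ContDiffOn ℝ ∞ g (times Ω)) : ContDiffAt ℝ ∞ g (z 0) :=
  hg.contDiffAt (hΩ.isOpen_times.mem_nhds (mem_times_of_mem_base hz))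

include h

theorem deriv_ne : ∀ z ∈ base Ω, deriv τ (z 0) ≠ 0 := fun _ hz =>
  h.deriv_time _ (mem_times_of_mem_base hz)

theorem scale_ne : ∀ z ∈ base Ω, l (z 0) ≠ 0 := fun _ hz =>
  (h.scale_pos _ (mem_times_of_mem_base hz)).ne'

theorem sign_sq : ε * ε = 1 := by
  rcases h.sign with h | h <;> rw [h] <;> norm_num

include hΩ hz

theorem harm : ContDiffAt ℝ ∞ δ z := h.smooth_harm.contDiffAt (hΩ.isOpen_base.mem_nhds hz)

theorem d_fst : d z 1 (of _ (contDiffAt_fstForm (at_time hΩ hz h.smooth_scale)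
      (at_time hΩ hz h.smooth_angle) (at_time hΩ hz h.smooth_fst)))
      = tm z l (at_time hΩ hz h.smooth_scale) * tm z _ (at_time hΩ hz h.smooth_angle).cos ∧
    d z 2 (of _ (contDiffAt_fstForm (at_time hΩ hz h.smooth_scale)
      (at_time hΩ hz h.smooth_angle) (at_time hΩ hz h.smooth_fst)))
      = -(tm z l (at_time hΩ hz h.smooth_scale) * tm z _ (at_time hΩ hz h.smooth_angle).sin) := by
  rw [of_fstForm (at_time hΩ hz h.smooth_scale)
      (at_time hΩ hz h.smooth_angle) (at_time hΩ hz h.smooth_fst)]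
  constructor <;>
  simp only [d_mul, map_add, map_sub, d_one_tm, d_two_tm, d_co_self, d_one_co_two,
    d_two_co_one, mul_zero, mul_one, add_zero, zero_add, sub_zero, zero_sub, mul_neg]

theorem d_snd : d z 1 (of _ (contDiffAt_sndForm (ε := ε) (at_time hΩ hz h.smooth_scale)
      (at_time hΩ hz h.smooth_angle) (at_time hΩ hz h.smooth_snd)))
      = C z ε * (tm z l (at_time hΩ hz h.smooth_scale)
        * tm z _ (at_time hΩ hz h.smooth_angle).sin) ∧
    d z 2 (of _ (contDiffAt_sndForm (ε := ε) (at_time hΩ hz h.smooth_scale)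
      (at_time hΩ hz h.smooth_angle) (at_time hΩ hz h.smooth_snd)))
      = C z ε * (tm z l (at_time hΩ hz h.smooth_scale)
        * tm z _ (at_time hΩ hz h.smooth_angle).cos) := by
  rw [of_sndForm (at_time hΩ hz h.smooth_scale)
      (at_time hΩ hz h.smooth_angle) (at_time hΩ hz h.smooth_snd)]
  constructor <;>
  simp only [d_mul, map_add, d_one_tm, d_two_tm, d_C, d_co_self, d_one_co_two,
    d_two_co_one, mul_zero, mul_one, add_zero, zero_add]

theorem contDiffAt_shiftForm : ContDiffAt ℝ ∞ (shiftForm ε τ l β γ₁ γ₂ σ δ) z := by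
  have h₁ := contDiffAt_gaugeForm (ε := ε) (at_time hΩ hz h.smooth_time) (h.deriv_ne z hz)
    (at_time hΩ hz h.smooth_scale) (at_time hΩ hz h.smooth_angle) (at_time hΩ hz h.smooth_fst)
    (at_time hΩ hz h.smooth_snd)
  have h₂ := contDiffAt_time (at_time hΩ hz h.smooth_vort)
  exact (h₁.add (h.harm hΩ hz)).add ((h₂.mul contDiffAt_const).mul (by fun_prop))

omit hz in
theorem toConformalForm : ConformalForm Ω φ ε τ (fstForm l β γ₁) (sndForm ε l β γ₂)
    (coeffForm ε τ l) (shiftForm ε τ l β γ₁ γ₂ σ δ) where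
  sign := h.sign
  smooth_time := h.smooth_time
  smooth_fst z hz := (contDiffAt_fstForm (at_time hΩ hz h.smooth_scale)
    (at_time hΩ hz h.smooth_angle) (at_time hΩ hz h.smooth_fst)).contDiffWithinAt
  smooth_snd z hz := (contDiffAt_sndForm (at_time hΩ hz h.smooth_scale)
    (at_time hΩ hz h.smooth_angle) (at_time hΩ hz h.smooth_snd)).contDiffWithinAt
  smooth_coeff t ht := by
    have h₁ := h.smooth_scale.contDiffAt (hΩ.isOpen_times.mem_nhds ht)
    have h₂ := (contDiffAt_deriv
      (h.smooth_time.contDiffAt (hΩ.isOpen_times.mem_nhds ht))).inv (h.deriv_time t ht)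
    exact ((contDiffAt_const.mul (h₁.mul h₂)).mul h₁).contDiffWithinAt
  smooth_shift z hz := (h.contDiffAt_shiftForm hΩ hz).contDiffWithinAt
  eq := h.eq
  pd_two_snd z hz := by
    have h₁ := congrArg (ev z) (h.d_fst hΩ hz).1
    have h₂ := congrArg (ev z) (h.d_snd hΩ hz).2
    rw [d_of, ev_of] at h₁ h₂
    rw [h₁, h₂]
    simp
  pd_one_snd z hz := by
    have h₁ := congrArg (ev z) (h.d_fst hΩ hz).2
    have h₂ := congrArg (ev z) (h.d_snd hΩ hz).1
    rw [d_of, ev_of] at h₁ h₂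
    rw [h₁, h₂]
    simp
  scale_pos z hz := by
    have h₁ := congrArg (ev z) (h.d_fst hΩ hz).1
    have h₂ := congrArg (ev z) (h.d_fst hΩ hz).2
    rw [d_of, ev_of] at h₁ h₂
    rw [h₁, h₂]
    have := h.scale_pos _ (mem_times_of_mem_base hz)
    simp only [map_mul, map_neg, ev_tm]
    have h₃ := Real.sin_sq_add_cos_sq (β (z 0))
    have : (l (z 0) * Real.cos (β (z 0))) ^ 2 + (-(l (z 0) * Real.sin (β (z 0)))) ^ 2
      = l (z 0) ^ 2 := by linear_combination l (z 0) ^ 2 * h₃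
    rw [this]
    positivity
  deriv_time := h.deriv_time
  coeff_ne_zero t ht := by
    have h₁ := (h.scale_pos t ht).ne'
    have h₂ := h.deriv_time t ht
    have h₃ : ε ≠ 0 := fun h₄ => by simpa [h₄] using h.sign_sq
    unfold coeffForm
    positivity

/-- The pullback of germs along the transformation. -/
abbrev pb := (h.toConformalForm hΩ).pb hΩ hz

omit hΩ hz in
theorem C_sign_sq : C z ε * C z ε = 1 := by rw [← map_mul, h.sign_sq, map_one]

omit h hΩ hz in
theorem cos_sq_add_sin_sq {β : ℝ → ℝ} (hβ : ContDiffAt ℝ ∞ β (z 0)) :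
    tm z _ hβ.cos * tm z _ hβ.cos + tm z _ hβ.sin * tm z _ hβ.sin = 1 := by
  rw [tm, tm, of_mul, of_mul, of_add, ← map_one (C z), C_apply, of_eq_of]
  exact Eventually.of_forall fun w => by
    simpa [sq] using Real.cos_sq_add_sin_sq (β (w 0))

theorem scale_eq : (h.toConformalForm hΩ).scale hΩ hz
    = tm z l (at_time hΩ hz h.smooth_scale) * tm z l (at_time hΩ hz h.smooth_scale) := by
  rw [ConformalForm.scale, (h.d_fst hΩ hz).1, (h.d_fst hΩ hz).2]
  linear_combination (tm z l (at_time hΩ hz h.smooth_scale)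
    * tm z l (at_time hΩ hz h.smooth_scale)) * cos_sq_add_sin_sq (at_time hΩ hz h.smooth_angle)

/-- The chain rule inverted by the transposed rotation. The factor `l` remains on the left so that
further derivatives involve no quotient. -/
theorem scale_mul_pb_d_one (b : SGerm (ConformalForm.map τ (fstForm l β γ₁) (sndForm ε l β γ₂) z)) :
    tm z l (at_time hΩ hz h.smooth_scale) * h.pb hΩ hz (d _ 1 b)
      = tm z _ (at_time hΩ hz h.smooth_angle).cos * d z 1 (h.pb hΩ hz b)
        - tm z _ (at_time hΩ hz h.smooth_angle).sin * d z 2 (h.pb hΩ hz b) := by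
  rw [ConformalForm.d_one_pb, ConformalForm.d_two_pb, (h.d_fst hΩ hz).1, (h.d_fst hΩ hz).2]
  linear_combination (-(tm z l (at_time hΩ hz h.smooth_scale)) * h.pb hΩ hz (d _ 1 b))
    * cos_sq_add_sin_sq (at_time hΩ hz h.smooth_angle)

theorem scale_mul_pb_d_two (b : SGerm (ConformalForm.map τ (fstForm l β γ₁) (sndForm ε l β γ₂) z)) :
    tm z l (at_time hΩ hz h.smooth_scale) * h.pb hΩ hz (d _ 2 b)
      = C z ε * (tm z _ (at_time hΩ hz h.smooth_angle).sin * d z 1 (h.pb hΩ hz b)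
        + tm z _ (at_time hΩ hz h.smooth_angle).cos * d z 2 (h.pb hΩ hz b)) := by
  rw [ConformalForm.d_one_pb, ConformalForm.d_two_pb, (h.d_fst hΩ hz).1, (h.d_fst hΩ hz).2]
  linear_combination (-(tm z l (at_time hΩ hz h.smooth_scale)) * h.pb hΩ hz (d _ 2 b)
    * (C z ε * C z ε)) * cos_sq_add_sin_sq (at_time hΩ hz h.smooth_angle)
    - (tm z l (at_time hΩ hz h.smooth_scale)) * h.pb hΩ hz (d _ 2 b) * h.C_sign_sq (z := z)

theorem lap_shift : lap (of _ (h.contDiffAt_shiftForm hΩ hz))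
    = 2 * C z ε * (tm z l (at_time hΩ hz h.smooth_scale) ^ 2
        * tm z _ (contDiffAt_inv_deriv (at_time hΩ hz h.smooth_time) (h.deriv_ne z hz)))
        * tm z _ (contDiffAt_deriv (at_time hΩ hz h.smooth_angle))
      + 2 * tm z σ (at_time hΩ hz h.smooth_vort) := by
  have hδ : lap (of δ (h.harm hΩ hz)) = 0 := by
    rw [lap, d_of, d_of, d_of, d_of, of_add, ← map_zero (C z), C_apply, of_eq_of]
    filter_upwards [hΩ.isOpen_base.mem_nhds hz] with w hw using h.harmonic w hw
  have key : of _ (h.contDiffAt_shiftForm hΩ hz) = of _ (contDiffAt_gaugeForm (ε := ε)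
      (at_time hΩ hz h.smooth_time) (h.deriv_ne z hz) (at_time hΩ hz h.smooth_scale)
      (at_time hΩ hz h.smooth_angle) (at_time hΩ hz h.smooth_fst) (at_time hΩ hz h.smooth_snd))
    + of δ (h.harm hΩ hz) + tm z σ (at_time hΩ hz h.smooth_vort) * C z 2⁻¹
      * (co z 1 * co z 1 + co z 2 * co z 2) := rfl
  rw [key, lap_add, lap_add, hδ, lap_gaugeForm (at_time hΩ hz h.smooth_time)
    (h.deriv_ne z hz) (at_time hΩ hz h.smooth_scale) (at_time hΩ hz h.smooth_angle)
    (at_time hΩ hz h.smooth_fst) (at_time hΩ hz h.smooth_snd)]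
  simp only [lap, d_mul, map_add, d_one_tm, d_two_tm, d_C, d_co_self, d_one_co_two,
    d_two_co_one, mul_zero, mul_one, add_zero, zero_add]
  linear_combination (2 * tm z σ (at_time hΩ hz h.smooth_vort)) * C_two_inv (z := z)

theorem contDiffAt_ratio : ContDiffAt ℝ ∞ (fun s => σ s / l s ^ 2) (z 0) :=
  (at_time hΩ hz h.smooth_vort).div ((at_time hΩ hz h.smooth_scale).pow 2)
    (pow_ne_zero 2 (h.scale_ne z hz))

theorem isUnit_l : IsUnit (tm z l (at_time hΩ hz h.smooth_scale)) :=
  isUnit_iff.2 (h.scale_ne z hz)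

/-- The new vorticity in terms of the old one. -/
theorem pb_lap {a : SGerm z}
    {a' : SGerm (ConformalForm.map τ (fstForm l β γ₁) (sndForm ε l β γ₂) z)}
    (ha : h.pb hΩ hz a' = tm z _ ((h.toConformalForm hΩ).coeff hΩ hz) * a
      + of _ (h.contDiffAt_shiftForm hΩ hz)) :
    h.pb hΩ hz (lap a')
      = C z ε * tm z _ (contDiffAt_inv_deriv (at_time hΩ hz h.smooth_time) (h.deriv_ne z hz))
          * lap a
        + 2 * C z ε
          * tm z _ (contDiffAt_inv_deriv (at_time hΩ hz h.smooth_time) (h.deriv_ne z hz))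
          * tm z _ (contDiffAt_deriv (at_time hΩ hz h.smooth_angle))
        + 2 * tm z _ (h.contDiffAt_ratio hΩ hz) := by
  have hL := h.isUnit_l hΩ hz
  -- Conformal covariance gives the claim multiplied by the scale `l ^ 2`, which is a unit.
  refine (hL.mul hL).mul_left_cancel ?_
  have hN : tm z l (at_time hΩ hz h.smooth_scale) ^ 2 * tm z _ (h.contDiffAt_ratio hΩ hz)
      = tm z σ (at_time hΩ hz h.smooth_vort) := by
    refine tm_congr ((at_time hΩ hz h.smooth_scale).pow 2 |>.mul (h.contDiffAt_ratio hΩ hz)) _ ?_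
    filter_upwards [hΩ.isOpen_times.mem_nhds (mem_times_of_mem_base hz)] with t ht
    exact mul_div_cancel₀ _ (pow_ne_zero 2 (h.scale_pos t ht).ne')
  rw [← h.scale_eq hΩ hz, ← ConformalForm.lap_pb, ha, lap_add, ConformalForm.lap_tm_mul,
    h.lap_shift hΩ hz, h.scale_eq hΩ hz]
  have hκ : tm z _ ((h.toConformalForm hΩ).coeff hΩ hz) = C z ε
    * (tm z l (at_time hΩ hz h.smooth_scale)
      * tm z _ (contDiffAt_inv_deriv (at_time hΩ hz h.smooth_time) (h.deriv_ne z hz)))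
    * tm z l (at_time hΩ hz h.smooth_scale) := rfl
  rw [hκ]
  linear_combination (-2) * hN

end NormalForm

/-! ### Transformation of the arguments and of the left hand side. -/

open SGerm

/-- The fibre part of the transformation of the arguments of the arbitrary element. -/
def argFib (ε r l c s k : ℝ) (w : Fin 6 → ℝ) : Fin 6 → ℝ :=
  ![ε * r * w 0 + k, ε * r * l⁻¹ * (c * w 1 - s * w 2), r * l⁻¹ * (s * w 1 + c * w 2),
    ε * r * (l⁻¹ * l⁻¹) * (c * c * w 3 - 2 * c * s * w 4 + s * s * w 5),
    r * (l⁻¹ * l⁻¹) * (c * s * w 3 + (c * c - s * s) * w 4 - c * s * w 5),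
    ε * r * (l⁻¹ * l⁻¹) * (s * s * w 3 + 2 * c * s * w 4 + c * c * w 5)]

/-- The auxiliary `p, q` are the old spatial derivatives of the pulled back `∂ζ'/∂x'`, and `p', q'`
those of `∂ζ'/∂y'`; a new second derivative takes two inverse rotations. -/
theorem eq_argFib {ε r l c s k : ℝ} (hε : ε * ε = 1) (hl : l ≠ 0)
    {w : Fin 6 → ℝ} {v₀ v₁ v₂ v₃ v₄ v₅ p q p' q' : ℝ} (h₀ : v₀ = ε * r * w 0 + k)
    (h₁ : l * v₁ = c * (ε * r * w 1) - s * (ε * r * w 2))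
    (h₂ : l * v₂ = ε * (s * (ε * r * w 1) + c * (ε * r * w 2)))
    (h₃ : l * v₃ = c * p - s * q) (h₄ : l * v₄ = c * p' - s * q')
    (h₅ : l * v₅ = ε * (s * p' + c * q'))
    (hp : l * p = c * (ε * r * w 3) - s * (ε * r * w 4))
    (hq : l * q = c * (ε * r * w 4) - s * (ε * r * w 5))
    (hp' : l * p' = ε * (s * (ε * r * w 3) + c * (ε * r * w 4)))
    (hq' : l * q' = ε * (s * (ε * r * w 4) + c * (ε * r * w 5))) :
    ![v₀, v₁, v₂, v₃, v₄, v₅] = argFib ε r l c s k w := by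
  obtain ⟨m, hm⟩ : ∃ m, m = l⁻¹ := ⟨_, rfl⟩
  have hml : m * l = 1 := by rw [hm, inv_mul_cancel₀ hl]
  have key : ∀ {a b : ℝ}, l * a = b → a = m * b := fun {a b} h => by
    linear_combination m * h - a * hml
  obtain rfl := key hp
  obtain rfl := key hq
  obtain rfl := key hp'
  obtain rfl := key hq'
  rw [argFib, ← hm, h₀, key h₁, key h₂, key h₃, key h₄, key h₅]
  funext i
  fin_cases i
  · simp
  · simp
    ring
  · simp
    linear_combination m * r * (s * w 1 + c * w 2) * hε
  · simp
    ring
  · simp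
    linear_combination m * m * r * (c * s * w 3 + c * c * w 4 - s * s * w 4 - s * c * w 5) * hε
  · simp
    linear_combination m * m * ε * r * (s * s * w 3 + 2 * c * s * w 4 + c * c * w 5) * hε

/-- The transformation of the arguments of the arbitrary element. -/
def argMap (ε : ℝ) (τ l β γ₁ γ₂ σ : ℝ → ℝ) (q : Arg) : Arg :=
  (ConformalForm.map τ (fstForm l β γ₁) (sndForm ε l β γ₂) q.1,
    argFib ε (deriv τ (q.1 0))⁻¹ (l (q.1 0)) (Real.cos (β (q.1 0))) (Real.sin (β (q.1 0)))
      (2 * ε * (deriv τ (q.1 0))⁻¹ * deriv β (q.1 0) + 2 * (σ (q.1 0) / l (q.1 0) ^ 2)) q.2)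

namespace NormalForm

variable {Ω : Set Total} {φ : Total → Total} {ε : ℝ} {τ l β γ₁ γ₂ σ : ℝ → ℝ} {δ : Base → ℝ}
  {z : Base} (h : NormalForm Ω φ ε τ l β γ₁ γ₂ σ δ) (hΩ : LocalDomain Ω) (hz : z ∈ base Ω)

include h

theorem args_eq {a : SGerm z}
    {a' : SGerm (ConformalForm.map τ (fstForm l β γ₁) (sndForm ε l β γ₂) z)}
    (ha : h.pb hΩ hz a' = tm z _ ((h.toConformalForm hΩ).coeff hΩ hz) * a
      + of _ (h.contDiffAt_shiftForm hΩ hz)) :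
    args a' = argMap ε τ l β γ₁ γ₂ σ (args a) := by
  have hZ := h.pb_lap hΩ hz ha
  have h1 := h.scale_mul_pb_d_one hΩ hz (lap a')
  have h2 := h.scale_mul_pb_d_two hΩ hz (lap a')
  have h11 := h.scale_mul_pb_d_one hΩ hz (d _ 1 (lap a'))
  have h12 := h.scale_mul_pb_d_one hΩ hz (d _ 2 (lap a'))
  have h22 := h.scale_mul_pb_d_two hΩ hz (d _ 2 (lap a'))
  rw [hZ] at h1 h2
  have d1 : ∀ b : SGerm z, d z 1 (tm z l (at_time hΩ hz h.smooth_scale) * b)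
      = tm z l (at_time hΩ hz h.smooth_scale) * d z 1 b := fun b => by
    rw [d_mul, d_one_tm, mul_zero, add_zero]
  have d2 : ∀ b : SGerm z, d z 2 (tm z l (at_time hΩ hz h.smooth_scale) * b)
      = tm z l (at_time hΩ hz h.smooth_scale) * d z 2 b := fun b => by
    rw [d_mul, d_two_tm, mul_zero, add_zero]
  have e11 := congrArg (fun b => ev z (d z 1 b)) h1
  have e12 := congrArg (fun b => ev z (d z 2 b)) h1
  have e21 := congrArg (fun b => ev z (d z 1 b)) h2
  have e22 := congrArg (fun b => ev z (d z 2 b)) h2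
  replace h1 := congrArg (ev z) h1
  replace h2 := congrArg (ev z) h2
  replace h11 := congrArg (ev z) h11
  replace h12 := congrArg (ev z) h12
  replace h22 := congrArg (ev z) h22
  replace hZ := congrArg (ev z) hZ
  have h20 : ∀ i, d z i (2 : SGerm z) = 0 := fun i => by
    rw [← map_ofNat (C z) 2, d_C]
  simp only [d1, d2] at e11 e12 e21 e22
  simp only [map_mul, map_add, map_sub, ConformalForm.ev_pb, ev_tm, ev_C, d_mul, d_one_tm,
    d_two_tm, d_C, h20, map_ofNat, mul_zero, add_zero] at hZ h1 h2 h11 h12 h22 e11 e12 e21 e22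
  rw [d_comm 2 1 (lap a)] at e12 e22
  rw [add_assoc] at hZ
  exact Prod.ext rfl (eq_argFib (w := (args a).2) h.sign_sq (h.scale_ne z hz) hZ h1 h2 h11 h12 h22
    e11 e12 e21 e22)

end NormalForm

open SGerm

/-- The algebraic core of `NormalForm.lhs_eq`. `P₀, P₁, P₂` stand for the new derivatives of `ζ'`,
and `Q₁, Q₂` for those of `ψ'`. The chain rule in time gives `h₀`, the rotated gradients are `h₁`
and `h₂`, and `hb` is the transformed bracket. -/
theorem elem_identity {ε T U L Lt c s B Bt N σ G₁ G₂ x y δx δy κ zt z₀ zx zy ax ay P₀ P₁ P₂ Q₁ Q₂ dr : ℝ}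
    (hε : ε * ε = 1) (hT : T ≠ 0) (hL : L ≠ 0) (hcs : s ^ 2 + c ^ 2 = 1)
    (hκ : κ = ε * (L * T⁻¹) * L) (hdr : T * dr = -(U * T⁻¹))
    (h₀ : ε * T⁻¹ * zt + z₀ * (ε * dr) + (2 * ε * T⁻¹ * Bt + B * (2 * ε * dr)) + 2 * N
      = T * P₀ + (Lt * (x * c - y * s) - L * (x * s + y * c) * B + G₁) * P₁
        + ε * (Lt * (x * s + y * c) + L * (x * c - y * s) * B + G₂) * P₂)
    (h₁ : L * P₁ = c * (ε * T⁻¹ * zx) - s * (ε * T⁻¹ * zy))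
    (h₂ : L * P₂ = ε * (s * (ε * T⁻¹ * zx) + c * (ε * T⁻¹ * zy)))
    (hb : (κ * ax + (ε * (L * T⁻¹) * (L * B * x - G₁ * s + G₂ * c) + δx + σ * x)) * (ε * T⁻¹ * zy)
      - (κ * ay + (ε * (L * T⁻¹) * (L * B * y - G₁ * c - G₂ * s) + δy + σ * y)) * (ε * T⁻¹ * zx)
      = ε * (L * L) * (Q₁ * P₂ - Q₂ * P₁)) :
    P₀ + Q₁ * P₂ - Q₂ * P₁ = ε / T ^ 2 * (zt + ax * zy - ay * zx - U / T * z₀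
      - Lt / L * (x * zx + y * zy) + 2 * Bt - 2 * (U / T) * B)
      - (δy + σ * y) / (T * L ^ 2) * zx + (δx + σ * x) / (T * L ^ 2) * zy + 2 / T * N := by
  obtain ⟨r, hr⟩ : ∃ r, r = T⁻¹ := ⟨_, rfl⟩
  obtain ⟨m, hm⟩ : ∃ m, m = L⁻¹ := ⟨_, rfl⟩
  have hrT : r * T = 1 := by rw [hr, inv_mul_cancel₀ hT]
  have hmL : m * L = 1 := by rw [hm, inv_mul_cancel₀ hL]
  simp only [div_eq_mul_inv, mul_inv, ← inv_pow, ← hr, ← hm] at *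
  have e₁ : P₁ = m * (c * (ε * r * zx) - s * (ε * r * zy)) := by
    linear_combination m * h₁ - P₁ * hmL
  have e₂ : P₂ = m * (s * r * zx + c * r * zy) := by
    linear_combination m * h₂ - P₂ * hmL + m * r * (s * zx + c * zy) * hε
  have e₃ : dr = -(U * r) * r := by linear_combination r * hdr - dr * hrT
  have S₁ : P₀ = r * (ε * r * zt - ε * r * r * U * z₀ + 2 * ε * r * Bt - 2 * ε * r * r * U * B
      + 2 * N) - ε * r ^ 2 * (m * (Lt * (x * zx + y * zy) + (G₁ * c + G₂ * s) * zx
      + (G₂ * c - G₁ * s) * zy) + B * (x * zy - y * zx)) := by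
    rw [e₁, e₂, e₃] at h₀
    linear_combination (-r) * h₀ - P₀ * hrT
      - ε * r ^ 2 * m * (Lt * (x * zx + y * zy) + L * B * (x * zy - y * zx)) * hcs
      - ε * r ^ 2 * B * (x * zy - y * zx) * hmL
  have S₂ : Q₁ * P₂ - Q₂ * P₁ = ε * r ^ 2 * (ax * zy - ay * zx)
      + ε * r ^ 2 * ((B * x + m * (G₂ * c - G₁ * s)) * zy
        - (B * y - m * (G₁ * c + G₂ * s)) * zx)
      + m ^ 2 * r * ((δx + σ * x) * zy - (δy + σ * y) * zx) := by
    rw [hκ] at hb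
    linear_combination (-ε * m ^ 2) * hb - (Q₁ * P₂ - Q₂ * P₁) * (m * m * L * L) * hε
      - (Q₁ * P₂ - Q₂ * P₁) * (m * L + 1) * hmL
      + m ^ 2 * r * ((ε * (L * r) * L * ax + (ε * (L * r) * (L * B * x - G₁ * s + G₂ * c)
          + δx + σ * x)) * zy - (ε * (L * r) * L * ay
          + (ε * (L * r) * (L * B * y - G₁ * c - G₂ * s) + δy + σ * y)) * zx) * hε
      + ε * r ^ 2 * (ax * zy - ay * zx) * (m * L + 1) * hmL
      + ε * r ^ 2 * (((m * L + 1) * B * x + m * (G₂ * c - G₁ * s)) * zy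
        - ((m * L + 1) * B * y - m * (G₁ * c + G₂ * s)) * zx) * hmL
  linear_combination S₁ + S₂

theorem SGerm.ev_d_zero_tm {z : Base} {g : ℝ → ℝ} (hg : ContDiffAt ℝ ∞ g (z 0)) :
    ev z (d z 0 (tm z g hg)) = deriv g (z 0) := by
  rw [d_zero_tm, ev_tm]

namespace NormalForm

variable {Ω : Set Total} {φ : Total → Total} {ε : ℝ} {τ l β γ₁ γ₂ σ : ℝ → ℝ} {δ : Base → ℝ}
  {z : Base} (h : NormalForm Ω φ ε τ l β γ₁ γ₂ σ δ) (hΩ : LocalDomain Ω) (hz : z ∈ base Ω)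

include h hΩ hz

theorem ev_d_zero_fst : ev z (d z 0 (of _ ((h.toConformalForm hΩ).fst hΩ hz)))
    = deriv l (z 0) * (z 1 * Real.cos (β (z 0)) - z 2 * Real.sin (β (z 0)))
      - l (z 0) * (z 1 * Real.sin (β (z 0)) + z 2 * Real.cos (β (z 0))) * deriv β (z 0)
      + deriv γ₁ (z 0) := by
  have h₁ := congrArg (fun b => ev z (d z 0 b)) (of_fstForm (at_time hΩ hz h.smooth_scale)
    (at_time hΩ hz h.smooth_angle) (at_time hΩ hz h.smooth_fst))
  simp only [d_mul, map_add, map_sub, map_mul, d_zero_co_one,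
    d_zero_co_two, ev_co, ev_tm, map_zero] at h₁
  have hβ := ((at_time hΩ hz h.smooth_angle).differentiableAt (by simp)).hasDerivAt
  refine h₁.trans ?_
  rw [ev_d_zero_tm (at_time hΩ hz h.smooth_scale), ev_d_zero_tm (at_time hΩ hz h.smooth_fst),
    ev_d_zero_tm (at_time hΩ hz h.smooth_angle).cos,
    ev_d_zero_tm (at_time hΩ hz h.smooth_angle).sin, hβ.cos.deriv, hβ.sin.deriv]
  ring

theorem ev_d_zero_snd : ev z (d z 0 (of _ ((h.toConformalForm hΩ).snd hΩ hz)))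
    = ε * (deriv l (z 0) * (z 1 * Real.sin (β (z 0)) + z 2 * Real.cos (β (z 0)))
      + l (z 0) * (z 1 * Real.cos (β (z 0)) - z 2 * Real.sin (β (z 0))) * deriv β (z 0)
      + deriv γ₂ (z 0)) := by
  have h₁ := congrArg (fun b => ev z (d z 0 b)) (of_sndForm (ε := ε)
    (at_time hΩ hz h.smooth_scale) (at_time hΩ hz h.smooth_angle) (at_time hΩ hz h.smooth_snd))
  simp only [d_mul, map_add, map_mul, d_zero_co_one,
    d_zero_co_two, ev_co, ev_tm, map_zero, d_C, ev_C] at h₁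
  have hβ := ((at_time hΩ hz h.smooth_angle).differentiableAt (by simp)).hasDerivAt
  refine h₁.trans ?_
  rw [ev_d_zero_tm (at_time hΩ hz h.smooth_scale), ev_d_zero_tm (at_time hΩ hz h.smooth_snd),
    ev_d_zero_tm (at_time hΩ hz h.smooth_angle).cos,
    ev_d_zero_tm (at_time hΩ hz h.smooth_angle).sin, hβ.cos.deriv, hβ.sin.deriv]
  ring

theorem ev_d_shift :
    ev z (d z 1 (of _ (h.contDiffAt_shiftForm hΩ hz)))
      = ε * (l (z 0) * (deriv τ (z 0))⁻¹) * (l (z 0) * deriv β (z 0) * z 1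
        - deriv γ₁ (z 0) * Real.sin (β (z 0)) + deriv γ₂ (z 0) * Real.cos (β (z 0)))
        + pd 1 δ z + σ (z 0) * z 1 ∧
    ev z (d z 2 (of _ (h.contDiffAt_shiftForm hΩ hz)))
      = ε * (l (z 0) * (deriv τ (z 0))⁻¹) * (l (z 0) * deriv β (z 0) * z 2
        - deriv γ₁ (z 0) * Real.cos (β (z 0)) - deriv γ₂ (z 0) * Real.sin (β (z 0)))
        + pd 2 δ z + σ (z 0) * z 2 := by
  have key : of _ (h.contDiffAt_shiftForm hΩ hz) = of _ (contDiffAt_gaugeForm (ε := ε)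
      (at_time hΩ hz h.smooth_time) (h.deriv_ne z hz) (at_time hΩ hz h.smooth_scale)
      (at_time hΩ hz h.smooth_angle) (at_time hΩ hz h.smooth_fst) (at_time hΩ hz h.smooth_snd))
    + of δ (h.harm hΩ hz) + tm z σ (at_time hΩ hz h.smooth_vort) * C z 2⁻¹
      * (co z 1 * co z 1 + co z 2 * co z 2) := rfl
  rw [key, of_gaugeForm (at_time hΩ hz h.smooth_time)
    (h.deriv_ne z hz) (at_time hΩ hz h.smooth_scale) (at_time hΩ hz h.smooth_angle)
    (at_time hΩ hz h.smooth_fst) (at_time hΩ hz h.smooth_snd)]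
  simp only [d_mul, map_add, map_sub, map_mul, d_one_tm, d_two_tm, d_C, d_co_self, d_one_co_two,
    d_two_co_one, mul_zero, mul_one, add_zero, zero_add, sub_zero, d_of, ev_of, ev_tm, ev_co, ev_C]
  constructor <;> ring_nf
  simp only [map_zero]
  ring

/-- The left hand side of the equation transforms like the arbitrary element. -/
theorem lhs_eq {a : SGerm z}
    {a' : SGerm (ConformalForm.map τ (fstForm l β γ₁) (sndForm ε l β γ₂) z)}
    (ha : h.pb hΩ hz a' = tm z _ ((h.toConformalForm hΩ).coeff hΩ hz) * a
      + of _ (h.contDiffAt_shiftForm hΩ hz)) :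
    lhs a' = elemForm ε τ l β σ δ z
      ![ev z (lap a), ev z (d z 1 (lap a)), ev z (d z 2 (lap a))] (lhs a) := by
  have hZ := h.pb_lap hΩ hz ha
  have h1 := h.scale_mul_pb_d_one hΩ hz (lap a')
  have h2 := h.scale_mul_pb_d_two hΩ hz (lap a')
  have h0 := congrArg (ev z) ((h.toConformalForm hΩ).d_pb hΩ hz 0 (lap a'))
  have hb := congrArg (ev z) ((h.toConformalForm hΩ).bracket_pb hΩ hz a' (lap a'))
  rw [ha, h.scale_eq hΩ hz] at hb
  rw [hZ] at h1 h2 h0 hb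
  replace h1 := congrArg (ev z) h1
  replace h2 := congrArg (ev z) h2
  have h20 : ∀ i, d z i (2 : SGerm z) = 0 := fun i => by
    rw [← map_ofNat (C z) 2, d_C]
  have hr : deriv τ (z 0) * ev z (d z 0 (tm z _ (contDiffAt_inv_deriv
      (at_time hΩ hz h.smooth_time) (h.deriv_ne z hz))))
      = -(deriv (deriv τ) (z 0) * (deriv τ (z 0))⁻¹) := by
    have e₁ : tm z _ (contDiffAt_inv_deriv (at_time hΩ hz h.smooth_time) (h.deriv_ne z hz))
        * tm z _ (contDiffAt_deriv (at_time hΩ hz h.smooth_time)) = 1 := by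
      rw [tm, tm, of_mul, ← map_one (C z), C_apply, of_eq_of]
      filter_upwards [hΩ.isOpen_base.mem_nhds hz] with w hw
      exact inv_mul_cancel₀ (h.deriv_ne w hw)
    have e₂ := congrArg (fun b => ev z (d z 0 b)) e₁
    simp only [d_mul, map_add, map_mul, ev_tm, Derivation.map_one_eq_zero, map_zero] at e₂
    rw [d_zero_tm (contDiffAt_deriv (at_time hΩ hz h.smooth_time)), ev_tm] at e₂
    linear_combination e₂
  obtain ⟨hs1, hs2⟩ := h.ev_d_shift hΩ hz
  have hx := h.ev_d_zero_fst hΩ hz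
  have hy := h.ev_d_zero_snd hΩ hz
  simp only [map_mul, map_add, map_sub, ConformalForm.ev_pb, ev_C, d_mul, d_one_tm,
    d_two_tm, d_C, h20, map_ofNat, mul_zero, add_zero, hs1, hs2, hx, hy] at h0 hb h1 h2
  rw [ev_d_zero_tm (at_time hΩ hz h.smooth_time), ev_d_zero_tm (h.contDiffAt_ratio hΩ hz),
    ev_d_zero_tm (contDiffAt_deriv (at_time hΩ hz h.smooth_angle))] at h0
  simp only [ev_tm] at h0 hb h1 h2
  have := elem_identity h.sign_sq (h.deriv_ne z hz) (h.scale_ne z hz)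
    (Real.sin_sq_add_cos_sq (β (z 0))) rfl hr h0 h1 h2 hb
  exact this

end NormalForm

/-! ### Lifting of angles and reduction to the explicit family. -/

open SGerm

/-- Smooth functions on an interval have smooth primitives. -/
theorem exists_primitive {I : Set ℝ} (hI : IsOpen I) (hI' : IsPreconnected I) {g : ℝ → ℝ}
    (hg : ContDiffOn ℝ ∞ g I) : ∃ G : ℝ → ℝ, ContDiffOn ℝ ∞ G I ∧ ∀ t ∈ I, HasDerivAt G (g t) t := by
  rcases I.eq_empty_or_nonempty with rfl | ⟨t₀, ht₀⟩
  · exact ⟨g, by simp [ContDiffOn], by simp⟩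
  have hd : ∀ t ∈ I, HasDerivAt (fun t => ∫ s in t₀..t, g s) (g t) t := by
    intro t ht
    have hsub : uIcc t₀ t ⊆ I := hI'.ordConnected.uIcc_subset ht₀ ht
    refine intervalIntegral.integral_hasDerivAt_right
      ((hg.continuousOn.mono hsub).intervalIntegrable) ?_
      (hg.continuousOn.continuousAt (hI.mem_nhds ht))
    exact hg.continuousOn.stronglyMeasurableAtFilter hI t ht
  refine ⟨_, ?_, hd⟩
  rw [contDiffOn_infty_iff_deriv_of_isOpen hI]
  exact ⟨fun t ht => (hd t ht).differentiableAt.differentiableWithinAt,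
    hg.congr fun t ht => (hd t ht).deriv⟩

/-- Smooth curves in the circle lift to the line. -/
theorem exists_angle {I : Set ℝ} (hI : IsOpen I) (hI' : IsPreconnected I) {c s : ℝ → ℝ}
    (hc : ContDiffOn ℝ ∞ c I) (hs : ContDiffOn ℝ ∞ s I) (h1 : ∀ t ∈ I, c t ^ 2 + s t ^ 2 = 1) :
    ∃ β : ℝ → ℝ, ContDiffOn ℝ ∞ β I ∧ ∀ t ∈ I, c t = Real.cos (β t) ∧ s t = Real.sin (β t) := by
  rcases I.eq_empty_or_nonempty with rfl | ⟨t₀, ht₀⟩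
  · exact ⟨c, by simp [ContDiffOn], by simp⟩
  have hcd : ∀ t ∈ I, HasDerivAt c (deriv c t) t := fun t ht =>
    ((hc.contDiffAt (hI.mem_nhds ht)).differentiableAt (by simp)).hasDerivAt
  have hsd : ∀ t ∈ I, HasDerivAt s (deriv s t) t := fun t ht =>
    ((hs.contDiffAt (hI.mem_nhds ht)).differentiableAt (by simp)).hasDerivAt
  -- On the unit circle the angular velocity is `c s' - s c'`.
  obtain ⟨G, hG, hG'⟩ := exists_primitive hI hI' (g := fun t => c t * deriv s t - s t * deriv c t)
    (fun t ht => by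
      have h₁ := hc.contDiffAt (hI.mem_nhds ht)
      have h₂ := hs.contDiffAt (hI.mem_nhds ht)
      exact ((h₁.mul (contDiffAt_deriv h₂)).sub (h₂.mul (contDiffAt_deriv h₁))).contDiffWithinAt)
  have horth : ∀ t ∈ I, c t * deriv c t + s t * deriv s t = 0 := by
    intro t ht
    have h₂ := ((hcd t ht).pow 2).add ((hsd t ht).pow 2)
    have h₃ : (fun t => c t ^ 2 + s t ^ 2) =ᶠ[𝓝 t] fun _ => 1 := by
      filter_upwards [hI.mem_nhds ht] with u hu using h1 u hu
    have h₄ := h₂.unique ((hasDerivAt_const t (1 : ℝ)).congr_of_eventuallyEq h₃)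
    simp at h₄
    linarith
  obtain ⟨b, hb, hb'⟩ : ∃ b : ℝ, c t₀ = Real.cos b ∧ s t₀ = Real.sin b := by
    have hne : (⟨c t₀, s t₀⟩ : ℂ) ≠ 0 := fun h => by
      have h₁ := congrArg Complex.re h
      have h₂ := congrArg Complex.im h
      have h₃ := h1 t₀ ht₀
      simp at h₁ h₂
      simp [h₁, h₂] at h₃
    have hn : ‖(⟨c t₀, s t₀⟩ : ℂ)‖ = 1 := by
      rw [Complex.norm_def, Complex.normSq_mk, Real.sqrt_eq_one]
      linear_combination h1 t₀ ht₀
    refine ⟨Complex.arg ⟨c t₀, s t₀⟩, ?_, ?_⟩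
    · rw [Complex.cos_arg hne, hn, div_one]
    · rw [Complex.sin_arg, hn, div_one]
  set β : ℝ → ℝ := fun t => b + (G t - G t₀) with hβ
  have hβd : ∀ t ∈ I, HasDerivAt β (c t * deriv s t - s t * deriv c t) t := fun t ht =>
    ((hG' t ht).sub_const _).const_add _
  have hβ₀ : β t₀ = b := by simp [hβ]
  have key : ∀ F : ℝ → ℝ, (∀ t ∈ I, HasDerivAt F 0 t) → ∀ t ∈ I, F t = F t₀ := by
    intro F hF t ht
    exact hI.is_const_of_deriv_eq_zero hI' (fun t ht => (hF t ht).differentiableAt.differentiableWithinAt)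
      (fun t ht => (hF t ht).deriv) ht ht₀
  -- These are the cosine and the sine of the angle between the curve and its candidate lift; both
  -- are constant and have the values `1` and `0` at `t₀`.
  have hu := key (fun t => c t * Real.cos (β t) + s t * Real.sin (β t)) fun t ht => by
    have h₁ := ((hcd t ht).mul (hβd t ht).cos).add ((hsd t ht).mul (hβd t ht).sin)
    refine h₁.congr_deriv ?_
    linear_combination (c t * Real.cos (β t) + s t * Real.sin (β t)) * horth t ht
      - (deriv c t * Real.cos (β t) + deriv s t * Real.sin (β t)) * h1 t ht
  have hv := key (fun t => s t * Real.cos (β t) - c t * Real.sin (β t)) fun t ht => by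
    have h₁ := ((hsd t ht).mul (hβd t ht).cos).sub ((hcd t ht).mul (hβd t ht).sin)
    refine h₁.congr_deriv ?_
    linear_combination (s t * Real.cos (β t) - c t * Real.sin (β t)) * horth t ht
      - (deriv s t * Real.cos (β t) - deriv c t * Real.sin (β t)) * h1 t ht
  refine ⟨β, fun t ht => contDiffWithinAt_const.add ((hG t ht).sub contDiffWithinAt_const),
    fun t ht => ?_⟩
  have h₁ := hu t ht
  have h₂ := hv t ht
  simp only [hβ₀, hb, hb'] at h₁ h₂
  have h₃ := Real.sin_sq_add_cos_sq b
  have h₄ := Real.sin_sq_add_cos_sq (β t)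
  constructor
  · linear_combination Real.cos (β t) * h₁ - Real.sin (β t) * h₂ + Real.cos (β t) * h₃ - c t * h₄
  · linear_combination Real.sin (β t) * h₁ + Real.cos (β t) * h₂ + Real.sin (β t) * h₃ - s t * h₄

open SGerm

theorem contDiffOn_pd {Ω : Set Total} (hΩ : LocalDomain Ω) {F : Base → ℝ}
    (hF : ContDiffOn ℝ ∞ F (base Ω)) (i : Fin 3) : ContDiffOn ℝ ∞ (pd i F) (base Ω) :=
  fun _ hz => (contDiffAt_pd (hF.contDiffAt (hΩ.isOpen_base.mem_nhds hz)) i).contDiffWithinAt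

/-- A function whose gradient at fixed time depends only on time is affine at fixed time. -/
theorem LocalDomain.exists_eq_affine {Ω : Set Total} (hΩ : LocalDomain Ω) {F : Base → ℝ}
    (hF : ContDiffOn ℝ ∞ F (base Ω)) {A B : ℝ → ℝ} (hA : ContDiffOn ℝ ∞ A (times Ω))
    (hB : ContDiffOn ℝ ∞ B (times Ω)) (h₁ : ∀ z ∈ base Ω, pd 1 F z = A (z 0))
    (h₂ : ∀ z ∈ base Ω, pd 2 F z = B (z 0)) :
    ∃ g : ℝ → ℝ, ContDiffOn ℝ ∞ g (times Ω) ∧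
      ∀ z ∈ base Ω, F z = A (z 0) * z 1 + B (z 0) * z 2 + g (z 0) := by
  have hAt : ∀ z ∈ base Ω, ContDiffAt ℝ ∞ A (z 0) := fun z hz =>
    hA.contDiffAt (hΩ.isOpen_times.mem_nhds (mem_times_of_mem_base hz))
  have hBt : ∀ z ∈ base Ω, ContDiffAt ℝ ∞ B (z 0) := fun z hz =>
    hB.contDiffAt (hΩ.isOpen_times.mem_nhds (mem_times_of_mem_base hz))
  have hFt : ∀ z ∈ base Ω, ContDiffAt ℝ ∞ F z := fun z hz =>
    hF.contDiffAt (hΩ.isOpen_base.mem_nhds hz)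
  have hsm : ∀ z ∈ base Ω, ContDiffAt ℝ ∞
      (fun z : Base => F z - (A (z 0) * z 1 + B (z 0) * z 2)) z := fun z hz =>
    (hFt z hz).sub (((contDiffAt_time (hAt z hz)).mul (by fun_prop)).add
      ((contDiffAt_time (hBt z hz)).mul (by fun_prop)))
  have hpd : ∀ z ∈ base Ω, ∀ i : Fin 3, i ≠ 0 →
      pd i (fun z : Base => F z - (A (z 0) * z 1 + B (z 0) * z 2)) z
        = pd i F z - (A (z 0) * (if i = 1 then 1 else 0) + B (z 0) * (if i = 2 then 1 else 0)) := by
    intro z hz i hi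
    have e : of _ (hsm z hz) = of F (hFt z hz)
      - (tm z A (hAt z hz) * co z 1 + tm z B (hBt z hz) * co z 2) := rfl
    have := congrArg (fun b => ev z (d z i b)) e
    simp only [map_sub, map_add, d_mul, d_tm_of_ne _ hi, d_co, d_of, ev_of, map_mul, ev_tm,
      mul_zero, add_zero] at this
    rw [this]
    split_ifs <;> simp
  obtain ⟨g, hg, hg'⟩ := hΩ.exists_eq_time_of_base
    (fun z hz => (hsm z hz).contDiffWithinAt)
    (fun z hz => by rw [hpd z hz 1 (by decide), h₁ z hz]; simp)
    (fun z hz => by rw [hpd z hz 2 (by decide), h₂ z hz]; simp)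
  exact ⟨g, hg, fun z hz => by rw [← hg' z hz]; ring⟩

namespace ConformalForm

variable {Ω : Set Total} {f f' : ArbElem} {φ : Total → Total} {ε : ℝ} {τ : ℝ → ℝ}
  {X Y : Base → ℝ} {κ : ℝ → ℝ} {χ : Base → ℝ} {z : Base}

/-- Stationarity of `|∇X|²` together with `ΔX = 0` is a linear system for the two independent second
derivatives of `X`, with determinant `|∇X|²` up to sign. -/
theorem hessian_fst (h : ConformalForm Ω φ ε τ X Y κ χ) (hΩ : LocalDomain Ω) (hz : z ∈ base Ω)
    (had : IsAdmissible Ω f f' φ) : (pd 1 (pd 1 X) z = 0 ∧ pd 2 (pd 1 X) z = 0) ∧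
      (pd 1 (pd 2 X) z = 0 ∧ pd 2 (pd 2 X) z = 0) := by
  obtain ⟨s1, s2, -⟩ := h.conditions hΩ hz had
  have hl := congrArg (ev z) (h.lap_fst hΩ hz)
  have hc := congrArg (ev z) (d_comm 1 2 (of X (h.fst hΩ hz)))
  have hp := h.scale_pos z hz
  simp only [scale, sq, map_add, d_mul, map_mul, d_of, ev_of, lap, map_zero] at s1 s2 hl hc
  have k1 : pd 1 (pd 1 X) z = 0 := by
    refine (mul_eq_zero.1 (?_ : (pd 1 X z ^ 2 + pd 2 X z ^ 2) * _ = 0)).resolve_left hp.ne'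
    linear_combination pd 1 X z * s1 / 2 - pd 2 X z * s2 / 2 + pd 2 X z ^ 2 * hl
      - pd 1 X z * pd 2 X z * hc
  have k2 : pd 1 (pd 2 X) z = 0 := by
    refine (mul_eq_zero.1 (?_ : (pd 1 X z ^ 2 + pd 2 X z ^ 2) * _ = 0)).resolve_left hp.ne'
    linear_combination pd 2 X z * s1 / 2 + pd 1 X z * s2 / 2 - pd 1 X z * pd 2 X z * hl
      + pd 1 X z ^ 2 * hc
  exact ⟨⟨k1, hc ▸ k2⟩, k2, by linarith⟩

/-- An admissible transformation of conformal form is one of those of the theorem. -/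
theorem exists_normalForm (h : ConformalForm Ω φ ε τ X Y κ χ) (hΩ : LocalDomain Ω)
    (had : IsAdmissible Ω f f' φ) :
    ∃ (l β γ₁ γ₂ σ : ℝ → ℝ) (δ : Base → ℝ), NormalForm Ω φ ε τ l β γ₁ γ₂ σ δ := by
  have hε := h.sign_sq
  obtain ⟨A, hA, hXA⟩ := hΩ.exists_eq_time_of_base (contDiffOn_pd hΩ h.smooth_fst 1)
    (fun z hz => (h.hessian_fst hΩ hz had).1.1) (fun z hz => (h.hessian_fst hΩ hz had).1.2)
  obtain ⟨B, hB, hXB⟩ := hΩ.exists_eq_time_of_base (contDiffOn_pd hΩ h.smooth_fst 2)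
    (fun z hz => (h.hessian_fst hΩ hz had).2.1) (fun z hz => (h.hessian_fst hΩ hz had).2.2)
  obtain ⟨γ₁, hγ₁, hX⟩ := hΩ.exists_eq_affine h.smooth_fst hA hB hXA hXB
  obtain ⟨γ₂', hγ₂', hY⟩ := hΩ.exists_eq_affine h.smooth_snd (A := fun t => -ε * B t)
    (B := fun t => ε * A t) (contDiffOn_const.mul hB) (contDiffOn_const.mul hA)
    (fun z hz => by rw [h.pd_one_snd z hz, hXB z hz])
    (fun z hz => by rw [h.pd_two_snd z hz, hXA z hz])
  have hpos : ∀ t ∈ times Ω, 0 < A t ^ 2 + B t ^ 2 := by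
    rintro _ ⟨p, hp, rfl⟩
    have := h.scale_pos _ (mem_base hp)
    rwa [hXA _ (mem_base hp), hXB _ (mem_base hp)] at this
  obtain ⟨l, hl⟩ : ∃ l : ℝ → ℝ, l = fun t => √(A t ^ 2 + B t ^ 2) := ⟨_, rfl⟩
  have hl0 : ∀ t ∈ times Ω, 0 < l t := fun t ht => hl ▸ Real.sqrt_pos.2 (hpos t ht)
  have hl2 : ∀ t ∈ times Ω, l t ^ 2 = A t ^ 2 + B t ^ 2 := fun t ht => by
    rw [hl]
    exact Real.sq_sqrt (hpos t ht).le
  have hls : ContDiffOn ℝ ∞ l (times Ω) := by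
    rw [hl]
    exact ((hA.pow 2).add (hB.pow 2)).sqrt fun t ht => (hpos t ht).ne'
  -- The sign of the sine matches `X = l (x cos β - y sin β) + γ₁`.
  obtain ⟨β, hβ, hβ'⟩ := exists_angle hΩ.isOpen_times hΩ.isPreconnected_times
    (c := fun t => A t / l t) (s := fun t => -B t / l t)
    (hA.div hls fun t ht => (hl0 t ht).ne') (hB.neg.div hls fun t ht => (hl0 t ht).ne')
    fun t ht => by
      have := (hl0 t ht).ne'
      field_simp
      linear_combination -hl2 t ht
  have hc : ∀ t ∈ times Ω, A t = l t * Real.cos (β t) := fun t ht => by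
    rw [← (hβ' t ht).1, mul_div_cancel₀ _ (hl0 t ht).ne']
  have hs : ∀ t ∈ times Ω, B t = -(l t * Real.sin (β t)) := fun t ht => by
    rw [← (hβ' t ht).2, mul_div_cancel₀ _ (hl0 t ht).ne', neg_neg]
  have hγ₂ : ContDiffOn ℝ ∞ (fun t => ε * γ₂' t) (times Ω) := contDiffOn_const.mul hγ₂'
  have hτ0 : ∀ z ∈ base Ω, deriv τ (z 0) ≠ 0 := fun z hz =>
    h.deriv_time _ (mem_times_of_mem_base hz)
  have at_ : ∀ {g : ℝ → ℝ}, ContDiffOn ℝ ∞ g (times Ω) → ∀ t ∈ times Ω, ContDiffAt ℝ ∞ g t :=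
    fun hg t ht => hg.contDiffAt (hΩ.isOpen_times.mem_nhds ht)
  have atb : ∀ {g : ℝ → ℝ}, ContDiffOn ℝ ∞ g (times Ω) → ∀ z ∈ base Ω, ContDiffAt ℝ ∞ g (z 0) :=
    fun hg z hz => at_ hg _ (mem_times_of_mem_base hz)
  obtain ⟨Λ, hΛ, hΛ'⟩ := hΩ.exists_eq_time_of_base (F := fun z => pd 1 (pd 1 χ) z + pd 2 (pd 2 χ) z)
    ((contDiffOn_pd hΩ (contDiffOn_pd hΩ h.smooth_shift 1) 1).add
      (contDiffOn_pd hΩ (contDiffOn_pd hΩ h.smooth_shift 2) 2))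
    (fun z hz => (h.conditions hΩ hz had).2.2.2.1) (fun z hz => (h.conditions hΩ hz had).2.2.2.2)
  -- `Δχ = Λ` must equal the Laplacian of the gauge summand plus `2 σ`; this choice of `σ` leaves a
  -- harmonic remainder `δ`.
  obtain ⟨σ, hσ⟩ : ∃ σ : ℝ → ℝ, σ = fun t =>
    2⁻¹ * Λ t - ε * (l t ^ 2 * (deriv τ t)⁻¹) * deriv β t := ⟨_, rfl⟩
  have hσs : ContDiffOn ℝ ∞ σ (times Ω) := fun t ht => by
    rw [hσ]
    exact ((contDiffAt_const.mul (at_ hΛ t ht)).sub ((contDiffAt_const.mul (((at_ hls t ht).pow 2).mul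
      ((contDiffAt_deriv (at_ h.smooth_time t ht)).inv (h.deriv_time t ht)))).mul
      (contDiffAt_deriv (at_ hβ t ht)))).contDiffWithinAt
  obtain ⟨δ, hδ⟩ : ∃ δ : Base → ℝ, δ = fun z => χ z - gaugeForm ε τ l β γ₁ (fun t => ε * γ₂' t) z
    - σ (z 0) * 2⁻¹ * (z 1 * z 1 + z 2 * z 2) := ⟨_, rfl⟩
  have hgauge : ∀ z ∈ base Ω, ContDiffAt ℝ ∞ (gaugeForm ε τ l β γ₁ (fun t => ε * γ₂' t)) z :=
    fun z hz => contDiffAt_gaugeForm (atb h.smooth_time z hz) (hτ0 z hz) (atb hls z hz)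
      (atb hβ z hz) (atb hγ₁ z hz) (atb hγ₂ z hz)
  have hδs : ∀ z ∈ base Ω, ContDiffAt ℝ ∞ δ z := fun z hz => by
    rw [hδ]
    exact ((h.shift hΩ hz).sub (hgauge z hz)).sub
      (((contDiffAt_time (atb hσs z hz)).mul contDiffAt_const).mul (by fun_prop))
  refine ⟨l, β, γ₁, fun t => ε * γ₂' t, σ, δ, h.sign, h.smooth_time, hls, hβ, hγ₁, hγ₂, hσs,
    fun z hz => (hδs z hz).contDiffWithinAt, hl0, h.deriv_time, fun z hz => ?_, fun p hp => ?_⟩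
  · have e : of δ (hδs z hz) = of χ (h.shift hΩ hz) - of _ (hgauge z hz)
        - tm z σ (atb hσs z hz) * C z 2⁻¹ * (co z 1 * co z 1 + co z 2 * co z 2) := by
      subst hδ
      rfl
    have e₁ := congrArg (fun b => ev z (lap b)) e
    have e₂ := congrArg (ev z) (lap_gaugeForm (ε := ε) (atb h.smooth_time z hz) (hτ0 z hz)
      (atb hls z hz) (atb hβ z hz) (atb hγ₁ z hz) (atb hγ₂ z hz))
    have e₃ := hΛ' z hz
    have e₄ : σ (z 0) = _ := congrFun hσ (z 0)
    simp only [lap_sub] at e₁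
    rw [map_sub, map_sub, e₂] at e₁
    simp only [lap, d_mul, map_add, map_mul, d_one_tm, d_two_tm, d_C, d_co_self, d_one_co_two,
      d_two_co_one, mul_zero, mul_one, add_zero, zero_add, d_of, ev_of, ev_tm, ev_C, map_ofNat,
      map_pow, map_one] at e₁
    rw [e₁, e₃, e₄]
    ring
  · have hz := mem_base hp
    have ht := mem_times hp
    have hκ : κ (p.1 0) = coeffForm ε τ l (p.1 0) := by
      have h₁ := (h.conditions hΩ hz had).2.2.1
      rw [h.ev_scale, hXA _ hz, hXB _ hz, ← hl2 _ ht] at h₁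
      have h₂ := h.deriv_time _ ht
      rw [coeffForm]
      field_simp
      linear_combination h₁
    rw [h.eq p hp, map, hκ, hX _ hz, hY _ hz, hc _ ht, hs _ ht, fstForm, sndForm, shiftForm, hδ]
    refine Prod.ext (funext fun i => ?_) (by simp; ring)
    fin_cases i
    · rfl
    · simp
      ring
    · simp
      linear_combination (-γ₂' (p.1 0)) * hε

end ConformalForm

/-- Admissible transformations are those of the theorem. -/
theorem IsAdmissible.exists_normalForm {Ω : Set Total} {f f' : ArbElem} {φ : Total → Total}
    (h : IsAdmissible Ω f f' φ) (hΩ : LocalDomain Ω) :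
    ∃ (ε : ℝ) (τ l β γ₁ γ₂ σ : ℝ → ℝ) (δ : Base → ℝ), NormalForm Ω φ ε τ l β γ₁ γ₂ σ δ := by
  obtain ⟨ε, τ, X, Y, κ, χ, hc⟩ := h.exists_conformalForm hΩ
  obtain ⟨l, β, γ₁, γ₂, σ, δ, hn⟩ := hc.exists_normalForm hΩ h
  exact ⟨ε, τ, l, β, γ₁, γ₂, σ, δ, hn⟩

/-! ### How arbitrary elements transform. -/

open SGerm

/-- The left hand side of the equation as a function on the jet space. -/
def jetLhs (j : Jet) : ℝ := ζ_t j + D j 0 1 0 * ζ_y j - D j 0 0 1 * ζ_x j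

theorem mem_eqn {f : ArbElem} {j : Jet} : j ∈ f.eqn ↔ arg j ∈ f.dom ∧ jetLhs j = f.H (arg j) :=
  Iff.rfl

/-- The left hand side of the equation is independent of the arguments of the right hand side. -/
theorem exists_jetLhs_eq (j : Jet) (s : ℝ) :
    ∃ j₁ : Jet, pt j₁ = pt j ∧ arg j₁ = arg j ∧ jetLhs j₁ = s := by
  obtain ⟨a, ha⟩ := exists_jet_eq j
  set c : ℝ := (s - lhs a) / 2
  set u : SGerm j.1 := C j.1 c * (SGerm.X j.1 0 * (SGerm.X j.1 1 * SGerm.X j.1 1))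
  have hu : lap u = C j.1 (s - lhs a) * SGerm.X j.1 0 := by
    have h2 : C j.1 (s - lhs a) = C j.1 c * 2 := by
      rw [← map_ofNat (C j.1) 2, ← map_mul]
      congr 1
      simp only [c]
      ring
    rw [h2]
    simp [u, lap, Derivation.leibniz]
    ring
  refine ⟨jet (a + u), ?_, ?_, ?_⟩
  · rw [pt_jet, map_add]
    conv_rhs => rw [← ha, pt_jet]
    simp [u]
  · conv_rhs => rw [← ha]
    rw [arg_jet, arg_jet]
    simp [args, lap_add, hu, Derivation.leibniz]
  · rw [jetLhs, lhs_jet]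
    have h₁ : ev j.1 (d j.1 1 u) = 0 := by simp [u, Derivation.leibniz]
    have h₂ : ev j.1 (d j.1 2 u) = 0 := by simp [u, Derivation.leibniz]
    have h₃ : lhs (a + u) = lhs a + (s - lhs a) := by
      simp only [lhs, lap_add, map_add, hu, h₁, h₂, d_mul, d_C, d_X_self, d_one_X_zero,
        d_two_X_zero, map_mul, ev_X, ev_C, map_one]
      simp
      ring
    rw [h₃]
    ring

theorem arg_jet_congr {j j₁ : Jet} (h : arg j₁ = arg j) :
    j₁.1 = j.1 ∧ ![ζ j₁, ζ_x j₁, ζ_y j₁] = ![ζ j, ζ_x j, ζ_y j] := by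
  refine ⟨congrArg (fun q : Arg => q.1) h, ?_⟩
  have h₀ : ζ j₁ = ζ j := congrArg (fun q : Arg => q.2 0) h
  have h₁ : ζ_x j₁ = ζ_x j := congrArg (fun q : Arg => q.2 1) h
  have h₂ : ζ_y j₁ = ζ_y j := congrArg (fun q : Arg => q.2 2) h
  rw [h₀, h₁, h₂]

namespace NormalForm

variable {Ω : Set Total} {φ : Total → Total} {ε : ℝ} {τ l β γ₁ γ₂ σ : ℝ → ℝ} {δ : Base → ℝ}

/-- Neither formula involves `ψ_x` or `ψ_y` except through the left hand side, which is why such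
transformations keep every equation inside the class. -/
theorem prolong (h : NormalForm Ω φ ε τ l β γ₁ γ₂ σ δ) (hΩ : LocalDomain Ω) {j j' : Jet}
    (hj : Prolong Ω φ j j') : arg j' = argMap ε τ l β γ₁ γ₂ σ (arg j) ∧
      jetLhs j' = elemForm ε τ l β σ δ j.1 ![ζ j, ζ_x j, ζ_y j] (jetLhs j) := by
  have hp := hj.1
  have hc := h.toConformalForm hΩ
  obtain ⟨ψ, hψ, a', e, e', hpt, hm⟩ := hj.mapsGraph (hc.contDiffAt hΩ hp)
  obtain ⟨z, v⟩ := j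
  obtain ⟨z', v'⟩ := j'
  dsimp only at hψ a' e e' hpt hm
  have hp' : (z, ψ z) ∈ Ω := hpt ▸ hp
  have hz : z ∈ base Ω := mem_base hp'
  obtain rfl : ConformalForm.map τ (fstForm l β γ₁) (sndForm ε l β γ₂) z = z' :=
    (hc.graphMap_eq hp').symm.trans hm.choose_spec.choose_spec.choose
  have ha := (hc.mapsGraph_iff hΩ hz hψ hp' a').1 hm
  rw [← e, ← e', arg_jet, arg_jet, jetLhs, jetLhs, lhs_jet, lhs_jet, ζ_jet, ζ_x_jet, ζ_y_jet]
  exact ⟨h.args_eq hΩ hz ha, h.lhs_eq hΩ hz ha⟩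

theorem exists_prolong (h : NormalForm Ω φ ε τ l β γ₁ γ₂ σ δ) (hΩ : LocalDomain Ω) {j : Jet}
    (hj : pt j ∈ Ω) : ∃ j', Prolong Ω φ j j' := by
  have hc := h.toConformalForm hΩ
  have hz : j.1 ∈ base Ω := mem_base hj
  obtain ⟨a, ha⟩ := exists_jet_eq j
  obtain ⟨ψ, hψ, rfl⟩ := a.exists_rep
  have hp : (j.1, ψ j.1) ∈ Ω := by
    rw [← ha, pt_jet] at hj
    exact hj
  obtain ⟨a', ha'⟩ := (hc.pb_bijective hΩ hz).2
    (tm j.1 _ (hc.coeff hΩ hz) * of ψ hψ + of _ (hc.shift hΩ hz))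
  have := ((hc.mapsGraph_iff hΩ hz hψ hp a').2 ha').prolong hp hψ
  rw [ha] at this
  exact ⟨_, this⟩

theorem elemForm_bijective (h : NormalForm Ω φ ε τ l β γ₁ γ₂ σ δ) {z : Base} (hz : z ∈ base Ω)
    (v : Fin 3 → ℝ) : Function.Bijective (elemForm ε τ l β σ δ z v) := by
  have h₁ : ε / deriv τ (z 0) ^ 2 ≠ 0 := by
    have := h.deriv_ne z hz
    have h₃ : ε ≠ 0 := fun h₄ => by simpa [h₄] using h.sign_sq
    positivity
  have h₂ : elemForm ε τ l β σ δ z v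
      = fun H => ε / deriv τ (z 0) ^ 2 * H + elemForm ε τ l β σ δ z v 0 := by
    funext H
    simp only [elemForm]
    ring
  rw [h₂]
  refine ⟨fun a b hab => ?_, fun b => ⟨(b - elemForm ε τ l β σ δ z v 0) / (ε / deriv τ (z 0) ^ 2), ?_⟩⟩
  · exact mul_left_cancel₀ h₁ (add_right_cancel hab)
  · simp only
    rw [mul_div_cancel₀ _ h₁]
    ring

/-- Under an admissible transformation of normal form, arbitrary elements transform as in the
theorem. -/
theorem transforms (h : NormalForm Ω φ ε τ l β γ₁ γ₂ σ δ) (hΩ : LocalDomain Ω) {f f' : ArbElem}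
    (had : IsAdmissible Ω f f' φ) :
    Transforms Ω φ (fun j => elemForm ε τ l β σ δ j.1 ![ζ j, ζ_x j, ζ_y j]) f f' := by
  intro j j' hj
  have hz : j.1 ∈ base Ω := mem_base hj.1
  -- Moving `ζ_t` alone gives the left hand side any value `s` while the arguments, at the source
  -- and at the image, stay the same. The value `f.H (arg j)` puts the jet on the equation.
  have key : ∀ s, ∃ j₁ j₁', Prolong Ω φ j₁ j₁' ∧ arg j₁ = arg j ∧ arg j₁' = arg j' ∧ jetLhs j₁ = s ∧
      jetLhs j₁' = elemForm ε τ l β σ δ j.1 ![ζ j, ζ_x j, ζ_y j] s := by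
    intro s
    obtain ⟨j₁, hpt, harg, hs⟩ := exists_jetLhs_eq j s
    obtain ⟨j₁', hj₁⟩ := h.exists_prolong hΩ (hpt ▸ hj.1 : pt j₁ ∈ Ω)
    obtain ⟨e₁, e₂⟩ := h.prolong hΩ hj₁
    obtain ⟨c₁, c₂⟩ := arg_jet_congr harg
    rw [c₁, c₂, hs] at e₂
    exact ⟨j₁, j₁', hj₁, harg, by rw [e₁, harg, (h.prolong hΩ hj).1], hs, e₂⟩
  have hfwd : arg j ∈ f.dom → arg j' ∈ f'.dom ∧
      f'.H (arg j') = elemForm ε τ l β σ δ j.1 ![ζ j, ζ_x j, ζ_y j] (f.H (arg j)) := by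
    intro hd
    obtain ⟨j₁, j₁', hj₁, e, e', hs, hs'⟩ := key (f.H (arg j))
    have := (had.maps_eqn j₁ j₁' hj₁).1 (mem_eqn.2 ⟨e ▸ hd, by rw [hs, e]⟩)
    rw [mem_eqn, e', hs'] at this
    exact ⟨this.1, this.2.symm⟩
  refine ⟨⟨fun hd => (hfwd hd).1, fun hd => ?_⟩, fun hd => (hfwd hd).2⟩
  -- For the converse, the left hand side is chosen so that the image jet lies on the second
  -- equation.
  obtain ⟨s, hs₀⟩ := (h.elemForm_bijective hz ![ζ j, ζ_x j, ζ_y j]).2 (f'.H (arg j'))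
  obtain ⟨j₁, j₁', hj₁, e, e', hs, hs'⟩ := key s
  have := (had.maps_eqn j₁ j₁' hj₁).2 (mem_eqn.2 ⟨e' ▸ hd, by rw [hs', hs₀, e']⟩)
  exact e ▸ (mem_eqn.1 this).1

end NormalForm

/-- The arbitrary elements over `Ω` that are constant. -/
def constElem {Ω : Set Total} (hΩ : LocalDomain Ω) (c : ℝ) : ArbElem where
  dom := {q | q.1 ∈ base Ω}
  isOpen_dom := hΩ.isOpen_base.preimage continuous_fst
  H _ := c
  smooth := contDiffOn_const

theorem base_constElem {Ω : Set Total} (hΩ : LocalDomain Ω) (c : ℝ) :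
    (constElem hΩ c).base = base Ω :=
  Subset.antisymm (by rintro _ ⟨q, hq, rfl⟩; exact hq) fun z hz => ⟨(z, 0), hz, rfl⟩

/-- Transformations from the equivalence group are those of the theorem. -/
theorem IsEquivTransf.exists_normalForm {Ω : Set Total} {φ : Total → Total} {K : Jet → ℝ → ℝ}
    (h : IsEquivTransf Ω φ K) (hΩ : LocalDomain Ω) :
    ∃ (ε : ℝ) (τ l β γ₁ γ₂ σ : ℝ → ℝ) (δ : Base → ℝ), NormalForm Ω φ ε τ l β γ₁ γ₂ σ δ ∧
      ∀ j : Jet, pt j ∈ Ω → K j = elemForm ε τ l β σ δ j.1 ![ζ j, ζ_x j, ζ_y j] := by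
  obtain ⟨f', -, had⟩ := h.admissible _ (base_constElem hΩ 0)
  obtain ⟨ε, τ, l, β, γ₁, γ₂, σ, δ, hn⟩ := had.exists_normalForm hΩ
  refine ⟨ε, τ, l, β, γ₁, γ₂, σ, δ, hn, fun j hj => funext fun H => ?_⟩
  -- The constant element with value `H` probes `K j` at the prescribed `H`.
  obtain ⟨f', htr, had⟩ := h.admissible _ (base_constElem hΩ H)
  obtain ⟨j', hj'⟩ := hn.exists_prolong hΩ hj
  have hd : arg j ∈ (constElem hΩ H).dom := mem_base hj
  exact ((htr j j' hj').2 hd).symm.trans ((hn.transforms hΩ had j j' hj').2 hd)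

/-! ### Inverting the transformation of the arguments; membership in the equivalence group. -/

open SGerm

/-- Smooth functions without critical points on an interval have smooth inverses. -/
theorem exists_smooth_leftInverse {I : Set ℝ} (hI : IsOpen I) (hI' : IsPreconnected I) {τ : ℝ → ℝ}
    (hτ : ContDiffOn ℝ ∞ τ I) (h0 : ∀ t ∈ I, deriv τ t ≠ 0) :
    IsOpen (τ '' I) ∧ ∃ g : ℝ → ℝ, ContDiffOn ℝ ∞ g (τ '' I) ∧ ∀ t ∈ I, g (τ t) = t := by
  have hat : ∀ t ∈ I, ContDiffAt ℝ ∞ τ t := fun t ht => hτ.contDiffAt (hI.mem_nhds ht)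
  -- Rolle's theorem: equal values would produce a critical point in between.
  have hlt : ∀ a ∈ I, ∀ b ∈ I, a < b → τ a ≠ τ b := by
    intro a ha b hb hab he
    have hsub : Icc a b ⊆ I := hI'.ordConnected.out ha hb
    obtain ⟨c, hc, hc'⟩ := exists_deriv_eq_zero hab (hτ.continuousOn.mono hsub) he
    exact h0 c (hsub (Ioo_subset_Icc_self hc)) hc'
  have hinj : InjOn τ I := by
    intro a ha b hb he
    rcases lt_trichotomy a b with h | h | h
    · exact absurd he (hlt a ha b hb h)
    · exact h
    · exact absurd he.symm (hlt b hb a ha h)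
  have hleft : ∀ t ∈ I, Function.invFunOn τ I (τ t) = t := hinj.leftInvOn_invFunOn
  have hstrict : ∀ t ∈ I, HasStrictDerivAt τ (deriv τ t) t := fun t ht =>
    (hat t ht).hasStrictDerivAt (by simp)
  refine ⟨?_, Function.invFunOn τ I, ?_, hleft⟩
  · rw [isOpen_iff_mem_nhds]
    rintro _ ⟨t, ht, rfl⟩
    rw [← (hstrict t ht).map_nhds_eq (h0 t ht)]
    exact image_mem_map (hI.mem_nhds ht)
  · rintro _ ⟨t, ht, rfl⟩
    have hf' : HasFDerivAt τ
        ((ContinuousLinearEquiv.unitsEquivAut ℝ (Units.mk0 _ (h0 t ht)) : ℝ ≃L[ℝ] ℝ) : ℝ →L[ℝ] ℝ)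
        t := (hstrict t ht).hasDerivAt.hasFDerivAt_equiv (h0 t ht)
    have hs := (hat t ht).to_localInverse hf' (by simp)
    -- Near `τ t` the local inverse takes values in `I`, so injectivity identifies it with the
    -- global one.
    refine (hs.congr_of_eventuallyEq ?_).contDiffWithinAt
    have hst := (hat t ht).hasStrictFDerivAt' hf' (by simp)
    have h₁ : ∀ᶠ y in 𝓝 (τ t), τ (hst.localInverse τ _ t y) = y :=
      hst.eventually_right_inverse
    have h₂ : ∀ᶠ y in 𝓝 (τ t), hst.localInverse τ _ t y ∈ I := by
      have hc : ContinuousAt (hst.localInverse τ _ t) (τ t) := hst.localInverse_continuousAt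
      refine hc.eventually ?_
      rw [hst.localInverse_apply_image]
      exact hI.mem_nhds ht
    filter_upwards [h₁, h₂] with y hy hy'
    have := hleft _ hy'
    rw [hy] at this
    exact this

/-- The action of a rotation of the plane on the second order jets of functions. -/
def rot (c s : ℝ) (w : Fin 6 → ℝ) : Fin 6 → ℝ :=
  ![w 0, c * w 1 - s * w 2, s * w 1 + c * w 2,
    c * c * w 3 - 2 * c * s * w 4 + s * s * w 5,
    c * s * w 3 + (c * c - s * s) * w 4 - c * s * w 5,
    s * s * w 3 + 2 * c * s * w 4 + c * c * w 5]

theorem rot_rot {c s : ℝ} (h : s ^ 2 + c ^ 2 = 1) (w : Fin 6 → ℝ) : rot c (-s) (rot c s w) = w := by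
  funext i
  fin_cases i
  · rfl
  · simp [rot]
    linear_combination w 1 * h
  · simp [rot]
    linear_combination w 2 * h
  · simp [rot]
    linear_combination w 3 * (c ^ 2 + s ^ 2 + 1) * h
  · simp [rot]
    linear_combination w 4 * (c ^ 2 + s ^ 2 + 1) * h
  · simp [rot]
    linear_combination w 5 * (c ^ 2 + s ^ 2 + 1) * h

/-- The scaling factors of the second order jets of the vorticity. -/
def fac (ε r m : ℝ) : Fin 6 → ℝ :=
  ![ε * r, ε * r * m, r * m, ε * r * (m * m), r * (m * m), ε * r * (m * m)]

/-- Splitting into rotation, scaling and shift of `ζ` makes the inverse explicit: each factor is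
inverted on its own. -/
theorem argFib_eq (ε r l c s k : ℝ) (w : Fin 6 → ℝ) :
    argFib ε r l c s k w = fac ε r l⁻¹ * rot c s w + Pi.single 0 k := by
  funext i
  fin_cases i <;> simp [argFib, fac, rot]

theorem fac_mul_fac {ε r l : ℝ} (hε : ε * ε = 1) (hr : r ≠ 0) (hl : l ≠ 0) :
    fac ε r⁻¹ l * fac ε r l⁻¹ = 1 := by
  funext i
  fin_cases i <;> simp [fac] <;> field_simp <;> linear_combination hε

/-- The inverse of the transformation of the arguments of the arbitrary element, in terms of the
inverse `g` of the transformation of time. -/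
def argInv (g : ℝ → ℝ) (ε : ℝ) (τ l β γ₁ γ₂ σ : ℝ → ℝ) (q : Arg) : Arg :=
  let t := g (q.1 0)
  (![t, (l t)⁻¹ * (Real.cos (β t) * (q.1 1 - γ₁ t) + Real.sin (β t) * (ε * q.1 2 - γ₂ t)),
    (l t)⁻¹ * (-Real.sin (β t) * (q.1 1 - γ₁ t) + Real.cos (β t) * (ε * q.1 2 - γ₂ t))],
    rot (Real.cos (β t)) (-Real.sin (β t)) (fac ε (deriv τ t) (l t) * (q.2 - (Pi.single 0
      (2 * ε * (deriv τ t)⁻¹ * deriv β t + 2 * (σ t / l t ^ 2)) : Fin 6 → ℝ))))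

namespace NormalForm

variable {Ω : Set Total} {φ : Total → Total} {ε : ℝ} {τ l β γ₁ γ₂ σ : ℝ → ℝ} {δ : Base → ℝ}
  {g : ℝ → ℝ}

theorem argInv_argMap (h : NormalForm Ω φ ε τ l β γ₁ γ₂ σ δ) (hg : ∀ t ∈ times Ω, g (τ t) = t)
    {q : Arg} (hq : q.1 ∈ base Ω) :
    argInv g ε τ l β γ₁ γ₂ σ (argMap ε τ l β γ₁ γ₂ σ q) = q := by
  obtain ⟨z, w⟩ := q
  have ht := mem_times_of_mem_base hq
  have hcs := Real.sin_sq_add_cos_sq (β (z 0))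
  have hl := h.scale_ne z hq
  have hτ := h.deriv_ne z hq
  have hgz : g ((argMap ε τ l β γ₁ γ₂ σ (z, w)).1 0) = z 0 := hg _ ht
  have hε := h.sign_sq
  simp only [argInv, hgz]
  refine Prod.ext (funext fun i => ?_) ?_
  · fin_cases i
    · rfl
    · simp only [argMap, ConformalForm.map, fstForm, sndForm]
      simp
      field_simp
      linear_combination l (z 0) * z 1 * hcs + Real.sin (β (z 0))
        * (l (z 0) * (z 1 * Real.sin (β (z 0)) + z 2 * Real.cos (β (z 0))) + γ₂ (z 0)) * hε
    · simp only [argMap, ConformalForm.map, fstForm, sndForm]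
      simp
      field_simp
      linear_combination l (z 0) * z 2 * hcs + Real.cos (β (z 0))
        * (l (z 0) * (z 1 * Real.sin (β (z 0)) + z 2 * Real.cos (β (z 0))) + γ₂ (z 0)) * hε
  · simp only [argMap, argFib_eq, add_sub_cancel_right]
    rw [← mul_assoc, show fac ε (deriv τ (z 0)) (l (z 0)) * fac ε (deriv τ (z 0))⁻¹ (l (z 0))⁻¹ = 1
      by simpa using fac_mul_fac h.sign_sq (inv_ne_zero hτ) hl, one_mul, rot_rot hcs]

theorem argMap_argInv (h : NormalForm Ω φ ε τ l β γ₁ γ₂ σ δ) (hg : ∀ t ∈ times Ω, g (τ t) = t)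
    {q : Arg} (hq : q.1 0 ∈ τ '' times Ω) :
    argMap ε τ l β γ₁ γ₂ σ (argInv g ε τ l β γ₁ γ₂ σ q) = q := by
  obtain ⟨z, v⟩ := q
  obtain ⟨t, ht, hz⟩ := hq
  replace hz : τ t = z 0 := hz
  have hcs := Real.sin_sq_add_cos_sq (β t)
  have hl := (h.scale_pos t ht).ne'
  have hτ := h.deriv_time t ht
  have hε := h.sign_sq
  have hgz : g (z 0) = t := by rw [← hz, hg t ht]
  have hgz' : (argInv g ε τ l β γ₁ γ₂ σ (z, v)).1 0 = t := hgz
  simp only [argMap, hgz']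
  refine Prod.ext (funext fun i => ?_) ?_
  · fin_cases i
    · simp only [ConformalForm.map, hgz']
      exact hz
    · simp only [argInv, ConformalForm.map, fstForm, hgz]
      simp
      field_simp
      linear_combination (z 1 - γ₁ t) * hcs
    · simp only [argInv, ConformalForm.map, sndForm, hgz]
      simp
      field_simp
      linear_combination ε * (ε * z 2 - γ₂ t) * hcs + z 2 * hε
  · simp only [argInv, hgz, argFib_eq]
    have h₁ := rot_rot (c := Real.cos (β t)) (s := -Real.sin (β t)) (by rw [neg_sq, hcs])
    rw [neg_neg] at h₁
    rw [h₁, ← mul_assoc, show fac ε (deriv τ t)⁻¹ (l t)⁻¹ * fac ε (deriv τ t) (l t) = 1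
      by simpa using fac_mul_fac h.sign_sq hτ (inv_ne_zero hl), one_mul, sub_add_cancel]

end NormalForm

open SGerm

theorem contDiffAt_fst_time {E : Type*} [NormedAddCommGroup E] [NormedSpace ℝ E] {k : ℝ → ℝ}
    {q : Base × E} (hk : ContDiffAt ℝ ∞ k (q.1 0)) : ContDiffAt ℝ ∞ (fun q : Base × E => k (q.1 0)) q :=
  ContDiffAt.comp (g := k) q hk (by fun_prop)

theorem contDiffAt_rot {E : Type*} [NormedAddCommGroup E] [NormedSpace ℝ E] {c s : E → ℝ}
    {w : E → Fin 6 → ℝ} {x : E} (hc : ContDiffAt ℝ ∞ c x) (hs : ContDiffAt ℝ ∞ s x)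
    (hw : ContDiffAt ℝ ∞ w x) : ContDiffAt ℝ ∞ (fun x => rot (c x) (s x) (w x)) x := by
  have hw' : ∀ i, ContDiffAt ℝ ∞ (fun x => w x i) x := fun i => contDiffAt_pi.1 hw i
  have h0 := hw' 0
  have h1 := hw' 1
  have h2 := hw' 2
  have h3 := hw' 3
  have h4 := hw' 4
  have h5 := hw' 5
  refine contDiffAt_pi.2 fun i => ?_
  fin_cases i <;> simp [rot] <;> fun_prop

theorem contDiffAt_fac {E : Type*} [NormedAddCommGroup E] [NormedSpace ℝ E] {r m : E → ℝ} {x : E}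
    (ε : ℝ) (hr : ContDiffAt ℝ ∞ r x) (hm : ContDiffAt ℝ ∞ m x) :
    ContDiffAt ℝ ∞ (fun x => fac ε (r x) (m x)) x := by
  refine contDiffAt_pi.2 fun i => ?_
  fin_cases i <;> simp [fac] <;> fun_prop

namespace NormalForm

variable {Ω : Set Total} {φ : Total → Total} {ε : ℝ} {τ l β γ₁ γ₂ σ : ℝ → ℝ} {δ : Base → ℝ}
  {g : ℝ → ℝ} {t : ℝ}

theorem contDiffAt_elemForm (h : NormalForm Ω φ ε τ l β γ₁ γ₂ σ δ) (hΩ : LocalDomain Ω)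
    {q : Base × (Fin 3 → ℝ) × ℝ} (hq : q.1 ∈ base Ω) : ContDiffAt ℝ ∞
      (fun q : Base × (Fin 3 → ℝ) × ℝ => elemForm ε τ l β σ δ q.1 q.2.1 q.2.2) q := by
  have hτ := at_time hΩ hq h.smooth_time
  have hl := at_time hΩ hq h.smooth_scale
  have hτ0 := h.deriv_ne _ hq
  have hl0 := h.scale_ne _ hq
  have h₁ := contDiffAt_fst_time (q := q) (contDiffAt_deriv hτ)
  have h₂ := contDiffAt_fst_time (q := q) (contDiffAt_deriv (contDiffAt_deriv hτ))
  have h₃ := contDiffAt_fst_time (q := q) (contDiffAt_deriv hl)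
  have h₄ := contDiffAt_fst_time (q := q) hl
  have h₅ := contDiffAt_fst_time (q := q) (contDiffAt_deriv (at_time hΩ hq h.smooth_angle))
  have h₆ := contDiffAt_fst_time (q := q)
    (contDiffAt_deriv (contDiffAt_deriv (at_time hΩ hq h.smooth_angle)))
  have h₇ := contDiffAt_fst_time (q := q) (at_time hΩ hq h.smooth_vort)
  have h₈ := contDiffAt_fst_time (q := q) (contDiffAt_deriv (h.contDiffAt_ratio hΩ hq))
  have h₉ : ∀ i, ContDiffAt ℝ ∞ (fun q : Base × (Fin 3 → ℝ) × ℝ => pd i δ q.1) q := fun i =>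
    ContDiffAt.comp (g := pd i δ) q (contDiffAt_pd (h.harm hΩ hq) i) contDiffAt_fst
  have key : ∀ T U L Lt B Bt S δ₁ δ₂ N : Base × (Fin 3 → ℝ) × ℝ → ℝ, ContDiffAt ℝ ∞ T q →
      ContDiffAt ℝ ∞ U q → ContDiffAt ℝ ∞ L q → ContDiffAt ℝ ∞ Lt q → ContDiffAt ℝ ∞ B q →
      ContDiffAt ℝ ∞ Bt q → ContDiffAt ℝ ∞ S q → ContDiffAt ℝ ∞ δ₁ q → ContDiffAt ℝ ∞ δ₂ q →
      ContDiffAt ℝ ∞ N q → T q ≠ 0 → L q ≠ 0 → T q ^ 2 ≠ 0 → T q * L q ^ 2 ≠ 0 →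
      ContDiffAt ℝ ∞ (fun q : Base × (Fin 3 → ℝ) × ℝ => ε / T q ^ 2
        * (q.2.2 - U q / T q * q.2.1 0 - Lt q / L q * (q.1 1 * q.2.1 1 + q.1 2 * q.2.1 2)
          + 2 * Bt q - 2 * (U q / T q) * B q)
        - (δ₂ q + S q * q.1 2) / (T q * L q ^ 2) * q.2.1 1
        + (δ₁ q + S q * q.1 1) / (T q * L q ^ 2) * q.2.1 2 + 2 / T q * N q) q := by
    intros
    fun_prop (disch := assumption)
  exact key _ _ _ _ _ _ _ _ _ _ h₁ h₂ h₄ h₃ h₅ h₆ h₇ (h₉ 1) (h₉ 2) h₈ hτ0 hl0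
    (pow_ne_zero 2 hτ0) (mul_ne_zero hτ0 (pow_ne_zero 2 hl0))

theorem contDiffAt_argInv (h : NormalForm Ω φ ε τ l β γ₁ γ₂ σ δ) (hΩ : LocalDomain Ω)
    (hgs : ContDiffAt ℝ ∞ g (τ t)) (hg : g (τ t) = t) (ht : t ∈ times Ω) {q : Arg}
    (hq : q.1 0 = τ t) : ContDiffAt ℝ ∞ (argInv g ε τ l β γ₁ γ₂ σ) q := by
  have hG : ContDiffAt ℝ ∞ (fun q : Arg => g (q.1 0)) q :=
    contDiffAt_fst_time (q := q) (k := g) (by rwa [hq])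
  have key : ∀ {k : ℝ → ℝ}, ContDiffAt ℝ ∞ k t → ContDiffAt ℝ ∞ (fun q : Arg => k (g (q.1 0))) q :=
    fun {k} hk => ContDiffAt.comp (g := k) q (by rwa [hq, hg]) hG
  have hI := hΩ.isOpen_times.mem_nhds ht
  have hτ := contDiffAt_deriv (h.smooth_time.contDiffAt hI)
  have hl := h.smooth_scale.contDiffAt hI
  have h₁ := key hτ
  have hτ0 : deriv τ (g (q.1 0)) ≠ 0 := by
    rw [hq, hg]
    exact h.deriv_time t ht
  have hl0 : l (g (q.1 0)) ≠ 0 := by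
    rw [hq, hg]
    exact (h.scale_pos t ht).ne'
  have h₃ := key hl
  have h₅ := key (h.smooth_angle.contDiffAt hI).cos
  have h₆ := key (h.smooth_angle.contDiffAt hI).sin
  have h₇ := key (contDiffAt_deriv (h.smooth_angle.contDiffAt hI))
  have h₈ := key (h.smooth_fst.contDiffAt hI)
  have h₉ := key (h.smooth_snd.contDiffAt hI)
  have h₁₀ := key (h.smooth_vort.contDiffAt hI)
  have hx : ContDiffAt ℝ ∞ (fun q : Arg => q.1 1 - γ₁ (g (q.1 0))) q :=
    ContDiffAt.sub (by fun_prop) h₈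
  have hy : ContDiffAt ℝ ∞ (fun q : Arg => ε * q.1 2 - γ₂ (g (q.1 0))) q :=
    ContDiffAt.sub (by fun_prop) h₉
  refine ContDiffAt.prodMk (contDiffAt_pi.2 fun i => ?_) (contDiffAt_rot h₅ h₆.neg
    ((contDiffAt_fac ε h₁ h₃).mul (contDiffAt_snd.sub (contDiffAt_pi.2 fun i => ?_))))
  · fin_cases i
    · exact hG
    · exact (h₃.inv hl0).mul ((h₅.mul hx).add (h₆.mul hy))
    · exact (h₃.inv hl0).mul ((h₆.neg.mul hx).add (h₅.mul hy))
  · by_cases hi : i = 0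
    · subst hi
      simp only [Pi.single_eq_same]
      exact ((contDiffAt_const.mul (h₁.inv hτ0)).mul h₇).add
        (contDiffAt_const.mul (h₁₀.div (h₃.pow 2) (pow_ne_zero 2 hl0)))
    · simp only [Pi.single_eq_of_ne hi]
      exact contDiffAt_const

/-- The differential is triangular: injective on the base, with the nonzero coefficient of `ψ` as
its vertical entry. -/
theorem isPointTransf (h : NormalForm Ω φ ε τ l β γ₁ γ₂ σ δ) (hΩ : LocalDomain Ω) :
    IsPointTransf Ω φ := by
  have hc := h.toConformalForm hΩ
  refine ⟨fun p hp => (hc.contDiffAt hΩ hp).contDiffWithinAt, fun p hp => ?_⟩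
  have hz := mem_base hp
  have hd := ((hc.contDiffAt hΩ hp).differentiableAt (by simp)).hasFDerivAt
  have hinj : ∀ v, fderiv ℝ φ p v = 0 → v = 0 := by
    intro v hv
    have hM := ((hc.contDiffAt_map hΩ hz).differentiableAt (by simp)).hasFDerivAt
    have hM' := hM.comp p (hasFDerivAt_fst (p := p))
    have e₁ : (fun q => (φ q).1) =ᶠ[𝓝 p]
        (ConformalForm.map τ (fstForm l β γ₁) (sndForm ε l β γ₂)) ∘ Prod.fst := by
      filter_upwards [hΩ.isOpen.mem_nhds hp] with q hq
      rw [h.eq q hq]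
      rfl
    have h₁ := congrArg (fun L => L v) (hd.fst.unique (hM'.congr_of_eventuallyEq e₁))
    have v₁ : v.1 = 0 := hc.eq_zero_of_fderiv_map hΩ hz (by
      rw [show fderiv ℝ _ p.1 v.1 = (fderiv ℝ φ p v).1 from h₁.symm, hv]
      rfl)
    have hκ := ((hc.coeff hΩ hz).differentiableAt (by simp)).hasDerivAt
    have hline : HasDerivAt (fun y : ℝ => (p.1, p.2 + y)) ((0 : Base), (1 : ℝ)) 0 :=
      (hasDerivAt_const _ _).prodMk ((hasDerivAt_id _).const_add _)
    have h₂ : HasDerivAt (fun y : ℝ => (φ (p.1, p.2 + y)).2) (fderiv ℝ φ p (0, 1)).2 0 := by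
      have hd' : HasFDerivAt φ (fderiv ℝ φ p) (p.1, p.2 + 0) := by simpa using hd
      exact hd'.snd.comp_hasDerivAt (0 : ℝ) hline
    have h₃ : HasDerivAt (fun y : ℝ => coeffForm ε τ l (p.1 0) * (p.2 + y)
        + shiftForm ε τ l β γ₁ γ₂ σ δ p.1) (coeffForm ε τ l (p.1 0) * 1) 0 :=
      (((hasDerivAt_id _).const_add _).const_mul _).add_const _
    have e₂ : (fun y : ℝ => (φ (p.1, p.2 + y)).2) =ᶠ[𝓝 0] fun y =>
        coeffForm ε τ l (p.1 0) * (p.2 + y) + shiftForm ε τ l β γ₁ γ₂ σ δ p.1 := by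
      have hcont : ContinuousAt (fun y : ℝ => (p.1, p.2 + y)) 0 := by fun_prop
      filter_upwards [hcont.preimage_mem_nhds (by simpa using hΩ.isOpen.mem_nhds hp)] with y hy
      rw [h.eq _ hy]
    have h₄ := h₂.unique (h₃.congr_of_eventuallyEq e₂)
    have hv' : v = v.2 • ((0 : Base), (1 : ℝ)) := Prod.ext (by simp [v₁]) (by simp)
    rw [hv', map_smul] at hv
    have h₅ : v.2 * (fderiv ℝ φ p (0, 1)).2 = 0 := congrArg Prod.snd hv
    rw [h₄, mul_one] at h₅
    have v₂ := (mul_eq_zero.1 h₅).resolve_right (hc.coeff_ne_zero _ (mem_times hp))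
    exact Prod.ext v₁ v₂
  have hinj' : Function.Injective (fderiv ℝ φ p : Total →ₗ[ℝ] Total) :=
    (injective_iff_map_eq_zero _).2 hinj
  exact ((LinearEquiv.ofInjectiveEndo _ hinj').isUnit_det').ne_zero

/-- The transformations of the theorem belong to the equivalence group. -/
theorem isEquivTransf (h : NormalForm Ω φ ε τ l β γ₁ γ₂ σ δ) (hΩ : LocalDomain Ω)
    {K : Jet → ℝ → ℝ}
    (hK : ∀ j : Jet, pt j ∈ Ω → K j = elemForm ε τ l β σ δ j.1 ![ζ j, ζ_x j, ζ_y j]) :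
    IsEquivTransf Ω φ K where
  pointTransf := h.isPointTransf hΩ
  smooth := by
    rintro ⟨j, H⟩ ⟨j', hj⟩
    have hs : ContDiffAt ℝ ∞ (fun q : Jet × ℝ =>
        elemForm ε τ l β σ δ q.1.1 ![ζ q.1, ζ_x q.1, ζ_y q.1] q.2) (j, H) := by
      refine ContDiffAt.comp (g := fun q : Base × (Fin 3 → ℝ) × ℝ =>
        elemForm ε τ l β σ δ q.1 q.2.1 q.2.2) (f := fun q : Jet × ℝ =>
        (q.1.1, ![ζ q.1, ζ_x q.1, ζ_y q.1], q.2)) (j, H)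
        (h.contDiffAt_elemForm hΩ (mem_base hj.1)) ?_
      refine contDiffAt_fst.fst.prodMk ((contDiffAt_pi.2 fun i => ?_).prodMk contDiffAt_snd)
      fin_cases i <;> simp [ζ, ζ_x, ζ_y, D] <;> fun_prop
    refine hs.contDiffWithinAt.congr ?_ ?_
    · rintro ⟨j₁, H₁⟩ ⟨j₁', hj₁⟩
      exact congrFun (hK _ hj₁.1) H₁
    · exact congrFun (hK _ hj.1) H
  nondegenerate := by
    rintro j ⟨j', hj⟩ H
    have hz : j.1 ∈ base Ω := mem_base hj.1
    rw [hK j hj.1]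
    have h₂ : elemForm ε τ l β σ δ j.1 ![ζ j, ζ_x j, ζ_y j]
        = fun H => ε / deriv τ (j.1 0) ^ 2 * H
          + elemForm ε τ l β σ δ j.1 ![ζ j, ζ_x j, ζ_y j] 0 := by
      funext H
      simp only [elemForm]
      ring
    rw [h₂, (((hasDerivAt_id' H).const_mul _).add_const _).deriv, mul_one]
    have := h.deriv_ne _ hz
    have h₃ : ε ≠ 0 := fun h₄ => by simpa [h₄] using h.sign_sq
    positivity
  admissible f hf := by
    obtain ⟨hopen, g, hgs, hg⟩ := exists_smooth_leftInverse hΩ.isOpen_times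
      hΩ.isPreconnected_times h.smooth_time h.deriv_time
    have hfb : ∀ q ∈ f.dom, q.1 ∈ base Ω := fun q hq => hf ▸ mem_image_of_mem _ hq
    have hinv : ∀ q ∈ f.dom, argInv g ε τ l β γ₁ γ₂ σ (argMap ε τ l β γ₁ γ₂ σ q) = q :=
      fun q hq => h.argInv_argMap hg (hfb q hq)
    have hinvs : ∀ q : Arg, q.1 0 ∈ τ '' times Ω →
        ContDiffAt ℝ ∞ (argInv g ε τ l β γ₁ γ₂ σ) q := by
      rintro q ⟨t, ht, hq⟩
      exact h.contDiffAt_argInv hΩ (hgs.contDiffAt (hopen.mem_nhds ⟨t, ht, rfl⟩)) (hg t ht) ht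
        hq.symm
    have hmem : ∀ q ∈ f.dom, (argMap ε τ l β γ₁ γ₂ σ q).1 0 ∈ τ '' times Ω := fun q hq =>
      ⟨_, mem_times_of_mem_base (hfb q hq), rfl⟩
    -- The new element is the old one transported by `argMap` with the values changed by `elemForm`.
    -- Its domain is open and it is smooth because `argInv` is a smooth inverse.
    let f' : ArbElem :=
      { dom := argMap ε τ l β γ₁ γ₂ σ '' f.dom
        isOpen_dom := by
          rw [isOpen_iff_mem_nhds]
          rintro _ ⟨q, hq, rfl⟩
          have h₁ : ∀ᶠ q' in 𝓝 (argMap ε τ l β γ₁ γ₂ σ q), argInv g ε τ l β γ₁ γ₂ σ q' ∈ f.dom :=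
            (hinvs _ (hmem q hq)).continuousAt.eventually
              (by rw [hinv q hq]; exact f.isOpen_dom.mem_nhds hq)
          have h₂ : ∀ᶠ q' : Arg in 𝓝 (argMap ε τ l β γ₁ γ₂ σ q), q'.1 0 ∈ τ '' times Ω :=
            (hopen.preimage (by fun_prop : Continuous fun q : Arg => q.1 0)).mem_nhds (hmem q hq)
          filter_upwards [h₁, h₂] with q' h₃ h₄
          exact ⟨_, h₃, h.argMap_argInv hg h₄⟩
        H := fun q' => (fun q : Arg => elemForm ε τ l β σ δ q.1 ![q.2 0, q.2 1, q.2 2] (f.H q))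
          (argInv g ε τ l β γ₁ γ₂ σ q')
        smooth := by
          rintro _ ⟨q, hq, rfl⟩
          have h₁ : ContDiffAt ℝ ∞ (fun q : Arg =>
              elemForm ε τ l β σ δ q.1 ![q.2 0, q.2 1, q.2 2] (f.H q)) q := by
            refine ContDiffAt.comp (g := fun q : Base × (Fin 3 → ℝ) × ℝ =>
              elemForm ε τ l β σ δ q.1 q.2.1 q.2.2) (f := fun q : Arg =>
              (q.1, ![q.2 0, q.2 1, q.2 2], f.H q)) q
              (h.contDiffAt_elemForm hΩ (hfb q hq)) ?_
            refine contDiffAt_fst.prodMk ((contDiffAt_pi.2 fun i => ?_).prodMk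
              (f.smooth.contDiffAt (f.isOpen_dom.mem_nhds hq)))
            fin_cases i <;> simp <;> fun_prop
          rw [← hinv q hq] at h₁
          exact (ContDiffAt.comp _ h₁ (hinvs _ (hmem q hq))).contDiffWithinAt }
    have hH : ∀ q ∈ f.dom, f'.H (argMap ε τ l β γ₁ γ₂ σ q)
        = elemForm ε τ l β σ δ q.1 ![q.2 0, q.2 1, q.2 2] (f.H q) := fun q hq => by
      change (fun q : Arg => elemForm ε τ l β σ δ q.1 ![q.2 0, q.2 1, q.2 2] (f.H q))
          (argInv g ε τ l β γ₁ γ₂ σ (argMap ε τ l β γ₁ γ₂ σ q)) = _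
      rw [hinv q hq]
    have hdom : ∀ j j', Prolong Ω φ j j' → (arg j ∈ f.dom ↔ arg j' ∈ f'.dom) := by
      intro j j' hj
      rw [(h.prolong hΩ hj).1]
      refine ⟨fun hd => mem_image_of_mem _ hd, ?_⟩
      rintro ⟨q, hq, he⟩
      have h₁ := congrArg (argInv g ε τ l β γ₁ γ₂ σ) he
      rw [hinv q hq, h.argInv_argMap hg (q := arg j) (mem_base hj.1)] at h₁
      exact h₁ ▸ hq
    refine ⟨f', fun j j' hj => ⟨hdom j j' hj, fun hd => ?_⟩, h.isPointTransf hΩ, hf, ?_,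
      fun j j' hj => ?_⟩
    · rw [(h.prolong hΩ hj).1, hH _ hd, hK j hj.1]
      rfl
    · have h₁ : base (φ '' Ω)
          = ConformalForm.map τ (fstForm l β γ₁) (sndForm ε l β γ₂) '' base Ω := by
        rw [base, base, image_image, image_image]
        exact image_congr fun p hp => by rw [h.eq p hp]
      rw [h₁, ← hf, ArbElem.base, ArbElem.base, image_image, image_image]
      rfl
    · have hz : j.1 ∈ base Ω := mem_base hj.1
      rw [mem_eqn, mem_eqn, ← hdom j j' hj]
      -- Both sides of the equation pass through the same bijection `elemForm`, so one equality
      -- holds exactly when the other does.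
      refine and_congr_right fun hd => ?_
      obtain ⟨e₁, e₂⟩ := h.prolong hΩ hj
      rw [e₁, e₂, hH _ hd]
      exact ((h.elemForm_bijective hz ![ζ j, ζ_x j, ζ_y j]).1.eq_iff).symm

end NormalForm

/-! ### Normalization and the description of the equivalence group. -/

theorem isNormalized : IsNormalized := by
  intro Ω hΩ f f' φ had
  obtain ⟨ε, τ, l, β, γ₁, γ₂, σ, δ, h⟩ := had.exists_normalForm hΩ
  exact ⟨_, h.isEquivTransf hΩ fun j _ => rfl, h.transforms hΩ had⟩

theorem eq_of_coords (z : Base) : z = ![z 0, z 1, z 2] := by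
  funext i
  fin_cases i <;> rfl

theorem isEquivTransf_iff {Ω : Set Total} (hΩ : LocalDomain Ω) {φ : Total → Total}
    {K : Jet → ℝ → ℝ} :
    IsEquivTransf Ω φ K ↔
      ∃ (ε : ℝ) (τ l β γ₁ γ₂ σ : ℝ → ℝ) (δ : Base → ℝ),
        (ε = 1 ∨ ε = -1) ∧
        ContDiffOn ℝ ∞ τ (times Ω) ∧
        ContDiffOn ℝ ∞ l (times Ω) ∧
        ContDiffOn ℝ ∞ β (times Ω) ∧
        ContDiffOn ℝ ∞ γ₁ (times Ω) ∧
        ContDiffOn ℝ ∞ γ₂ (times Ω) ∧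
        ContDiffOn ℝ ∞ σ (times Ω) ∧
        ContDiffOn ℝ ∞ δ (base Ω) ∧
        (∀ t ∈ times Ω, 0 < l t ∧ deriv τ t ≠ 0) ∧
        (∀ z ∈ base Ω,
          pd 1 (pd 1 δ) z
            + pd 2 (pd 2 δ) z = 0) ∧
        (∀ (t x y ψ : ℝ), ((![t, x, y], ψ) : Total) ∈ Ω →
          (φ (![t, x, y], ψ)).1 0 = τ t ∧
          (φ (![t, x, y], ψ)).1 1
            = l t * (x * Real.cos (β t) - y * Real.sin (β t)) + γ₁ t ∧
          ε * (φ (![t, x, y], ψ)).1 2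
            = l t * (x * Real.sin (β t) + y * Real.cos (β t)) + γ₂ t ∧
          (φ (![t, x, y], ψ)).2
            = ε * (l t / deriv τ t)
                * (l t * ψ + l t / 2 * deriv β t * (x ^ 2 + y ^ 2)
                  - deriv γ₁ t * (x * Real.sin (β t) + y * Real.cos (β t))
                  + deriv γ₂ t * (x * Real.cos (β t) - y * Real.sin (β t)))
              + δ ![t, x, y] + σ t / 2 * (x ^ 2 + y ^ 2)) ∧
        (∀ (j : Jet) (t x y H : ℝ), j.1 = ![t, x, y] →
          pt j ∈ Ω →
          K j H
            = ε / deriv τ t ^ 2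
                * (H - deriv (deriv τ) t / deriv τ t * ζ j
                  - deriv l t / l t * (x * ζ_x j + y * ζ_y j)
                  + 2 * deriv (deriv β) t
                  - 2 * (deriv (deriv τ) t / deriv τ t) * deriv β t)
              - (pd 2 δ ![t, x, y] + σ t * y) / (deriv τ t * l t ^ 2)
                  * ζ_x j
              + (pd 1 δ ![t, x, y] + σ t * x) / (deriv τ t * l t ^ 2)
                  * ζ_y j
              + 2 / deriv τ t * deriv (fun s => σ s / l s ^ 2) t) := by
  constructor
  · intro h
    obtain ⟨ε, τ, l, β, γ₁, γ₂, σ, δ, hn, hK⟩ := h.exists_normalForm hΩ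
    refine ⟨ε, τ, l, β, γ₁, γ₂, σ, δ, hn.sign, hn.smooth_time, hn.smooth_scale, hn.smooth_angle,
      hn.smooth_fst, hn.smooth_snd, hn.smooth_vort, hn.smooth_harm,
      fun t ht => ⟨hn.scale_pos t ht, hn.deriv_time t ht⟩, hn.harmonic, fun t x y ψ hp => ?_,
      fun j t x y H hj hp => ?_⟩
    · have hε := hn.sign_sq
      rw [hn.eq _ hp]
      refine ⟨rfl, rfl, ?_, ?_⟩
      · simp [ConformalForm.map, sndForm]
        linear_combination (l t * (x * Real.sin (β t) + y * Real.cos (β t)) + γ₂ t) * hε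
      · simp [coeffForm, shiftForm, gaugeForm, div_eq_mul_inv]
        ring
    · rw [hK j hp, hj]
      rfl
  · rintro ⟨ε, τ, l, β, γ₁, γ₂, σ, δ, hε, hτ, hl, hβ, h₁, h₂, hσ, hδ, hpos, hharm, hφ, hK⟩
    have hn : NormalForm Ω φ ε τ l β γ₁ γ₂ σ δ :=
      { sign := hε
        smooth_time := hτ
        smooth_scale := hl
        smooth_angle := hβ
        smooth_fst := h₁
        smooth_snd := h₂
        smooth_vort := hσ
        smooth_harm := hδ
        scale_pos := fun t ht => (hpos t ht).1
        deriv_time := fun t ht => (hpos t ht).2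
        harmonic := hharm
        eq := by
          rintro ⟨z, ψ⟩ hp
          have hz := eq_of_coords z
          obtain ⟨e₀, e₁, e₂, e₃⟩ := hφ (z 0) (z 1) (z 2) ψ (by rwa [← hz])
          rw [← hz] at e₀ e₁ e₂ e₃
          have hεε : ε * ε = 1 := by rcases hε with h | h <;> rw [h] <;> norm_num
          refine Prod.ext (funext fun i => ?_) ?_
          · fin_cases i
            · exact e₀
            · exact e₁
            · simp only [ConformalForm.map, sndForm]
              simp
              linear_combination ε * e₂ - (φ (z, ψ)).1 2 * hεε
          · rw [e₃]
            simp only [coeffForm, shiftForm, gaugeForm, div_eq_mul_inv]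
            ring }
    refine hn.isEquivTransf hΩ fun j hj => funext fun H => ?_
    rw [hK j _ _ _ H (eq_of_coords j.1) hj, ← eq_of_coords]
    rfl

end GenVorticity

end

theorem mainTheorem2 :
    GenVorticity.IsNormalized ∧
    ∀ Ω : Set GenVorticity.Total, GenVorticity.LocalDomain Ω →
      ∀ (φ : GenVorticity.Total → GenVorticity.Total) (K : GenVorticity.Jet → ℝ → ℝ),
        GenVorticity.IsEquivTransf Ω φ K ↔
          ∃ (ε : ℝ) (τ l β γ₁ γ₂ σ : ℝ → ℝ) (δ : GenVorticity.Base → ℝ),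
            (ε = 1 ∨ ε = -1) ∧
            ContDiffOn ℝ ∞ τ (GenVorticity.times Ω) ∧
            ContDiffOn ℝ ∞ l (GenVorticity.times Ω) ∧
            ContDiffOn ℝ ∞ β (GenVorticity.times Ω) ∧
            ContDiffOn ℝ ∞ γ₁ (GenVorticity.times Ω) ∧
            ContDiffOn ℝ ∞ γ₂ (GenVorticity.times Ω) ∧
            ContDiffOn ℝ ∞ σ (GenVorticity.times Ω) ∧
            ContDiffOn ℝ ∞ δ (GenVorticity.base Ω) ∧
            (∀ t ∈ GenVorticity.times Ω, 0 < l t ∧ deriv τ t ≠ 0) ∧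
            (∀ z ∈ GenVorticity.base Ω,
              GenVorticity.pd 1 (GenVorticity.pd 1 δ) z
                + GenVorticity.pd 2 (GenVorticity.pd 2 δ) z = 0) ∧
            (∀ (t x y ψ : ℝ), ((![t, x, y], ψ) : GenVorticity.Total) ∈ Ω →
              (φ (![t, x, y], ψ)).1 0 = τ t ∧
              (φ (![t, x, y], ψ)).1 1
                = l t * (x * Real.cos (β t) - y * Real.sin (β t)) + γ₁ t ∧
              ε * (φ (![t, x, y], ψ)).1 2
                = l t * (x * Real.sin (β t) + y * Real.cos (β t)) + γ₂ t ∧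
              (φ (![t, x, y], ψ)).2
                = ε * (l t / deriv τ t)
                    * (l t * ψ + l t / 2 * deriv β t * (x ^ 2 + y ^ 2)
                      - deriv γ₁ t * (x * Real.sin (β t) + y * Real.cos (β t))
                      + deriv γ₂ t * (x * Real.cos (β t) - y * Real.sin (β t)))
                  + δ ![t, x, y] + σ t / 2 * (x ^ 2 + y ^ 2)) ∧
            (∀ (j : GenVorticity.Jet) (t x y H : ℝ), j.1 = ![t, x, y] →
              GenVorticity.pt j ∈ Ω →
              K j H
                = ε / deriv τ t ^ 2
                    * (H - deriv (deriv τ) t / deriv τ t * GenVorticity.ζ j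
                      - deriv l t / l t * (x * GenVorticity.ζ_x j + y * GenVorticity.ζ_y j)
                      + 2 * deriv (deriv β) t
                      - 2 * (deriv (deriv τ) t / deriv τ t) * deriv β t)
                  - (GenVorticity.pd 2 δ ![t, x, y] + σ t * y) / (deriv τ t * l t ^ 2)
                      * GenVorticity.ζ_x j
                  + (GenVorticity.pd 1 δ ![t, x, y] + σ t * x) / (deriv τ t * l t ^ 2)
                      * GenVorticity.ζ_y j
                  + 2 / deriv τ t * deriv (fun s => σ s / l s ^ 2) t) :=
  ⟨GenVorticity.isNormalized, fun _ hΩ _ _ => GenVorticity.isEquivTransf_iff hΩ⟩
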